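/- Let $d\ge 1$. A walk on $\mathbb Z^d$ is a starting point together with a finite sequence of steps $\pm e_1,\dots,\pm e_d$; let $p_0,p_1,\dots,p_m$ be its points and $m=\mathrm{length}(w)$. It is closed if $p_m=p_0$. The multiplicity of $q\in\mathbb Z^d$ is $\mathrm{mu}(q,w)=\delta_{q,p_0}+\delta_{q,p_m}+2\sum_{i=1}^{m-1}\delta_{q,p_i}$; for $k\ge1$ put $N_{2k}(w)=\#\{q:\mathrm{mu}(q,w)=2k\}$ and $\mathrm{ran}(w)=\sum_{k\ge1}N_{2k}(w)$. With the modified Bessel functions $I_\mu$ define, for $|z|<\frac1{2d}$, $$h(p,d,z)=-\delta_{p,0}+\int_0^\infty e^{-y}\prod_{\alpha=1}^d I_{|p^{(\alpha)}|}(2zy)\,dy .$$ **Generating functions.** For every complex $z$ with $|z|<\frac1{2d}$ the integral defining $h(0,d,z)$ converges absolutely, $h(0,d,\cdot)$ is complex differentiable at $z$, $1+h(0,d,z)\notin(-\infty,0]$, and, the sums running over all closed walks $w$ of positive length that start in $0$ and converging absolutely, $$\sum_w N_{2k}(w)z^{\mathrm{length}(w)}=z\,\partial_z\Bigl[\frac1k\Bigl(\frac{h(0,d,z)}{1+h(0,d,z)}\Bigr)^k\Bigr]\quad(k\ge1),\qquad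 \sum_w \mathrm{ran}(w)z^{\mathrm{length}(w)}=z\,\partial_z\log(1+h(0,d,z)).$$ **Values of $h$.** $h(0,1,z)=\frac{1-\sqrt{1-4z^2}}{\sqrt{1-4z^2}}$ for $|z|<\frac12$, and $h(0,2,z)=\frac2\pi K(16z^2)-1$ for $|z|<\frac14$, where $K(m)=\int_0^{\pi/2}(1-m\sin^2\theta)^{-1/2}d\theta$ is the complete elliptic integral as a function of its parameter. For $d>2$, $$h(0,d,\tfrac1{2d})=G(d):=-1+\int_0^\infty I_0(y/d)^d e^{-y}\,dy,$$ the integral converges, $G(d)>0$, and $1/(1+G(d))$ is the probability that the simple random walk never returns to its starting point (the limit as $m\to\infty$ of the proportion of walks of length $m$ from $0$ that do not revisit $0$). **Asymptotics.** Let $E_n(X)$ be the average of $X$ over all closed walks of length $2n$ that start in $0$. For fixed $d$ and $k\ge1$, as $n\to\infty$, $$E_n(N_{2k})=\begin{cases}1+O(1/n)& d=1\\ \dfrac{2n\pi^2}{(\log n)^2}\,\bigl(1+O(1/\log n)\bigr)& d=2\\ 2n\,\dfrac{G(d)^{k-1}}{(1+G(d))^{k+1}}+O(\varepsilon_d(n))&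 d>2,\end{cases}\qquad E_n(\mathrm{ran})=\begin{cases}\sqrt{\pi n}\,(1+O(1/n))& d=1\\ \dfrac{2n\pi}{\log n}\,\bigl(1+O(1/\log n)\bigr)& d=2\\ \dfrac{2n}{1+G(d)}+O(\varepsilon_d(n))& d>2,\end{cases}$$ where $\varepsilon_d(n)=\max(1,n^{2-d/2})$ for $d\ne4$ and $\varepsilon_4(n)=\log n$. The constants in the $O$-terms may depend on $d$ and $k$. -/

import Mathlib

open Filter Topology Asymptotics MeasureTheory
open scoped Nat

/-- A step of a nearest-neighbour walk on `ℤ ^ d`: a coordinate direction together with a sign. -/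
abbrev LatticeStep (d : ℕ) : Type := Fin d × ℤˣ

/-- The unit vector `± e_i` belonging to a step. -/
def LatticeStep.vec {d : ℕ} (s : LatticeStep d) : Fin d → ℤ :=
  Pi.single s.1 (s.2 : ℤ)

/-- A walk on `ℤ ^ d`: a starting point and a finite sequence of steps. -/
structure LatticeWalk (d : ℕ) where
  start : Fin d → ℤ
  length : ℕ
  step : Fin length → LatticeStep d

namespace LatticeWalk

variable {d : ℕ}

/-- The `i`-th point of a walk: the start plus the first `i` steps (`i ≤ length`). -/
def point (w : LatticeWalk d) (i : ℕ) : Fin d → ℤ :=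
  w.start + ∑ j : Fin w.length with j.val < i, (w.step j).vec

/-- A walk is closed if it ends where it starts. -/
def IsClosed (w : LatticeWalk d) : Prop :=
  w.point w.length = w.start

open Classical in
/-- The multiplicity of the point `q` with respect to `w`: the ends of the walk count once,
all intermediate visits count twice. -/
noncomputable def mult (q : Fin d → ℤ) (w : LatticeWalk d) : ℕ :=
  (if q = w.start then 1 else 0) + (if q = w.point w.length then 1 else 0)
    + 2 * ∑ i ∈ Finset.Ico 1 w.length, (if q = w.point i then 1 else 0)

/-- `multRange k w` is `N_{2k}(w)`, the number of lattice points of multiplicity `2 k`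
(for `k ≥ 1`). -/
noncomputable def multRange (k : ℕ) (w : LatticeWalk d) : ℕ :=
  Set.ncard {q : Fin d → ℤ | mult q w = 2 * k}

/-- The range `∑_{k ≥ 1} N_{2k}(w)`; only finitely many terms are nonzero. -/
noncomputable def range (w : LatticeWalk d) : ℕ :=
  ∑ᶠ (k : ℕ) (_ : 1 ≤ k), multRange k w

end LatticeWalk

/-- The closed walks of positive length that start (and end) in `0`. -/
def closedWalks (d : ℕ) : Set (LatticeWalk d) :=
  {w | w.start = 0 ∧ w.IsClosed ∧ 0 < w.length}

open Classical in
/-- The step sequences of the closed walks of length `m` starting in `0`. -/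
noncomputable def closedStepSeqs (d m : ℕ) : Finset (Fin m → LatticeStep d) :=
  {s | (LatticeWalk.mk 0 m s).IsClosed}

/-- `E_n(X)`: the average of `X` over the closed walks of length `2 n` starting in `0`. -/
noncomputable def closedWalkMean (d n : ℕ) (X : LatticeWalk d → ℕ) : ℝ :=
  (∑ s ∈ closedStepSeqs d (2 * n), (X ⟨0, 2 * n, s⟩ : ℝ)) / ((closedStepSeqs d (2 * n)).card : ℝ)

open Classical in
/-- The probability that the simple random walk on `ℤ ^ d` started in `0` does not return to `0`
during its first `m` steps. -/
noncomputable def noReturnProb (d m : ℕ) : ℝ :=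
  (Finset.card {s : Fin m → LatticeStep d |
      ∀ i : ℕ, 1 ≤ i → i ≤ m → (LatticeWalk.mk 0 m s).point i ≠ 0} : ℝ)
    / (Fintype.card (Fin m → LatticeStep d) : ℝ)

/-- The modified Bessel function `I_μ` of the first kind of integer order `μ ≥ 0`, on `ℝ` or `ℂ`. -/
noncomputable def besselI {𝕜 : Type*} [RCLike 𝕜] (μ : ℕ) (x : 𝕜) : 𝕜 :=
  ∑' m : ℕ, (x / 2) ^ (2 * m + μ) / ((m ! : 𝕜) * ((m + μ)! : 𝕜))

/-- The integrand `e^{-y} ∏_α I_{|p_α|}(2 z y)`. -/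
noncomputable def walkIntegrand {d : ℕ} (p : Fin d → ℤ) (z : ℂ) (y : ℝ) : ℂ :=
  (Real.exp (-y) : ℂ) * ∏ α : Fin d, besselI (p α).natAbs (2 * z * (y : ℂ))

/-- The function `h(p, d, z) = -δ_{p,0} + ∫_0^∞ e^{-y} ∏_α I_{|p_α|}(2 z y) dy`. -/
noncomputable def walkH {d : ℕ} (p : Fin d → ℤ) (z : ℂ) : ℂ :=
  -(if p = 0 then 1 else 0) + ∫ y in Set.Ioi (0 : ℝ), walkIntegrand p z y

/-- The integrand `e^{-y} I_0(y / d) ^ d` of `G(d)`. -/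
noncomputable def walkGIntegrand (d : ℕ) (y : ℝ) : ℝ :=
  besselI 0 (y / (d : ℝ)) ^ d * Real.exp (-y)

/-- The constant `G(d) = -1 + ∫_0^∞ I_0(y / d) ^ d e^{-y} dy` (for `d > 2`). -/
noncomputable def walkG (d : ℕ) : ℝ :=
  -1 + ∫ y in Set.Ioi (0 : ℝ), walkGIntegrand d y

/-- The complete elliptic integral of the first kind as a function of the parameter `m`
(the square of the modulus). -/
noncomputable def ellipticK (m : ℂ) : ℂ :=
  ∫ θ in (0 : ℝ)..(Real.pi / 2), 1 / Complex.sqrt (1 - m * ((Real.sin θ : ℝ) : ℂ) ^ 2)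

/-- The error term in dimension `d > 2`: `max (1, n ^ (2 - d / 2))`, with a logarithm in the
critical dimension `d = 4`, in which the two competing powers coincide. -/
noncomputable def transientError (d n : ℕ) : ℝ :=
  if d = 4 then Real.log n else max 1 ((n : ℝ) ^ (2 - (d : ℝ) / 2))

/-! Let `U` and `V` be the generating functions of the probabilities that the simple random walk is
back at `0`, respectively back for the first time, after `m` steps. Cutting a walk at its first
return gives `U * (1 - V) = 1`, and `V ^ k` counts closed walks made of `k` excursions. For a closed
walk of length `m`, `k * N_{2k}` is the number of indices `i < m` whose point is visited exactly `k`
times. Cyclic rotation makes every index equivalent to `i = 0`, so the sum of `N_{2k}` over closed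
walks, divided by `(2 * d) ^ m`, is `m / k` times a coefficient of `V ^ k` (`mul_sum_multRange`,
`coeff_firstReturnSeries_pow`). This is the operator `X * d/dX` applied to `V ^ k / k`; summed over
`k` it gives the same operator applied to `-log (1 - V) = log U`. Formally the logarithm is avoided
through `V' = U' * (1 - V) ^ 2`.

To see that `1 + h(0, d, z) = U (2 * d * z)`, Fourier inversion on the torus identifies the
exponential generating function of closed walks as `I_0 (2 * z) ^ d`, and integration against `e ^
(-y)` turns it into the ordinary one. Since `V` has nonnegative coefficients, `‖V‖ < 1` on the disc,
so `U = 1 / (1 - V)` has positive real part there.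

For the moments, pass to the series in the number of pairs of steps, with coefficients `u_n` and
`f_n`. Each mean is `2 / u_n` times a coefficient of `X * U' * B`, where `B` is `1 - V` for the
range and `(1 - V) ^ 2 * V ^ (k - 1)` for the multiplicities. Everything rests on `n * u_n`, the
coefficients of `X * U'`, varying slowly.

If `d > 2`, then `u_n` has order `n ^ (-d / 2)`, `B` is absolutely summable, and the convolution is
`n * u_n * B(1)` up to a controlled error (`exists_convolution_bound`, `transient_isBigO`).

If `d = 1`, then `U = (1 - X) ^ (-1 / 2)`; the numerators become explicit and Wallis' product gives
the size of `u_n`.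

If `d = 2`, then `u_n` is the square of the one-dimensional value, so `n * u_n = 1 / π + O(1 / n)`
and the convolution becomes a partial sum of `B`. The tails `r_n = 1 - (f_0 + ... + f_n)` satisfy `U
* R = 1 / (1 - X)`, whence `r_n = π / log n + O(1 / (log n) ^ 2)`. The identity for `n * f_n` then
gives `f_n = O(1 / (n * (log n) ^ 2))`, which suffices to show that `R * (1 - V)` behaves like `r_n
^ 2` and that further factors `V`, of total mass `1`, leave the leading term unchanged. -/

open Finset.HasAntidiagonal (antidiagonal mem_antidiagonal)

/-! ### Step sequences -/

section StepSequences

variable {d : ℕ}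

/-- The sum of the first `i` steps. -/
def stepSum {m : ℕ} (s : Fin m → LatticeStep d) (i : ℕ) : Fin d → ℤ :=
  ∑ j : Fin m, if j.val < i then (s j).vec else 0

/-- The number of indices `i < m` at which the walk from `0` with `m` steps is at `q`. -/
def visitCount {m : ℕ} (s : Fin m → LatticeStep d) (q : Fin d → ℤ) : ℕ :=
  ((Finset.range m).filter fun i => stepSum s i = q).card

/-- The walk from `0` returns to `0` for the first time after `j` steps. -/
def FirstReturnAt {m : ℕ} (s : Fin m → LatticeStep d) (j : ℕ) : Prop :=
  0 < j ∧ stepSum s j = 0 ∧ ∀ i, 0 < i → i < j → stepSum s i ≠ 0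

theorem LatticeWalk.point_mk_zero {m : ℕ} (s : Fin m → LatticeStep d) (i : ℕ) :
    (LatticeWalk.mk 0 m s).point i = stepSum s i := by
  simp [LatticeWalk.point, stepSum, Finset.sum_filter]

theorem stepSum_zero {m : ℕ} (s : Fin m → LatticeStep d) : stepSum s 0 = 0 := by
  simp [stepSum]

theorem stepSum_of_le {m : ℕ} (s : Fin m → LatticeStep d) {i : ℕ} (h : m ≤ i) :
    stepSum s i = ∑ j, (s j).vec := by
  unfold stepSum
  exact Finset.sum_congr rfl fun j _ => if_pos (j.2.trans_le h)

theorem isClosed_mk_zero {m : ℕ} (s : Fin m → LatticeStep d) :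
    (LatticeWalk.mk 0 m s).IsClosed ↔ stepSum s m = 0 := by
  unfold LatticeWalk.IsClosed
  rw [LatticeWalk.point_mk_zero]

theorem mem_closedStepSeqs {m : ℕ} {s : Fin m → LatticeStep d} :
    s ∈ closedStepSeqs d m ↔ stepSum s m = 0 := by
  simp [closedStepSeqs, isClosed_mk_zero]

theorem stepSum_append {a b : ℕ} (u : Fin a → LatticeStep d) (v : Fin b → LatticeStep d) (i : ℕ) :
    stepSum (Fin.append u v) i = stepSum u i + stepSum v (i - a) := by
  unfold stepSum
  rw [Fin.sum_univ_add]
  congr 1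
  · exact Finset.sum_congr rfl fun j _ => by simp
  · refine Finset.sum_congr rfl fun j _ => ?_
    have : (Fin.natAdd a j).val < i ↔ j.val < i - a := by simp; omega
    simp only [this, Fin.append_right]

theorem stepSum_append_left {a b : ℕ} (u : Fin a → LatticeStep d) (v : Fin b → LatticeStep d)
    {i : ℕ} (h : i ≤ a) : stepSum (Fin.append u v) i = stepSum u i := by
  rw [stepSum_append, Nat.sub_eq_zero_of_le h, stepSum_zero, add_zero]

theorem stepSum_append_right {a b : ℕ} (u : Fin a → LatticeStep d) (v : Fin b → LatticeStep d)
    (i : ℕ) : stepSum (Fin.append u v) (a + i) = stepSum u a + stepSum v i := by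
  rw [stepSum_append, Nat.add_sub_cancel_left, stepSum_of_le u (Nat.le_add_right a i),
    stepSum_of_le u le_rfl]

theorem firstReturnAt_append {a b : ℕ} (u : Fin a → LatticeStep d) (v : Fin b → LatticeStep d) :
    FirstReturnAt (Fin.append u v) a ↔ FirstReturnAt u a := by
  unfold FirstReturnAt
  rw [stepSum_append_left u v le_rfl]
  refine and_congr_right fun _ => and_congr_right fun _ => ?_
  refine forall_congr' fun i => imp_congr_right fun _ => forall_congr' fun h => ?_
  rw [stepSum_append_left u v h.le]

/-- The count of `u` leaves out its last index, so the return at time `a` is counted once, as the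
start of `v`. -/
theorem FirstReturnAt.visitCount_append {a b : ℕ} {u : Fin a → LatticeStep d}
    (hu : FirstReturnAt u a) (v : Fin b → LatticeStep d) :
    visitCount (Fin.append u v) 0 = visitCount v 0 + 1 := by
  obtain ⟨ha, hu0, hne⟩ := hu
  unfold visitCount
  simp only [Finset.card_filter]
  rw [Finset.sum_range_add, add_comm]
  congr 1
  · refine Finset.sum_congr rfl fun i _ => ?_
    rw [stepSum_append_right, hu0, zero_add]
  · rw [Finset.sum_eq_single_of_mem 0 (Finset.mem_range.2 ha)]
    · simp [stepSum_zero]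
    · intro i hi h0
      rw [stepSum_append_left u v (Finset.mem_range.1 hi).le,
        if_neg (hne i (Nat.pos_of_ne_zero h0) (Finset.mem_range.1 hi))]

theorem card_filter_append {α : Type*} [Fintype α] {a b : ℕ} (p : (Fin a → α) → Prop)
    (q : (Fin b → α) → Prop) (r : (Fin (a + b) → α) → Prop)
    [DecidablePred p] [DecidablePred q] [DecidablePred r]
    (h : ∀ u v, r (Fin.append u v) ↔ p u ∧ q v) :
    (Finset.univ.filter r).card = (Finset.univ.filter p).card * (Finset.univ.filter q).card := by
  rw [← Finset.card_product]
  symm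
  refine Finset.card_equiv (Fin.appendEquiv a b) fun x => ?_
  simp [Fin.appendEquiv, h]

open Classical in
/-- The number of step sequences of length `m` with first return to `0` after `m` steps. -/
noncomputable def firstReturnCount (d m : ℕ) : ℕ :=
  (Finset.univ.filter fun s : Fin m → LatticeStep d => FirstReturnAt s m).card

open Classical in
theorem card_firstReturnAt_and {a b : ℕ} (q : (Fin b → LatticeStep d) → Prop)
    (r : (Fin (a + b) → LatticeStep d) → Prop)
    (h : ∀ u v, FirstReturnAt u a → (r (Fin.append u v) ↔ q v)) :
    (Finset.univ.filter fun s : Fin (a + b) → LatticeStep d => FirstReturnAt s a ∧ r s).card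
      = firstReturnCount d a * (Finset.univ.filter q).card := by
  unfold firstReturnCount
  refine card_filter_append (α := LatticeStep d) _ _ _ fun u v => ?_
  rw [firstReturnAt_append]
  exact and_congr_right fun hu => h u v hu

theorem FirstReturnAt.unique {m : ℕ} {s : Fin m → LatticeStep d} {i j : ℕ}
    (hi : FirstReturnAt s i) (hj : FirstReturnAt s j) : i = j := by
  rcases lt_trichotomy i j with h | h | h
  · exact absurd hi.2.1 (hj.2.2 i hi.1 h)
  · exact h
  · exact absurd hj.2.1 (hi.2.2 j hj.1 h)

theorem exists_firstReturnAt {m : ℕ} {s : Fin m → LatticeStep d} {n : ℕ} (hn : 0 < n)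
    (h : stepSum s n = 0) : ∃ j ≤ n, FirstReturnAt s j := by
  classical
  have hex : ∃ j, 0 < j ∧ stepSum s j = 0 := ⟨n, hn, h⟩
  refine ⟨Nat.find hex, Nat.find_min' hex ⟨hn, h⟩, (Nat.find_spec hex).1, (Nat.find_spec hex).2, ?_⟩
  intro i hi hlt h0
  exact Nat.find_min hex hlt ⟨hi, h0⟩

open Classical in
theorem card_eq_sum_firstReturnAt {m : ℕ} (r : (Fin m → LatticeStep d) → Prop) :
    (Finset.univ.filter r).card
      = (Finset.univ.filter fun s => (∀ i, 1 ≤ i → i ≤ m → stepSum s i ≠ 0) ∧ r s).card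
        + ∑ j ∈ Finset.range (m + 1), (Finset.univ.filter fun s => FirstReturnAt s j ∧ r s).card := by
  simp only [Finset.card_filter]
  rw [Finset.sum_comm, ← Finset.sum_add_distrib]
  refine Finset.sum_congr rfl fun s _ => ?_
  by_cases hr : r s
  swap
  · simp [hr]
  simp only [hr, and_true, if_true]
  by_cases hN : ∀ i, 1 ≤ i → i ≤ m → stepSum s i ≠ 0
  · rw [if_pos hN, Finset.sum_eq_zero, add_zero]
    intro j hj
    exact if_neg fun hF => hN j hF.1 (Nat.lt_succ_iff.1 (Finset.mem_range.1 hj)) hF.2.1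
  · rw [if_neg hN, zero_add]
    push Not at hN
    obtain ⟨i, hi1, him, hi0⟩ := hN
    obtain ⟨j, hj, hF⟩ := exists_firstReturnAt hi1 hi0
    rw [Finset.sum_eq_single_of_mem j (Finset.mem_range.2 (by omega)), if_pos hF]
    intro b _ hb
    exact if_neg fun hFb => hb (hFb.unique hF)

-- The renewal principle for an arbitrary property. It yields the recursions for closed sequences
-- and for visit counts, and, with the trivial property, the probability of no return.
open Classical in
theorem card_eq_sum_firstReturnCount (r : (m : ℕ) → (Fin m → LatticeStep d) → Prop)
    (r' : (m : ℕ) → (Fin m → LatticeStep d) → Prop)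
    (h : ∀ a b (u : Fin a → LatticeStep d) (v : Fin b → LatticeStep d), FirstReturnAt u a →
      (r (a + b) (Fin.append u v) ↔ r' b v)) (m : ℕ) :
    (Finset.univ.filter (r m)).card
      = (Finset.univ.filter fun s : Fin m → LatticeStep d =>
          (∀ i, 1 ≤ i → i ≤ m → stepSum s i ≠ 0) ∧ r m s).card
        + ∑ x ∈ antidiagonal m,
          firstReturnCount d x.1 * (Finset.univ.filter (r' x.2)).card := by
  rw [card_eq_sum_firstReturnAt, Finset.Nat.sum_antidiagonal_eq_sum_range_succ
    (fun a b => firstReturnCount d a * (Finset.univ.filter (r' b)).card)]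
  congr 1
  refine Finset.sum_congr rfl fun j hj => ?_
  obtain ⟨l, rfl⟩ := Nat.exists_eq_add_of_le (Nat.lt_succ_iff.1 (Finset.mem_range.1 hj))
  rw [Nat.add_sub_cancel_left]
  exact card_firstReturnAt_and _ _ fun u v hu => h j l u v hu

open Classical in
theorem card_eq_sum_firstReturnCount_of_return (r r' : (m : ℕ) → (Fin m → LatticeStep d) → Prop)
    (h : ∀ a b (u : Fin a → LatticeStep d) (v : Fin b → LatticeStep d), FirstReturnAt u a →
      (r (a + b) (Fin.append u v) ↔ r' b v)) (m : ℕ)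
    (hr : ∀ s, r m s → 0 < m ∧ stepSum s m = 0) :
    (Finset.univ.filter (r m)).card
      = ∑ x ∈ antidiagonal m, firstReturnCount d x.1 * (Finset.univ.filter (r' x.2)).card := by
  refine (card_eq_sum_firstReturnCount r r' h m).trans ?_
  simp only [add_eq_right, Finset.card_eq_zero, Finset.filter_eq_empty_iff]
  exact fun s _ hs => hs.1 m (hr s hs.2).1 le_rfl (hr s hs.2).2

theorem stepSum_append_total {a b : ℕ} {u : Fin a → LatticeStep d} (hu : FirstReturnAt u a)
    (v : Fin b → LatticeStep d) : stepSum (Fin.append u v) (a + b) = stepSum v b := by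
  rw [stepSum_append_right, hu.2.1, zero_add]

theorem firstReturnCount_zero : firstReturnCount d 0 = 0 := by
  classical
  unfold firstReturnCount
  rw [Finset.card_eq_zero, Finset.filter_eq_empty_iff]
  exact fun s _ h => lt_irrefl _ h.1

theorem card_closedStepSeqs_eq_filter (m : ℕ) : (closedStepSeqs d m).card =
    (Finset.univ.filter fun s : Fin m → LatticeStep d => stepSum s m = 0).card := by
  congr 1
  ext s
  simp [mem_closedStepSeqs]

theorem card_closedStepSeqs_zero : (closedStepSeqs d 0).card = 1 := by
  rw [card_closedStepSeqs_eq_filter, Finset.filter_true_of_mem fun s _ => stepSum_zero s]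
  simp

theorem firstReturnCount_le (m : ℕ) : firstReturnCount d m ≤ (closedStepSeqs d m).card := by
  rw [card_closedStepSeqs_eq_filter]
  unfold firstReturnCount
  exact Finset.card_le_card fun s hs => by
    simp only [Finset.mem_filter, Finset.mem_univ, true_and] at hs ⊢
    exact hs.2.1

theorem card_closedStepSeqs_eq_sum {m : ℕ} (hm : 0 < m) : (closedStepSeqs d m).card =
    ∑ x ∈ antidiagonal m, firstReturnCount d x.1 * (closedStepSeqs d x.2).card := by
  classical
  simp only [card_closedStepSeqs_eq_filter]
  convert card_eq_sum_firstReturnCount_of_return (d := d)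
    (fun m s => stepSum s m = 0) (fun m s => stepSum s m = 0)
    (fun a b u v hu => by rw [stepSum_append_total hu]) m fun s hs => ⟨hm, hs⟩

/-- The number of closed step sequences of length `m` with exactly `k` visits of `0`
before the last step. -/
def closedVisitCount (d k m : ℕ) : ℕ :=
  (Finset.univ.filter fun s : Fin m → LatticeStep d => stepSum s m = 0 ∧ visitCount s 0 = k).card

theorem visitCount_pos {m : ℕ} (hm : 0 < m) (s : Fin m → LatticeStep d) : 0 < visitCount s 0 :=
  Finset.card_pos.2 ⟨0, by simp [hm, stepSum_zero]⟩

theorem visitCount_le {m : ℕ} (s : Fin m → LatticeStep d) (q : Fin d → ℤ) : visitCount s q ≤ m :=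
  (Finset.card_filter_le _ _).trans (Finset.card_range m).le

theorem closedVisitCount_zero (m : ℕ) : closedVisitCount d 0 m = if m = 0 then 1 else 0 := by
  unfold closedVisitCount
  split_ifs with h
  · subst h
    rw [Finset.filter_true_of_mem fun s _ => ⟨stepSum_zero s, by simp [visitCount]⟩]
    simp
  · rw [Finset.card_eq_zero, Finset.filter_eq_empty_iff]
    exact fun s _ hs => (visitCount_pos (Nat.pos_of_ne_zero h) s).ne' hs.2

theorem closedVisitCount_succ (k m : ℕ) : closedVisitCount d (k + 1) m =
    ∑ x ∈ antidiagonal m, firstReturnCount d x.1 * closedVisitCount d k x.2 := by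
  classical
  unfold closedVisitCount
  convert card_eq_sum_firstReturnCount_of_return (d := d)
    (fun m s => stepSum s m = 0 ∧ visitCount s 0 = k + 1)
    (fun m s => stepSum s m = 0 ∧ visitCount s 0 = k)
    (fun a b u v hu => by
      rw [stepSum_append_total hu, hu.visitCount_append, Nat.add_right_cancel_iff]) m
    fun s hs => ⟨Nat.pos_of_ne_zero ?_, hs.1⟩
  rintro rfl
  simp [visitCount] at hs

/-- Kept free of division, so that it also covers `d = 0` with `m > 0`, where there are no step
sequences. -/
theorem noReturnProb_mul_eq (m : ℕ) : (Fintype.card (Fin m → LatticeStep d) : ℝ) =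
    noReturnProb d m * (Fintype.card (Fin m → LatticeStep d) : ℝ)
      + ∑ x ∈ antidiagonal m, (firstReturnCount d x.1 : ℝ)
        * (Fintype.card (Fin x.2 → LatticeStep d) : ℝ) := by
  classical
  have h := card_eq_sum_firstReturnCount (d := d) (fun _ _ => True) (fun _ _ => True)
    (fun _ _ _ _ _ => Iff.rfl) m
  simp only [Finset.filter_true, Finset.card_univ, and_true] at h
  by_cases h0 : (Fintype.card (Fin m → LatticeStep d) : ℝ) = 0
  · have h1 : Fintype.card (Fin m → LatticeStep d) = 0 := by exact_mod_cast h0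
    rw [h1] at h
    have h2 := (Nat.add_eq_zero_iff.1 h.symm).2
    rw [h0, mul_zero, zero_add]
    exact_mod_cast h2.symm
  · unfold noReturnProb
    rw [div_mul_cancel₀ _ h0]
    simp only [LatticeWalk.point_mk_zero]
    exact_mod_cast h

end StepSequences

/-! ### Cyclic rotation of closed walks and the count of points of given multiplicity -/

section Rotation

variable {d : ℕ}

/-- The sequence of step vectors, continued by `0`. -/
def extendedVec {m : ℕ} (s : Fin m → LatticeStep d) (i : ℕ) : Fin d → ℤ :=
  if h : i < m then (s ⟨i, h⟩).vec else 0

theorem stepSum_eq_sum_range {m : ℕ} (s : Fin m → LatticeStep d) {i : ℕ} (hi : i ≤ m) :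
    stepSum s i = ∑ j ∈ Finset.range i, extendedVec s j := by
  have h : ∀ j : Fin m, (if j.val < i then (s j).vec else 0)
      = (fun j : ℕ => if j < i then extendedVec s j else 0) j.val := by
    intro j
    simp [extendedVec]
  unfold stepSum
  rw [Finset.sum_congr rfl fun j _ => h j,
    Fin.sum_univ_eq_sum_range (fun j : ℕ => if j < i then extendedVec s j else 0), ← Finset.sum_filter]
  congr 1
  ext j
  simp only [Finset.mem_filter, Finset.mem_range]
  omega

theorem stepSum_rotate {n : ℕ} (s : Fin (n + 1) → LatticeStep d) {i : ℕ} (hi : i ≤ n) :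
    stepSum (s ∘ finRotate (n + 1)) i + stepSum s 1 = stepSum s (i + 1) := by
  rw [stepSum_eq_sum_range _ (by omega), stepSum_eq_sum_range s (by omega),
    stepSum_eq_sum_range s (by omega), Finset.sum_range_succ' _ i, Finset.sum_range_one]
  congr 1
  refine Finset.sum_congr rfl fun j hj => ?_
  have hj' : j < n := (Finset.mem_range.1 hj).trans_le hi
  unfold extendedVec
  rw [dif_pos (by omega), dif_pos (by omega)]
  exact congrArg (fun j => (s j).vec) (finRotate_of_lt hj')

theorem stepSum_rotate_total {n : ℕ} (s : Fin (n + 1) → LatticeStep d) :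
    stepSum (s ∘ finRotate (n + 1)) (n + 1) = stepSum s (n + 1) := by
  rw [stepSum_of_le _ le_rfl, stepSum_of_le _ le_rfl]
  exact Equiv.sum_comp (finRotate (n + 1)) fun j => (s j).vec

/-- Rotation drops index `0` and gains index `n + 1`; closedness puts the walk at `0` at both, so no
visit is lost. -/
theorem visitCount_rotate {n : ℕ} {s : Fin (n + 1) → LatticeStep d} (hs : stepSum s (n + 1) = 0)
    (q : Fin d → ℤ) :
    visitCount (s ∘ finRotate (n + 1)) q = visitCount s (q + stepSum s 1) := by
  unfold visitCount
  simp only [Finset.card_filter]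
  rw [Finset.sum_range_succ' (fun i => if stepSum s i = q + stepSum s 1 then 1 else 0),
    Finset.sum_range_succ]
  have h : ∀ i ≤ n, (stepSum (s ∘ finRotate (n + 1)) i = q ↔
      stepSum s (i + 1) = q + stepSum s 1) := fun i hi => by
    rw [← stepSum_rotate s hi, add_left_inj]
  congr 1
  · exact Finset.sum_congr rfl fun i hi => by rw [if_congr (h i (Finset.mem_range.1 hi).le) rfl rfl]
  · rw [if_congr (h n le_rfl) rfl rfl, hs, stepSum_zero]

/-- The closed step sequences of length `m` whose `i`-th point is visited `k` times. -/
def visitedAt (d m k i : ℕ) : Finset (Fin m → LatticeStep d) :=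
  Finset.univ.filter fun s => stepSum s m = 0 ∧ visitCount s (stepSum s i) = k

theorem card_visitedAt_succ {m k i : ℕ} (hi : i < m) :
    (visitedAt d m k (i + 1)).card = (visitedAt d m k i).card := by
  obtain ⟨n, rfl⟩ : ∃ n, m = n + 1 := ⟨m - 1, by omega⟩
  refine Finset.card_equiv (Equiv.arrowCongr (finRotate (n + 1)).symm (Equiv.refl _)) fun s => ?_
  have h : (Equiv.arrowCongr (finRotate (n + 1)).symm (Equiv.refl (LatticeStep d))) s
      = s ∘ finRotate (n + 1) := rfl
  rw [h]
  simp only [visitedAt, Finset.mem_filter, Finset.mem_univ, true_and, stepSum_rotate_total]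
  refine and_congr_right fun hs => ?_
  rw [visitCount_rotate hs, stepSum_rotate s (by omega)]

theorem card_visitedAt {m k i : ℕ} (hi : i ≤ m) :
    (visitedAt d m k i).card = closedVisitCount d k m := by
  induction i with
  | zero =>
    unfold visitedAt closedVisitCount
    simp only [stepSum_zero]
  | succ i ih => rw [card_visitedAt_succ (by omega), ih (by omega)]

/-- In a closed walk the two ends, each of weight one, fall on the same point and together act as a
single intermediate visit at index `0`. -/
theorem mult_mk_zero {m : ℕ} (hm : 0 < m) {s : Fin m → LatticeStep d} (hs : stepSum s m = 0)
    (q : Fin d → ℤ) : LatticeWalk.mult q ⟨0, m, s⟩ = 2 * visitCount s q := by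
  unfold LatticeWalk.mult visitCount
  simp only [LatticeWalk.point_mk_zero, hs, Finset.card_filter]
  rw [Finset.range_eq_Ico, Finset.sum_eq_sum_Ico_succ_bot hm, stepSum_zero, mul_add]
  simp only [eq_comm (a := q), zero_add, mul_ite, mul_one, mul_zero, Finset.mul_sum]
  split_ifs <;> rfl

theorem multRange_mk_zero {m : ℕ} (hm : 0 < m) {s : Fin m → LatticeStep d} (hs : stepSum s m = 0)
    {k : ℕ} (hk : 1 ≤ k) : LatticeWalk.multRange k ⟨0, m, s⟩ =
      (((Finset.range m).image (stepSum s)).filter fun q => visitCount s q = k).card := by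
  unfold LatticeWalk.multRange
  rw [← Set.ncard_coe_finset]
  congr 1
  ext q
  simp only [mult_mk_zero hm hs, Set.mem_ofPred_eq, Finset.coe_filter, Finset.mem_image,
    Finset.mem_range]
  constructor
  · intro h
    have h1 : visitCount s q = k := by omega
    refine ⟨?_, h1⟩
    have h2 : 0 < visitCount s q := by omega
    obtain ⟨i, hi⟩ := Finset.card_pos.1 h2
    exact ⟨i, Finset.mem_range.1 (Finset.mem_filter.1 hi).1, (Finset.mem_filter.1 hi).2⟩
  · exact fun h => by rw [h.2]

/-- Double counting: every point of multiplicity `2 * k` is hit by exactly `k` of the indices below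
`m`. -/
theorem mul_multRange_mk_zero {m : ℕ} (hm : 0 < m) {s : Fin m → LatticeStep d}
    (hs : stepSum s m = 0) {k : ℕ} (hk : 1 ≤ k) : k * LatticeWalk.multRange k ⟨0, m, s⟩ =
      ((Finset.range m).filter fun i => visitCount s (stepSum s i) = k).card := by
  rw [multRange_mk_zero hm hs hk]
  rw [Finset.card_eq_sum_card_fiberwise (f := stepSum s)
    (t := ((Finset.range m).image (stepSum s)).filter fun q => visitCount s q = k)]
  · rw [Finset.sum_const_nat (m := k), mul_comm]
    intro q hq
    have hq' := (Finset.mem_filter.1 hq).2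
    rw [Finset.filter_filter]
    conv_rhs => rw [← hq']
    unfold visitCount
    congr 1
    ext i
    simp only [Finset.mem_filter, Finset.mem_range]
    constructor
    · exact fun h => ⟨h.1, h.2.2⟩
    · rintro ⟨h1, h2⟩
      refine ⟨h1, ?_, h2⟩
      rw [h2]
      exact hq'
  · intro i hi
    simp only [Finset.coe_filter, Finset.mem_range, Set.mem_ofPred_eq, Finset.mem_image] at hi ⊢
    exact ⟨⟨i, hi.1, rfl⟩, hi.2⟩

theorem range_mk_zero {m : ℕ} (hm : 0 < m) {s : Fin m → LatticeStep d} (hs : stepSum s m = 0) :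
    LatticeWalk.range ⟨0, m, s⟩
      = ∑ k ∈ Finset.Icc 1 m, LatticeWalk.multRange k ⟨0, m, s⟩ := by
  unfold LatticeWalk.range
  refine finsum_mem_eq_sum_of_inter_support_eq (s := {k | 1 ≤ k}) _ ?_
  ext k
  simp only [Set.mem_inter_iff, Set.mem_ofPred_eq, Function.mem_support, Finset.coe_Icc,
    Set.mem_Icc]
  refine and_congr_left fun hk => ⟨fun h1 => ⟨h1, ?_⟩, fun h1 => h1.1⟩
  by_contra hlt
  refine hk ?_
  rw [multRange_mk_zero hm hs h1, Finset.card_eq_zero, Finset.filter_eq_empty_iff]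
  intro q _ hq
  exact hlt (hq ▸ visitCount_le s q)

/-- Exchange the sums over walks and indices. By rotation invariance (`card_visitedAt`) all `m`
indices contribute the same number. -/
theorem mul_sum_multRange {m : ℕ} (hm : 0 < m) {k : ℕ} (hk : 1 ≤ k) :
    k * ∑ s ∈ closedStepSeqs d m, LatticeWalk.multRange k ⟨0, m, s⟩
      = m * closedVisitCount d k m := by
  rw [Finset.mul_sum, Finset.sum_congr rfl fun s hs =>
    mul_multRange_mk_zero hm (mem_closedStepSeqs.1 hs) hk]
  simp only [Finset.card_filter]
  rw [Finset.sum_comm]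
  have h : ∀ i ∈ Finset.range m, ∑ s ∈ closedStepSeqs d m,
      (if visitCount s (stepSum s i) = k then 1 else 0) = closedVisitCount d k m := by
    intro i hi
    rw [← card_visitedAt (Finset.mem_range.1 hi).le, ← Finset.card_filter]
    congr 1
    ext s
    simp [visitedAt, mem_closedStepSeqs]
  rw [Finset.sum_congr rfl h, Finset.sum_const, Finset.card_range, smul_eq_mul]

theorem even_of_stepSum_eq_zero {m : ℕ} {s : Fin m → LatticeStep d} (hs : stepSum s m = 0) :
    Even m := by
  -- The coordinate sum modulo `2` is a homomorphism that takes the value `1` on every step.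
  let ψ : (Fin d → ℤ) →+ ZMod 2 :=
    { toFun := fun v => ∑ i, (v i : ZMod 2)
      map_zero' := by simp
      map_add' := fun v w => by simp [Finset.sum_add_distrib] }
  have hψ : ∀ t : LatticeStep d, ψ t.vec = 1 := by
    rintro ⟨i, e⟩
    change ∑ j, ((Pi.single i (e : ℤ) : Fin d → ℤ) j : ZMod 2) = 1
    rw [Finset.sum_eq_single i]
    · rcases Int.units_eq_one_or e with rfl | rfl
      · simp
      · simp
    · intro j _ hj
      simp [Pi.single_eq_of_ne hj]
    · simp
  rw [stepSum_of_le s le_rfl] at hs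
  have h := congrArg ψ hs
  rw [map_sum, map_zero] at h
  simp only [hψ, Finset.sum_const, Finset.card_univ, Fintype.card_fin, nsmul_eq_mul, mul_one] at h
  exact (ZMod.natCast_eq_zero_iff_even).1 h

theorem card_closedStepSeqs_of_odd {m : ℕ} (hm : ¬ Even m) : (closedStepSeqs d m).card = 0 := by
  rw [Finset.card_eq_zero, Finset.eq_empty_iff_forall_notMem]
  exact fun s hs => hm (even_of_stepSum_eq_zero (mem_closedStepSeqs.1 hs))

end Rotation

/-! ### Formal renewal identities -/

section Renewal

open PowerSeries

variable {U V : ℝ⟦X⟧}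

/-- Formally `V = 1 - 1 / U`, so `V' = U' / U ^ 2`, and `1 / U = 1 - V`. -/
theorem derivative_of_renewal (h : U * (1 - V) = 1) :
    derivative ℝ V = derivative ℝ U * (1 - V) ^ 2 := by
  have h1 := congrArg (derivative ℝ) h
  rw [Derivation.leibniz, map_sub, Derivation.map_one_eq_zero, zero_sub, smul_eq_mul,
    smul_eq_mul] at h1
  linear_combination (-derivative ℝ V) * h - (1 - V) * h1

theorem coeff_X_mul_derivative (A : ℝ⟦X⟧) (n : ℕ) :
    coeff n (X * derivative ℝ A) = n * coeff n A := by
  cases n with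
  | zero => simp
  | succ n =>
    rw [coeff_succ_X_mul, coeff_derivative, mul_comm]
    push_cast
    ring

/-- The left side is a coefficient of `X * (V ^ k)' / k`. Exchanging `V'` for `U'` matters for the
asymptotics: the coefficients of `X * U'` are regular, while those of `V'` are not known beforehand.
-/
theorem coeff_pow_of_renewal (h : U * (1 - V) = 1) {k : ℕ} (hk : 1 ≤ k) (n : ℕ) :
    (n : ℝ) / k * coeff n (V ^ k)
      = coeff n (X * derivative ℝ U * ((1 - V) ^ 2 * V ^ (k - 1))) := by
  have hk0 : (k : ℝ) ≠ 0 := by positivity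
  have h1 : X * derivative ℝ (V ^ k)
      = (k : ℝ) • (X * derivative ℝ U * ((1 - V) ^ 2 * V ^ (k - 1))) := by
    rw [derivative_pow, derivative_of_renewal h, smul_eq_C_mul, map_natCast]
    ring
  have h2 := congrArg (coeff n) h1
  rw [coeff_X_mul_derivative, coeff_smul, smul_eq_mul] at h2
  rw [div_mul_eq_mul_div, h2, mul_div_cancel_left₀ _ hk0]

theorem coeff_mul_pow_of_lt (hV : constantCoeff V = 0) (A : ℝ⟦X⟧) {n K : ℕ} (hK : n < K) :
    coeff n (A * V ^ K) = 0 :=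
  X_pow_dvd_iff.1 (Dvd.dvd.mul_left (pow_dvd_pow_of_dvd (X_dvd_iff.2 hV) K) A) n hK

theorem sum_coeff_pow_of_renewal (h : U * (1 - V) = 1) (hV : constantCoeff V = 0) {n K : ℕ}
    (hK : n ≤ K) :
    ∑ k ∈ Finset.Icc 1 K, (n : ℝ) / k * coeff n (V ^ k)
      = coeff n (X * derivative ℝ U * (1 - V)) := by
  have h1 : ∀ k ∈ Finset.Icc 1 K, (n : ℝ) / k * coeff n (V ^ k)
      = coeff n (X * derivative ℝ U * ((1 - V) ^ 2 * V ^ (k - 1))) := fun k hk =>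
    coeff_pow_of_renewal h (Finset.mem_Icc.1 hk).1 n
  have h2 : (1 - V) * ∑ i ∈ Finset.range K, V ^ i = 1 - V ^ K := by
    rw [mul_comm]
    linear_combination -(geom_sum_mul V K)
  have h3 : ∑ i ∈ Finset.range K, X * derivative ℝ U * ((1 - V) ^ 2 * V ^ i)
      = X * derivative ℝ U * (1 - V) - X * derivative ℝ U * (1 - V) * V ^ K := by
    rw [← Finset.mul_sum, ← Finset.mul_sum]
    linear_combination (X * derivative ℝ U * (1 - V)) * h2
  rw [Finset.sum_congr rfl h1, ← map_sum]
  have h4 : ∑ k ∈ Finset.Icc 1 K, X * derivative ℝ U * ((1 - V) ^ 2 * V ^ (k - 1))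
      = ∑ i ∈ Finset.range K, X * derivative ℝ U * ((1 - V) ^ 2 * V ^ i) := by
    rw [show Finset.Icc 1 K = Finset.Ico 1 (K + 1) by ext; simp,
      Finset.sum_Ico_eq_sum_range]
    exact Finset.sum_congr rfl fun i _ => by rw [Nat.add_sub_cancel_left]
  rw [h4, h3, map_sub, sub_eq_self]
  -- The remainder of the geometric sum has order at least `K + 1`, thanks to the extra factor `X`;
  -- hence `n ≤ K` suffices.
  have h6 : X * derivative ℝ U * (1 - V) * V ^ K = X * (derivative ℝ U * (1 - V) * V ^ K) := by
    ring
  rw [h6]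
  cases n with
  | zero => simp
  | succ n => rw [coeff_succ_X_mul, coeff_mul_pow_of_lt hV _ (by omega)]

/-- The series formed by the coefficients of even index. -/
noncomputable def evenPart (A : ℝ⟦X⟧) : ℝ⟦X⟧ := PowerSeries.mk fun n => coeff (2 * n) A

theorem coeff_evenPart (A : ℝ⟦X⟧) (n : ℕ) : coeff n (evenPart A) = coeff (2 * n) A :=
  coeff_mk _ _

/-- When `A` has only even terms, an even coefficient of the product involves `B` at even indices
only, so nothing is required of `B`. -/
theorem evenPart_mul {A B : ℝ⟦X⟧} (hA : ∀ m, ¬ Even m → coeff m A = 0) :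
    evenPart (A * B) = evenPart A * evenPart B := by
  ext n
  rw [coeff_evenPart, coeff_mul, coeff_mul]
  simp only [coeff_evenPart]
  symm
  refine Finset.sum_of_injOn (fun x => (2 * x.1, 2 * x.2)) ?_ ?_ ?_ ?_
  · intro x _ y _ h
    simp only [Prod.mk.injEq] at h
    ext <;> omega
  · intro x hx
    simp only [Finset.mem_coe, mem_antidiagonal] at hx ⊢
    omega
  · intro x hx hx2
    rw [hA x.1, zero_mul]
    rintro ⟨r, hr⟩
    rw [mem_antidiagonal] at hx
    refine hx2 ⟨(r, n - r), ?_, ?_⟩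
    · simp only [Finset.mem_coe, mem_antidiagonal]; omega
    · ext <;> simp only <;> omega
  · intro x _
    rfl

theorem evenPart_one : evenPart 1 = 1 := by
  ext n
  rw [coeff_evenPart, coeff_one, coeff_one]
  simp

theorem evenPart_pow {A : ℝ⟦X⟧} (hA : ∀ m, ¬ Even m → coeff m A = 0) (k : ℕ) :
    evenPart (A ^ k) = evenPart A ^ k := by
  induction k with
  | zero => simp [evenPart_one]
  | succ k ih => rw [pow_succ', pow_succ', evenPart_mul hA, ih]

end Renewal

/-! ### Return probabilities -/

section ReturnProbabilities

open PowerSeries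

variable (d : ℕ)

/-- The generating function of the probabilities to be at the starting point after `m` steps. -/
noncomputable def returnSeries : ℝ⟦X⟧ :=
  PowerSeries.mk fun m => ((closedStepSeqs d m).card : ℝ) / (2 * d : ℝ) ^ m

/-- The generating function of the probabilities to return for the first time after `m` steps. -/
noncomputable def firstReturnSeries : ℝ⟦X⟧ :=
  PowerSeries.mk fun m => (firstReturnCount d m : ℝ) / (2 * d : ℝ) ^ m

theorem coeff_returnSeries (m : ℕ) :
    coeff m (returnSeries d) = ((closedStepSeqs d m).card : ℝ) / (2 * d : ℝ) ^ m := coeff_mk _ _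

theorem coeff_firstReturnSeries (m : ℕ) :
    coeff m (firstReturnSeries d) = (firstReturnCount d m : ℝ) / (2 * d : ℝ) ^ m := coeff_mk _ _

theorem sum_antidiagonal_div_pow (f g : ℕ → ℕ) (c : ℝ) (m : ℕ) :
    ((∑ x ∈ antidiagonal m, f x.1 * g x.2 : ℕ) : ℝ) / c ^ m
      = ∑ x ∈ antidiagonal m, ((f x.1 : ℝ) / c ^ x.1) * ((g x.2 : ℝ) / c ^ x.2) := by
  push_cast
  rw [Finset.sum_div]
  refine Finset.sum_congr rfl fun x hx => ?_
  rw [← mem_antidiagonal.1 hx, pow_add, mul_div_mul_comm]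

theorem returnSeries_renewal : returnSeries d * (1 - firstReturnSeries d) = 1 := by
  have h : returnSeries d = 1 + firstReturnSeries d * returnSeries d := by
    ext m
    rw [map_add, coeff_mul, coeff_one]
    simp only [coeff_returnSeries, coeff_firstReturnSeries]
    rcases Nat.eq_zero_or_pos m with rfl | hm
    · simp [card_closedStepSeqs_zero, firstReturnCount_zero]
    · rw [if_neg hm.ne', zero_add, card_closedStepSeqs_eq_sum hm]
      exact sum_antidiagonal_div_pow (firstReturnCount d) (fun l => (closedStepSeqs d l).card) _ m
  linear_combination h

theorem constantCoeff_firstReturnSeries : constantCoeff (firstReturnSeries d) = 0 := by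
  rw [← coeff_zero_eq_constantCoeff_apply, coeff_firstReturnSeries, firstReturnCount_zero]
  simp

theorem coeff_zero_returnSeries : coeff 0 (returnSeries d) = 1 := by
  rw [coeff_returnSeries, card_closedStepSeqs_zero]
  simp

theorem coeff_firstReturnSeries_nonneg (m : ℕ) : 0 ≤ coeff m (firstReturnSeries d) := by
  rw [coeff_firstReturnSeries]
  positivity

theorem coeff_firstReturnSeries_le (m : ℕ) :
    coeff m (firstReturnSeries d) ≤ coeff m (returnSeries d) := by
  rw [coeff_firstReturnSeries, coeff_returnSeries]
  gcongr
  exact firstReturnCount_le m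

theorem card_stepSeqs (m : ℕ) : Fintype.card (Fin m → LatticeStep d) = (2 * d) ^ m := by
  simp [LatticeStep, mul_comm]

theorem coeff_returnSeries_le_one (m : ℕ) : coeff m (returnSeries d) ≤ 1 := by
  rw [coeff_returnSeries]
  refine div_le_one_of_le₀ ?_ (by positivity)
  have h := Finset.card_le_univ (closedStepSeqs d m)
  rw [card_stepSeqs] at h
  exact_mod_cast h

theorem coeff_returnSeries_nonneg (m : ℕ) : 0 ≤ coeff m (returnSeries d) := by
  rw [coeff_returnSeries]
  positivity

theorem coeff_returnSeries_of_odd {m : ℕ} (hm : ¬ Even m) : coeff m (returnSeries d) = 0 := by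
  rw [coeff_returnSeries, card_closedStepSeqs_of_odd hm]
  simp

theorem coeff_firstReturnSeries_of_odd (m : ℕ) (hm : ¬ Even m) :
    coeff m (firstReturnSeries d) = 0 :=
  le_antisymm ((coeff_firstReturnSeries_le d m).trans (coeff_returnSeries_of_odd d hm).le)
    (coeff_firstReturnSeries_nonneg d m)

/-- A closed walk with `k` visits of `0` before its end is a concatenation of `k` excursions. -/
theorem coeff_firstReturnSeries_pow (k m : ℕ) :
    coeff m (firstReturnSeries d ^ k) = (closedVisitCount d k m : ℝ) / (2 * d : ℝ) ^ m := by
  induction k generalizing m with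
  | zero =>
    rw [pow_zero, coeff_one, closedVisitCount_zero]
    split_ifs with h
    · simp [h]
    · simp
  | succ k ih =>
    rw [pow_succ', coeff_mul, closedVisitCount_succ, sum_antidiagonal_div_pow]
    simp only [ih, coeff_firstReturnSeries]

variable {d}

theorem sum_multRange_div {m : ℕ} (hm : 0 < m) {k : ℕ} (hk : 1 ≤ k) :
    (∑ s ∈ closedStepSeqs d m, (LatticeWalk.multRange k ⟨0, m, s⟩ : ℝ)) / (2 * d : ℝ) ^ m
      = (m : ℝ) / k * coeff m (firstReturnSeries d ^ k) := by
  have h : (k : ℝ) * ∑ s ∈ closedStepSeqs d m, (LatticeWalk.multRange k ⟨0, m, s⟩ : ℝ)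
      = m * closedVisitCount d k m := by exact_mod_cast mul_sum_multRange hm hk
  have hk0 : (k : ℝ) ≠ 0 := by positivity
  rw [coeff_firstReturnSeries_pow, div_mul_div_comm, ← h, mul_div_mul_left _ _ hk0]

theorem sum_range_div {m : ℕ} (hm : 0 < m) :
    (∑ s ∈ closedStepSeqs d m, (LatticeWalk.range ⟨0, m, s⟩ : ℝ)) / (2 * d : ℝ) ^ m
      = ∑ k ∈ Finset.Icc 1 m, (m : ℝ) / k * coeff m (firstReturnSeries d ^ k) := by
  rw [← Finset.sum_congr rfl fun k hk => sum_multRange_div hm (Finset.mem_Icc.1 hk).1,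
    ← Finset.sum_div, Finset.sum_comm]
  congr 1
  refine Finset.sum_congr rfl fun s hs => ?_
  rw [range_mk_zero hm (mem_closedStepSeqs.1 hs)]
  push_cast
  rfl

theorem noReturnProb_eq (hd : 1 ≤ d) (m : ℕ) :
    noReturnProb d m = 1 - ∑ j ∈ Finset.range (m + 1), coeff j (firstReturnSeries d) := by
  have h := noReturnProb_mul_eq (d := d) m
  simp only [card_stepSeqs] at h
  push_cast at h
  have hc : (2 * d : ℝ) ≠ 0 := by positivity
  have h2 : ∑ x ∈ antidiagonal m, (firstReturnCount d x.1 : ℝ) * (2 * d : ℝ) ^ x.2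
      = (∑ j ∈ Finset.range (m + 1), coeff j (firstReturnSeries d)) * (2 * d : ℝ) ^ m := by
    rw [Finset.sum_mul, Finset.Nat.sum_antidiagonal_eq_sum_range_succ
      fun a b => (firstReturnCount d a : ℝ) * (2 * d : ℝ) ^ b]
    refine Finset.sum_congr rfl fun j hj => ?_
    rw [coeff_firstReturnSeries, pow_sub₀ _ hc (Nat.lt_succ_iff.1 (Finset.mem_range.1 hj))]
    ring
  rw [h2] at h
  have h3 : (2 * d : ℝ) ^ m ≠ 0 := pow_ne_zero _ hc
  field_simp at h
  linarith

end ReturnProbabilities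

/-! ### Fourier representation of the return probabilities -/

section Fourier

/-- The uniform probability measure on `(-π, π]`. -/
noncomputable def circleUniform : Measure ℝ :=
  ENNReal.ofReal (2 * Real.pi)⁻¹ • volume.restrict (Set.Ioc (-Real.pi) Real.pi)

instance : IsProbabilityMeasure circleUniform := by
  constructor
  unfold circleUniform
  rw [Measure.smul_apply, Measure.restrict_apply_univ, Real.volume_Ioc, smul_eq_mul,
    ← ENNReal.ofReal_mul (by positivity)]
  have := Real.pi_pos
  rw [show (2 * Real.pi)⁻¹ * (Real.pi - -Real.pi) = 1 by field_simp; ring, ENNReal.ofReal_one]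

theorem integral_circleUniform {E : Type*} [NormedAddCommGroup E] [NormedSpace ℝ E] (f : ℝ → E) :
    ∫ x, f x ∂circleUniform = (2 * Real.pi)⁻¹ • ∫ x in (-Real.pi)..Real.pi, f x := by
  unfold circleUniform
  rw [integral_smul_measure, ENNReal.toReal_ofReal (by positivity),
    intervalIntegral.integral_of_le (by linarith [Real.pi_pos])]

theorem integral_character (k : ℤ) :
    ∫ x : ℝ, Complex.exp ((k * Complex.I) * x) ∂circleUniform = if k = 0 then 1 else 0 := by
  split_ifs with h
  · simp [h]
  · rw [integral_circleUniform, integral_exp_mul_complex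
      (mul_ne_zero (Int.cast_ne_zero.2 h) Complex.I_ne_zero)]
    have h1 : Complex.exp (k * Complex.I * (Real.pi : ℂ))
        = Complex.exp (k * Complex.I * ((-Real.pi : ℝ) : ℂ)) := by
      rw [Complex.exp_eq_exp_iff_exists_int]
      exact ⟨k, by push_cast; ring⟩
    rw [h1, sub_self, zero_div, smul_zero]

/-- The sum of the exponentials of all steps at the frequency `θ`. -/
noncomputable def stepCos {d : ℕ} (θ : Fin d → ℝ) : ℝ := ∑ i, 2 * Real.cos (θ i)

theorem continuous_stepCos {d : ℕ} : Continuous (stepCos (d := d)) := by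
  unfold stepCos
  fun_prop

theorem abs_stepCos_le {d : ℕ} (θ : Fin d → ℝ) : |stepCos θ| ≤ 2 * d := by
  unfold stepCos
  refine (Finset.abs_sum_le_sum_abs _ _).trans ((Finset.sum_le_card_nsmul _ _ 2 fun i _ => ?_).trans
    ?_)
  · rw [abs_mul, abs_two]
    linarith [Real.abs_cos_le_one (θ i)]
  · simp [mul_comm]

/-- The uniform probability measure on the `d`-dimensional torus. -/
noncomputable def torusUniform (d : ℕ) : Measure (Fin d → ℝ) := Measure.pi fun _ => circleUniform

instance (d : ℕ) : IsProbabilityMeasure (torusUniform d) := by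
  unfold torusUniform
  infer_instance

theorem integral_torus_character {d : ℕ} (k : Fin d → ℤ) :
    ∫ θ, ∏ i, Complex.exp ((k i * Complex.I) * (θ i : ℝ)) ∂(torusUniform d)
      = if k = 0 then 1 else 0 := by
  unfold torusUniform
  rw [integral_fintype_prod_eq_prod (𝕜 := ℂ) fun i x => Complex.exp ((k i * Complex.I) * (x : ℝ))]
  simp only [integral_character]
  split_ifs with h
  · simp [h]
  · obtain ⟨i, hi⟩ := Function.ne_iff.1 h
    exact Finset.prod_eq_zero (Finset.mem_univ i) (if_neg hi)

theorem stepCos_eq_sum {d : ℕ} (θ : Fin d → ℝ) : (stepCos θ : ℂ)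
    = ∑ s : LatticeStep d, ∏ i, Complex.exp ((s.vec i * Complex.I) * (θ i : ℝ)) := by
  have h : ∀ s : LatticeStep d, ∏ i, Complex.exp ((s.vec i * Complex.I) * (θ i : ℝ))
      = Complex.exp (((s.2 : ℤ) * Complex.I) * (θ s.1 : ℝ)) := by
    intro s
    rw [Finset.prod_eq_single s.1]
    · simp [LatticeStep.vec]
    · intro j _ hj
      simp [LatticeStep.vec, Pi.single_eq_of_ne hj]
    · simp
  simp only [h]
  rw [Fintype.sum_prod_type]
  unfold stepCos
  push_cast
  refine Finset.sum_congr rfl fun i _ => ?_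
  rw [Complex.two_cos]
  have h2 : (Finset.univ : Finset ℤˣ) = {1, -1} := rfl
  rw [h2, Finset.sum_pair (by decide)]
  simp [mul_comm]

theorem stepCos_pow_eq_sum {d : ℕ} (θ : Fin d → ℝ) (m : ℕ) : (stepCos θ : ℂ) ^ m
    = ∑ s : Fin m → LatticeStep d,
        ∏ i, Complex.exp (((stepSum s m i : ℤ) * Complex.I) * (θ i : ℝ)) := by
  rw [stepCos_eq_sum, Fintype.sum_pow]
  refine Finset.sum_congr rfl fun s _ => ?_
  rw [Finset.prod_comm]
  refine Finset.prod_congr rfl fun i _ => ?_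
  rw [← Complex.exp_sum, stepSum_of_le s le_rfl, Finset.sum_apply, Int.cast_sum, Finset.sum_mul,
    Finset.sum_mul]

/-- Expanding the power gives one character per step sequence, with the endpoint as frequency;
integration keeps those with endpoint `0`. -/
theorem card_closedStepSeqs_eq_integral (d m : ℕ) :
    ((closedStepSeqs d m).card : ℝ) = ∫ θ, stepCos θ ^ m ∂(torusUniform d) := by
  have h : ((closedStepSeqs d m).card : ℂ) = ∫ θ, ((stepCos θ ^ m : ℝ) : ℂ) ∂(torusUniform d) := by
    push_cast
    simp only [stepCos_pow_eq_sum]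
    rw [integral_finsetSum]
    · simp only [integral_torus_character]
      rw [Finset.sum_ite, Finset.sum_const_zero, add_zero, Finset.sum_const,
        card_closedStepSeqs_eq_filter]
      simp
    · intro s _
      refine Integrable.of_bound (C := 1) ?_ (ae_of_all _ fun θ => ?_)
      · exact Continuous.aestronglyMeasurable (by fun_prop)
      · rw [norm_prod]
        refine (Finset.prod_le_one (fun i _ => norm_nonneg _) fun i _ => ?_)
        rw [Complex.norm_exp]
        simp
  rw [integral_complex_ofReal] at h
  exact_mod_cast h

theorem integral_two_cos_pow (m : ℕ) : ∫ x, (2 * Real.cos x) ^ m ∂circleUniform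
    = if Even m then ((m / 2).centralBinom : ℝ) else 0 := by
  have h : ∫ x, (((2 * Real.cos x) ^ m : ℝ) : ℂ) ∂circleUniform
      = ((if Even m then ((m / 2).centralBinom : ℝ) else 0 : ℝ) : ℂ) := by
    have h1 : ∀ x : ℝ, (((2 * Real.cos x) ^ m : ℝ) : ℂ) = ∑ j ∈ Finset.range (m + 1),
        (m.choose j : ℂ) * Complex.exp (((2 * j - m : ℤ) * Complex.I) * x) := by
      intro x
      push_cast
      rw [Complex.two_cos, add_pow]
      refine Finset.sum_congr rfl fun j hj => ?_
      rw [← Complex.exp_nat_mul, ← Complex.exp_nat_mul, ← Complex.exp_add, mul_comm]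
      congr 2
      rw [Nat.cast_sub (Nat.lt_succ_iff.1 (Finset.mem_range.1 hj))]
      ring
    simp only [h1]
    rw [integral_finsetSum]
    · simp only [integral_const_mul, integral_character]
      split_ifs with he
      · obtain ⟨n, rfl⟩ := he
        rw [Finset.sum_eq_single n]
        · rw [if_pos (by push_cast; ring), show (n + n) / 2 = n by omega, Nat.centralBinom, two_mul]
          simp
        · intro b _ hb
          rw [if_neg, mul_zero]
          push_cast
          omega
        · intro hn
          exact absurd (Finset.mem_range.2 (by omega)) hn
      · rw [Finset.sum_eq_zero]
        · simp
        · intro b _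
          rw [if_neg, mul_zero]
          intro hb
          exact he ⟨b, by omega⟩
    · intro j _
      refine Integrable.const_mul ?_ _
      refine Integrable.of_bound (C := 1) ?_ (ae_of_all _ fun θ => ?_)
      · exact Continuous.aestronglyMeasurable (by fun_prop)
      · rw [Complex.norm_exp]
        simp
  rw [integral_complex_ofReal] at h
  exact_mod_cast h

theorem card_closedStepSeqs_one (n : ℕ) : (closedStepSeqs 1 (2 * n)).card = n.centralBinom := by
  have h : ((closedStepSeqs 1 (2 * n)).card : ℝ) = n.centralBinom := by
    rw [card_closedStepSeqs_eq_integral]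
    have h1 : ∀ θ : Fin 1 → ℝ, stepCos θ ^ (2 * n) = ∏ i, (2 * Real.cos (θ i)) ^ (2 * n) := by
      intro θ
      simp [stepCos]
    simp only [h1]
    unfold torusUniform
    rw [integral_fintype_prod_eq_prod (𝕜 := ℝ) fun _ x => (2 * Real.cos x) ^ (2 * n)]
    simp [integral_two_cos_pow]
  exact_mod_cast h

theorem choose_two_mul_mul_centralBinom {n j : ℕ} (hj : j ≤ n) :
    (2 * n).choose (2 * j) * (j.centralBinom * (n - j).centralBinom)
      = n.centralBinom * n.choose j ^ 2 := by
  obtain ⟨l, rfl⟩ := Nat.exists_eq_add_of_le hj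
  have h1 := Nat.add_choose_mul_factorial_mul_factorial (2 * j) (2 * l)
  have h2 := Nat.add_choose_mul_factorial_mul_factorial j j
  have h3 := Nat.add_choose_mul_factorial_mul_factorial l l
  have h4 := Nat.add_choose_mul_factorial_mul_factorial (j + l) (j + l)
  have h5 := Nat.add_choose_mul_factorial_mul_factorial j l
  rw [← Nat.choose_symm_add] at h1 h5
  rw [Nat.add_sub_cancel_left]
  unfold Nat.centralBinom
  rw [← two_mul] at h2 h3 h4
  rw [← mul_add] at h1
  have hj0 := Nat.factorial_pos j
  have hl0 := Nat.factorial_pos l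
  have e1 : (2 * (j + l)).choose (2 * j) * ((2 * j).choose j * (2 * l).choose l)
      * ((j ! * l !) * (j ! * l !)) = (2 * (j + l))! := by
    rw [← h1, ← h2, ← h3]
    ring
  have e2 : (2 * (j + l)).choose (j + l) * (j + l).choose j ^ 2
      * ((j ! * l !) * (j ! * l !)) = (2 * (j + l))! := by
    rw [← h4, ← h5]
    ring
  exact Nat.eq_of_mul_eq_mul_right (by positivity) (e1.trans e2.symm)

/-- In the binomial expansion only even exponents have nonzero integral. By
`choose_two_mul_mul_centralBinom` the remaining terms are `n.centralBinom * n.choose j ^ 2`, and the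
squares of a binomial row sum to `n.centralBinom`. -/
theorem card_closedStepSeqs_two (n : ℕ) :
    (closedStepSeqs 2 (2 * n)).card = n.centralBinom ^ 2 := by
  have h : ((closedStepSeqs 2 (2 * n)).card : ℝ) = (n.centralBinom : ℝ) ^ 2 := by
    rw [card_closedStepSeqs_eq_integral]
    have h1 : ∀ θ : Fin 2 → ℝ, stepCos θ ^ (2 * n) = ∑ j ∈ Finset.range (2 * n + 1),
        ((2 * n).choose j : ℝ) * ∏ i, (2 * Real.cos (θ i)) ^ (![j, 2 * n - j] i) := by
      intro θ
      simp only [stepCos, Fin.sum_univ_two, Fin.prod_univ_two]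
      rw [add_pow]
      refine Finset.sum_congr rfl fun j _ => ?_
      simp only [Matrix.cons_val_zero, Matrix.cons_val_one]
      ring
    simp only [h1]
    rw [integral_finsetSum]
    · simp only [integral_const_mul]
      unfold torusUniform
      have h2 : ∀ j, ∫ θ : Fin 2 → ℝ, ∏ i, (2 * Real.cos (θ i)) ^ (![j, 2 * n - j] i)
          ∂(Measure.pi fun _ => circleUniform) =
          (if Even j then ((j / 2).centralBinom : ℝ) else 0)
          * (if Even (2 * n - j) then (((2 * n - j) / 2).centralBinom : ℝ) else 0) := by
        intro j
        rw [integral_fintype_prod_eq_prod (𝕜 := ℝ)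
          fun i x => (2 * Real.cos x) ^ (![j, 2 * n - j] i)]
        simp only [Fin.prod_univ_two, integral_two_cos_pow, Matrix.cons_val_zero,
          Matrix.cons_val_one]
        rfl
      simp only [h2]
      have h3 : ∑ j ∈ Finset.range (n + 1), ((2 * n).choose (2 * j) : ℝ)
          * ((j.centralBinom : ℝ) * ((n - j).centralBinom : ℝ)) = (n.centralBinom : ℝ) ^ 2 := by
        rw [sq]
        nth_rewrite 2 [Nat.centralBinom]
        rw [← Nat.sum_range_choose_sq]
        push_cast
        rw [Finset.mul_sum]
        refine Finset.sum_congr rfl fun j hj => ?_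
        exact_mod_cast choose_two_mul_mul_centralBinom (Nat.lt_succ_iff.1 (Finset.mem_range.1 hj))
      rw [← h3]
      symm
      refine Finset.sum_of_injOn (fun j => 2 * j) (fun a _ b _ h => by simpa using h) ?_ ?_ ?_
      · intro j hj
        simp only [Finset.coe_range, Set.mem_Iio] at hj ⊢
        omega
      · intro j hj hj2
        rw [if_neg, zero_mul, mul_zero]
        rintro ⟨r, hr⟩
        rw [Finset.mem_range] at hj
        refine hj2 ⟨r, ?_, ?_⟩
        · simp only [Finset.coe_range, Set.mem_Iio]
          omega
        · simp only
          omega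
      · intro j hj
        rw [Finset.mem_range] at hj
        rw [← Nat.mul_sub, if_pos (even_two_mul _), if_pos (even_two_mul _),
          Nat.mul_div_cancel_left _ two_pos, Nat.mul_div_cancel_left _ two_pos]
    · intro j _
      refine Integrable.const_mul ?_ _
      refine Integrable.of_bound (C := ∏ i, 2 ^ (![j, 2 * n - j] i)) ?_ (ae_of_all _ fun θ => ?_)
      · exact Continuous.aestronglyMeasurable (by fun_prop)
      · rw [norm_prod]
        refine Finset.prod_le_prod (fun i _ => norm_nonneg _) fun i _ => ?_
        rw [norm_pow]
        refine pow_le_pow_left₀ (norm_nonneg _) ?_ _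
        rw [Real.norm_eq_abs, abs_mul, abs_two]
        linarith [Real.abs_cos_le_one (θ i)]
  exact_mod_cast h

end Fourier

/-! ### Bessel functions and the integral `walkH` -/

section Bessel

theorem HasSum.of_forall_eq {ι α : Type*} [AddCommMonoid α] [TopologicalSpace α] {f g : ι → α}
    {a b : α} (h : HasSum f a) (hf : ∀ i, g i = f i) (hab : b = a) : HasSum g b := by
  rw [funext hf, hab]
  exact h

/-- Tonelli: the norm of the sum is at most the sum of the norms, whose integral is finite. -/
theorem integrable_of_hasSum {α E : Type*} [MeasurableSpace α] {μ : Measure α}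
    [NormedAddCommGroup E] [CompleteSpace E] {F : ℕ → α → E} {f : α → E}
    (hF : ∀ i, Integrable (F i) μ) (hs : Summable fun i => ∫ a, ‖F i a‖ ∂μ)
    (hf : ∀ a, HasSum (fun i => F i a) (f a)) : Integrable f μ := by
  refine ⟨aestronglyMeasurable_of_tendsto_ae atTop
    (f := fun n a => ∑ i ∈ Finset.range n, F i a) (fun n => ?_)
    (ae_of_all _ fun a => (hf a).tendsto_sum_nat), ?_⟩
  · exact Finset.aestronglyMeasurable_fun_sum _ fun i _ => (hF i).1
  · have h1 : ∀ a, ‖f a‖ₑ ≤ ∑' i, ‖F i a‖ₑ := fun a => by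
      rw [← (hf a).tsum_eq]
      exact enorm_tsum_le_tsum_enorm
    refine (lintegral_mono h1).trans_lt ?_
    rw [lintegral_tsum fun i => (hF i).1.enorm]
    have h2 : ∀ i, ∫⁻ a, ‖F i a‖ₑ ∂μ = ENNReal.ofReal (∫ a, ‖F i a‖ ∂μ) := fun i =>
      (ofReal_integral_norm_eq_lintegral_enorm (hF i)).symm
    simp only [h2]
    rw [← ENNReal.ofReal_tsum_of_nonneg (fun i => integral_nonneg fun a => norm_nonneg _) hs]
    exact ENNReal.ofReal_lt_top

theorem hasSum_integral_exp {Ω : Type*} [MeasurableSpace Ω] (μ : Measure Ω)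
    [IsProbabilityMeasure μ] {f : Ω → ℝ} (hf : AEStronglyMeasurable f μ) {B : ℝ}
    (hB : ∀ ω, |f ω| ≤ B) (z : ℂ) :
    HasSum (fun m : ℕ => ((∫ ω, f ω ^ m ∂μ : ℝ) : ℂ) * (z ^ m / (m ! : ℂ)))
      (∫ ω, Complex.exp ((f ω : ℂ) * z) ∂μ) := by
  have hfc : AEStronglyMeasurable (fun ω => (f ω : ℂ)) μ :=
    Complex.continuous_ofReal.comp_aestronglyMeasurable hf
  have hbound : ∀ (m : ℕ) ω, ‖((f ω : ℂ) * z) ^ m / (m ! : ℂ)‖ ≤ (B * ‖z‖) ^ m / (m ! : ℝ) := by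
    intro m ω
    rw [norm_div, norm_pow, norm_mul, Complex.norm_real, Real.norm_eq_abs]
    simp only [Complex.norm_natCast]
    gcongr
    exact hB ω
  have hint : ∀ m : ℕ, Integrable (fun ω => ((f ω : ℂ) * z) ^ m / (m ! : ℂ)) μ := fun m =>
    Integrable.of_bound (((hfc.mul_const z).pow m).div₀ aestronglyMeasurable_const) _ 
      (ae_of_all _ (hbound m))
  have h := hasSum_integral_of_summable_integral_norm hint
    (Summable.of_nonneg_of_le (fun m => integral_nonneg fun ω => norm_nonneg _) (fun m => by
      calc _ ≤ ∫ _, (B * ‖z‖) ^ m / (m ! : ℝ) ∂μ :=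
            integral_mono (hint m).norm (integrable_const _) (hbound m)
        _ = _ := by simp) (Real.summable_pow_div_factorial (B * ‖z‖)))
  refine h.of_forall_eq (fun m => ?_) ?_
  · rw [← integral_complex_ofReal, ← integral_mul_const]
    congr 1
    ext ω
    push_cast
    ring
  · congr 1
    ext ω
    rw [Complex.exp_eq_exp_ℂ, NormedSpace.exp_eq_tsum_div]

theorem integral_exp_two_cos (z : ℂ) :
    ∫ x, Complex.exp (((2 * Real.cos x : ℝ) : ℂ) * z) ∂circleUniform = besselI 0 (2 * z) := by
  have h := hasSum_integral_exp circleUniform (f := fun x => 2 * Real.cos x) (B := 2)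
    (Continuous.aestronglyMeasurable (by fun_prop)) (fun x => by
      rw [abs_mul, abs_two]
      linarith [Real.abs_cos_le_one x]) z
  simp only [integral_two_cos_pow] at h
  rw [← h.tsum_eq]
  unfold besselI
  symm
  have hinj : Function.Injective fun n : ℕ => 2 * n := fun a b hab => by simpa using hab
  rw [← hinj.tsum_eq (f := fun m : ℕ => ((if Even m then ((m / 2).centralBinom : ℝ) else 0 : ℝ) : ℂ)
    * (z ^ m / (m ! : ℂ)))]
  · refine tsum_congr fun n => ?_
    rw [if_pos (even_two_mul n), Nat.mul_div_cancel_left _ two_pos, mul_div_cancel_left₀ _ two_ne_zero,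
      add_zero, add_zero]
    have h1 : (n.centralBinom : ℂ) * ((n ! : ℂ) * (n ! : ℂ)) = ((2 * n)! : ℂ) := by
      have := Nat.add_choose_mul_factorial_mul_factorial n n
      rw [← two_mul] at this
      rw [← this, Nat.centralBinom]
      push_cast
      ring
    have h2 : (n ! : ℂ) ≠ 0 := by exact_mod_cast n.factorial_ne_zero
    have h3 : ((2 * n)! : ℂ) ≠ 0 := by exact_mod_cast (2 * n).factorial_ne_zero
    push_cast
    field_simp
    rw [← h1]
    ring
  · intro m hm
    rcases Nat.even_or_odd m with ⟨r, hr⟩ | ho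
    · exact ⟨r, by simp only; omega⟩
    · rw [Function.mem_support, if_neg (Nat.not_even_iff_odd.2 ho)] at hm
      simp at hm

/-- The exponential generating function of closed walks is the torus integral of `exp (stepCos θ *
z)`, which factors over the coordinates into `d` equal Bessel integrals. -/
theorem hasSum_besselI_pow (d : ℕ) (z : ℂ) :
    HasSum (fun m : ℕ => ((closedStepSeqs d m).card : ℂ) * (z ^ m / (m ! : ℂ)))
      (besselI 0 (2 * z) ^ d) := by
  have h := hasSum_integral_exp (torusUniform d) (f := stepCos) (B := 2 * d)
    continuous_stepCos.aestronglyMeasurable abs_stepCos_le z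
  simp only [← card_closedStepSeqs_eq_integral] at h
  refine h.of_forall_eq (fun m => by simp) ?_
  have h1 : ∀ θ : Fin d → ℝ, Complex.exp ((stepCos θ : ℂ) * z)
      = ∏ i, Complex.exp (((2 * Real.cos (θ i) : ℝ) : ℂ) * z) := by
    intro θ
    rw [← Complex.exp_sum, ← Finset.sum_mul]
    unfold stepCos
    push_cast
    rfl
  simp only [h1]
  unfold torusUniform
  rw [integral_fintype_prod_eq_prod (𝕜 := ℂ)
    fun _ x => Complex.exp (((2 * Real.cos x : ℝ) : ℂ) * z)]
  rw [Finset.prod_const, integral_exp_two_cos, Finset.card_univ, Fintype.card_fin]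

theorem integrableOn_exp_neg_mul_pow (m : ℕ) :
    IntegrableOn (fun y : ℝ => Real.exp (-y) * y ^ m) (Set.Ioi 0) := by
  have h := Real.GammaIntegral_convergent (s := m + 1) (by positivity)
  refine h.congr_fun (fun y _ => ?_) measurableSet_Ioi
  simp

theorem integral_exp_neg_mul_pow (m : ℕ) :
    ∫ y in Set.Ioi (0 : ℝ), Real.exp (-y) * y ^ m = (m ! : ℝ) := by
  rw [← Real.Gamma_nat_eq_factorial, Real.Gamma_eq_integral (by positivity)]
  refine setIntegral_congr_fun measurableSet_Ioi fun y _ => ?_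
  simp

theorem hasSum_walkIntegrand (d : ℕ) (z : ℂ) (y : ℝ) :
    HasSum (fun m : ℕ => (((closedStepSeqs d m).card : ℂ) * z ^ m / (m ! : ℂ))
      * ((Real.exp (-y) * y ^ m : ℝ) : ℂ)) (walkIntegrand (0 : Fin d → ℤ) z y) := by
  have h := (hasSum_besselI_pow d (z * y)).mul_left (Real.exp (-y) : ℂ)
  refine h.of_forall_eq (fun m => ?_) ?_
  · push_cast
    ring
  · simp [walkIntegrand, mul_assoc]

/-- Since `∫ e ^ (-y) * y ^ m = m !`, termwise integration cancels the factorials. Only absolute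
convergence at `z` is assumed, so the result also serves at the boundary point `1 / (2 * d)` when `d
> 2`. -/
theorem integrableOn_walkIntegrand_and_hasSum {d : ℕ} {z : ℂ}
    (hz : Summable fun m : ℕ => ((closedStepSeqs d m).card : ℝ) * ‖z‖ ^ m) :
    IntegrableOn (walkIntegrand (0 : Fin d → ℤ) z) (Set.Ioi 0) ∧
      HasSum (fun m : ℕ => ((closedStepSeqs d m).card : ℂ) * z ^ m)
        (1 + walkH (0 : Fin d → ℤ) z) := by
  set F : ℕ → ℝ → ℂ := fun m y => (((closedStepSeqs d m).card : ℂ) * z ^ m / (m ! : ℂ))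
      * ((Real.exp (-y) * y ^ m : ℝ) : ℂ) with hF
  have hint : ∀ m, Integrable (F m) (volume.restrict (Set.Ioi 0)) := fun m =>
    (integrableOn_exp_neg_mul_pow m).ofReal.const_mul _
  have hfac : ∀ m : ℕ, (m ! : ℝ) ≠ 0 := fun m => by exact_mod_cast m.factorial_ne_zero
  have hnorm : ∀ m, ∫ y in Set.Ioi (0 : ℝ), ‖F m y‖
      = ((closedStepSeqs d m).card : ℝ) * ‖z‖ ^ m := by
    intro m
    have h1 : ∀ y ∈ Set.Ioi (0 : ℝ), ‖F m y‖
        = (((closedStepSeqs d m).card : ℝ) * ‖z‖ ^ m / (m ! : ℝ)) * (Real.exp (-y) * y ^ m) := by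
      intro y hy
      have hy' : (0 : ℝ) < y := hy
      rw [hF]
      simp only [norm_mul, norm_div, norm_pow, Complex.norm_natCast, Complex.norm_real,
        Real.norm_eq_abs, Real.abs_exp, abs_of_pos hy']
    rw [setIntegral_congr_fun measurableSet_Ioi h1, integral_const_mul, integral_exp_neg_mul_pow,
      div_mul_cancel₀ _ (hfac m)]
  have hs : Summable fun m => ∫ y in Set.Ioi (0 : ℝ), ‖F m y‖ := by simpa only [hnorm] using hz
  refine ⟨integrable_of_hasSum hint hs (hasSum_walkIntegrand d z), ?_⟩
  have h := hasSum_integral_of_summable_integral_norm hint hs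
  refine h.of_forall_eq (fun m => ?_) ?_
  · rw [hF]
    simp only
    rw [integral_const_mul, integral_complex_ofReal, integral_exp_neg_mul_pow]
    have := hfac m
    rw [Complex.ofReal_natCast, div_mul_cancel₀ _ (by exact_mod_cast this)]
  · unfold walkH
    simp only [if_true, add_neg_cancel_left]
    exact integral_congr_ae (ae_of_all _ fun y => (hasSum_walkIntegrand d z y).tsum_eq.symm)

end Bessel

/-! ### Power series with real coefficients on the complex unit disc -/

section UnitDisc

open PowerSeries

/-- The sum of a power series with real coefficients at a complex number. -/
noncomputable def discSum (A : ℝ⟦X⟧) (w : ℂ) : ℂ := ∑' m, ((coeff m A : ℝ) : ℂ) * w ^ m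

/-- The power series converges absolutely on the open unit disc. -/
def ConvergesOnDisc (A : ℝ⟦X⟧) : Prop :=
  ∀ r : ℝ, 0 ≤ r → r < 1 → Summable fun m => |coeff m A| * r ^ m

variable {A B : ℝ⟦X⟧}

theorem ConvergesOnDisc.of_bounded {C : ℝ} (h : ∀ m, |coeff m A| ≤ C) : ConvergesOnDisc A := by
  intro r h0 h1
  refine Summable.of_nonneg_of_le (fun m => by positivity) (fun m => ?_)
    ((summable_geometric_of_lt_one h0 h1).mul_left C)
  gcongr
  exact h m

theorem ConvergesOnDisc.summable_norm (hA : ConvergesOnDisc A) {w : ℂ} (hw : ‖w‖ < 1) :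
    Summable fun m => ‖((coeff m A : ℝ) : ℂ) * w ^ m‖ := by
  simpa using hA ‖w‖ (norm_nonneg w) hw

theorem ConvergesOnDisc.hasSum (hA : ConvergesOnDisc A) {w : ℂ} (hw : ‖w‖ < 1) :
    HasSum (fun m => ((coeff m A : ℝ) : ℂ) * w ^ m) (discSum A w) :=
  (hA.summable_norm hw).of_norm.hasSum

theorem ConvergesOnDisc.mul (hA : ConvergesOnDisc A) (hB : ConvergesOnDisc B) :
    ConvergesOnDisc (A * B) := by
  intro r h0 h1
  have h := (summable_norm_sum_mul_antidiagonal_of_summable_norm (hA r h0 h1).norm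
    (hB r h0 h1).norm)
  refine Summable.of_nonneg_of_le (fun m => by positivity) (fun m => ?_) h
  rw [coeff_mul, Real.norm_eq_abs]
  refine le_trans ?_ (le_abs_self _)
  refine (mul_le_mul_of_nonneg_right (Finset.abs_sum_le_sum_abs _ _) (pow_nonneg h0 m)).trans ?_
  rw [Finset.sum_mul]
  refine Finset.sum_le_sum fun x hx => ?_
  rw [← mem_antidiagonal.1 hx, pow_add, abs_mul]
  exact le_of_eq (by ring)

theorem discSum_mul (hA : ConvergesOnDisc A) (hB : ConvergesOnDisc B) {w : ℂ} (hw : ‖w‖ < 1) :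
    discSum (A * B) w = discSum A w * discSum B w := by
  unfold discSum
  rw [tsum_mul_tsum_eq_tsum_sum_antidiagonal_of_summable_norm (hA.summable_norm hw)
    (hB.summable_norm hw)]
  refine tsum_congr fun m => ?_
  rw [coeff_mul, Complex.ofReal_sum, Finset.sum_mul]
  refine Finset.sum_congr rfl fun x hx => ?_
  rw [← mem_antidiagonal.1 hx, pow_add]
  push_cast
  ring

theorem ConvergesOnDisc.sub (hA : ConvergesOnDisc A) (hB : ConvergesOnDisc B) :
    ConvergesOnDisc (A - B) := by
  intro r h0 h1
  refine Summable.of_nonneg_of_le (fun m => by positivity) (fun m => ?_)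
    ((hA r h0 h1).add (hB r h0 h1))
  rw [map_sub, ← add_mul]
  gcongr
  exact abs_sub _ _

theorem discSum_sub (hA : ConvergesOnDisc A) (hB : ConvergesOnDisc B) {w : ℂ} (hw : ‖w‖ < 1) :
    discSum (A - B) w = discSum A w - discSum B w := by
  refine HasSum.tsum_eq (((hA.hasSum hw).sub (hB.hasSum hw)).of_forall_eq (fun m => ?_) rfl)
  rw [map_sub, Complex.ofReal_sub, sub_mul]

theorem ConvergesOnDisc.X_pow (n : ℕ) : ConvergesOnDisc ((X : ℝ⟦X⟧) ^ n) :=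
  .of_bounded (C := 1) fun m => by rw [coeff_X_pow]; split_ifs <;> simp

theorem discSum_X_pow (n : ℕ) (w : ℂ) : discSum (X ^ n) w = w ^ n := by
  unfold discSum
  rw [tsum_eq_single n]
  · simp [coeff_X_pow]
  · intro m hm
    simp [coeff_X_pow, hm]

theorem ConvergesOnDisc.one : ConvergesOnDisc (1 : ℝ⟦X⟧) := pow_zero (X : ℝ⟦X⟧) ▸ .X_pow 0

theorem discSum_one (w : ℂ) : discSum 1 w = 1 := by
  have := discSum_X_pow 0 w
  rwa [pow_zero, pow_zero] at this

theorem ConvergesOnDisc.pow (hA : ConvergesOnDisc A) (k : ℕ) : ConvergesOnDisc (A ^ k) := by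
  induction k with
  | zero => exact pow_zero A ▸ .one
  | succ k ih => exact pow_succ A k ▸ ih.mul hA

theorem discSum_pow (hA : ConvergesOnDisc A) {w : ℂ} (hw : ‖w‖ < 1) (k : ℕ) :
    discSum (A ^ k) w = discSum A w ^ k := by
  induction k with
  | zero => rw [pow_zero, pow_zero, discSum_one]
  | succ k ih => rw [pow_succ, pow_succ, discSum_mul (hA.pow k) hA hw, ih]

theorem ConvergesOnDisc.X_mul_derivative (hA : ConvergesOnDisc A) :
    ConvergesOnDisc (X * derivative ℝ A) := by
  intro r h0 h1
  obtain ⟨s, hrs, hs1⟩ := exists_between h1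
  have hs0 : 0 < s := h0.trans_lt hrs
  -- The factor `m` is paid for by the gap between `r` and a larger radius `s < 1`.
  have ht : Tendsto (fun m : ℕ => (m : ℝ) * (r / s) ^ m) atTop (𝓝 0) :=
    tendsto_self_mul_const_pow_of_abs_lt_one (by
      rw [abs_of_nonneg (by positivity), div_lt_one hs0]
      exact hrs)
  obtain ⟨C, hC⟩ := ht.isBoundedUnder_le.bddAbove_range
  refine Summable.of_nonneg_of_le (fun m => by positivity) (fun m => ?_)
    ((hA s hs0.le hs1).mul_left C)
  rw [coeff_X_mul_derivative, abs_mul, Nat.abs_cast]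
  have h2 : (m : ℝ) * (r / s) ^ m ≤ C := hC ⟨m, rfl⟩
  have h3 : (m : ℝ) * r ^ m = (m : ℝ) * (r / s) ^ m * s ^ m := by
    rw [div_pow, mul_assoc, div_mul_cancel₀ _ (by positivity)]
  calc (m : ℝ) * |coeff m A| * r ^ m = |coeff m A| * ((m : ℝ) * r ^ m) := by ring
    _ = |coeff m A| * ((m : ℝ) * (r / s) ^ m * s ^ m) := by rw [h3]
    _ ≤ |coeff m A| * (C * s ^ m) := by gcongr
    _ = _ := by ring

theorem hasDerivAt_discSum (hA : ConvergesOnDisc A) {w : ℂ} (hw : ‖w‖ < 1) :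
    ∃ D : ℂ, HasDerivAt (discSum A) D w ∧ w * D = discSum (X * derivative ℝ A) w := by
  obtain ⟨r, hwr, hr1⟩ := exists_between hw
  have hr0 : 0 < r := (norm_nonneg w).trans_lt hwr
  have hsum : Summable fun m : ℕ => r⁻¹ * (|coeff m (X * derivative ℝ A)| * r ^ m) :=
    (hA.X_mul_derivative r hr0.le hr1).mul_left _
  have hd : ∀ (m : ℕ) (y : ℂ), y ∈ Metric.ball (0 : ℂ) r → HasDerivAt
      (fun z : ℂ => ((coeff m A : ℝ) : ℂ) * z ^ m) (((coeff m A : ℝ) : ℂ) * ((m : ℂ) * y ^ (m - 1))) y :=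
    fun m y _ => (hasDerivAt_pow m y).const_mul _
  have hb : ∀ (m : ℕ) (y : ℂ), y ∈ Metric.ball (0 : ℂ) r →
      ‖((coeff m A : ℝ) : ℂ) * ((m : ℂ) * y ^ (m - 1))‖
        ≤ r⁻¹ * (|coeff m (X * derivative ℝ A)| * r ^ m) := by
    intro m y hy
    have hy' : ‖y‖ ≤ r := (mem_ball_zero_iff.1 hy).le
    rw [coeff_X_mul_derivative]
    cases m with
    | zero => simp
    | succ m =>
      rw [abs_mul, Nat.abs_cast, norm_mul, norm_mul, Complex.norm_real, Complex.norm_natCast,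
        norm_pow, Real.norm_eq_abs, Nat.add_sub_cancel]
      calc |coeff (m + 1) A| * (((m + 1 : ℕ) : ℝ) * ‖y‖ ^ m)
          ≤ |coeff (m + 1) A| * (((m + 1 : ℕ) : ℝ) * r ^ m) := by gcongr
        _ = _ := by
          rw [pow_succ]
          field_simp
  have hw' : w ∈ Metric.ball (0 : ℂ) r := mem_ball_zero_iff.2 hwr
  refine ⟨_, hasDerivAt_tsum_of_isPreconnected hsum Metric.isOpen_ball
    (convex_ball (0 : ℂ) r).isPreconnected hd hb hw' (hA.hasSum hw).summable hw', ?_⟩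
  unfold discSum
  rw [← tsum_mul_left]
  refine tsum_congr fun m => ?_
  rw [coeff_X_mul_derivative]
  cases m with
  | zero => simp
  | succ m =>
    rw [Nat.add_sub_cancel, pow_succ]
    push_cast
    ring

theorem discSum_evenPart (hA : ∀ m, ¬ Even m → coeff m A = 0) (w : ℂ) :
    discSum A w = discSum (evenPart A) (w ^ 2) := by
  unfold discSum
  have hinj : Function.Injective fun n : ℕ => 2 * n := fun a b hab => by simpa using hab
  rw [← hinj.tsum_eq]
  · refine tsum_congr fun n => ?_
    rw [coeff_evenPart, pow_mul]
  · intro m hm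
    by_contra hne
    rw [Function.mem_support, hA m fun ⟨r, hr⟩ => hne ⟨r, by simp only; omega⟩] at hm
    simp at hm

variable {U V : ℝ⟦X⟧}

theorem discSum_renewal (h : U * (1 - V) = 1) (hU : ConvergesOnDisc U) (hV : ConvergesOnDisc V)
    {w : ℂ} (hw : ‖w‖ < 1) : discSum U w * (1 - discSum V w) = 1 := by
  rw [← discSum_one w, ← discSum_sub .one hV hw, ← discSum_mul hU (.sub .one hV) hw, h]

/-- Nonnegative coefficients reduce the claim to the real point `‖w‖`. There `u * (1 - v) = 1` with
`u ≥ 0` forces `v < 1`. -/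
theorem norm_discSum_lt_one (h : U * (1 - V) = 1) (hU : ConvergesOnDisc U) (hV : ConvergesOnDisc V)
    (hU0 : ∀ m, 0 ≤ coeff m U) (hV0 : ∀ m, 0 ≤ coeff m V) {w : ℂ} (hw : ‖w‖ < 1) :
    ‖discSum V w‖ < 1 := by
  have hreal : ∀ A : ℝ⟦X⟧, ConvergesOnDisc A → (∀ m, 0 ≤ coeff m A) →
      ∃ a : ℝ, 0 ≤ a ∧ discSum A (‖w‖ : ℂ) = a ∧ ‖discSum A w‖ ≤ a := by
    intro A hA hA0
    refine ⟨∑' m, coeff m A * ‖w‖ ^ m, tsum_nonneg fun m => mul_nonneg (hA0 m) (by positivity),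
      ?_, ?_⟩
    · unfold discSum
      push_cast
      rfl
    · refine (norm_tsum_le_tsum_norm (hA.summable_norm hw)).trans (le_of_eq ?_)
      refine tsum_congr fun m => ?_
      rw [norm_mul, norm_pow, Complex.norm_real, Real.norm_of_nonneg (hA0 m)]
  obtain ⟨u, hu0, hu, -⟩ := hreal U hU hU0
  obtain ⟨v, hv0, hv, hle⟩ := hreal V hV hV0
  have h1 := discSum_renewal h hU hV (w := (‖w‖ : ℂ)) (by simpa using hw)
  rw [hu, hv] at h1
  have h2 : u * (1 - v) = 1 := by exact_mod_cast h1
  refine hle.trans_lt ?_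
  by_contra hcon
  have h3 : u * (1 - v) ≤ 0 := mul_nonpos_of_nonneg_of_nonpos hu0 (by linarith)
  linarith

/-- `1 - V` lies in the right half plane, and inversion preserves it. This puts `1 + h` in the slit
plane, makes `log` differentiable there, and later selects the sign of the square root. -/
theorem re_discSum_pos (h : U * (1 - V) = 1) (hU : ConvergesOnDisc U) (hV : ConvergesOnDisc V)
    (hU0 : ∀ m, 0 ≤ coeff m U) (hV0 : ∀ m, 0 ≤ coeff m V) {w : ℂ} (hw : ‖w‖ < 1) :
    0 < (discSum U w).re := by
  have h1 := discSum_renewal h hU hV hw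
  have h2 := norm_discSum_lt_one h hU hV hU0 hV0 hw
  have h3 : (discSum V w).re < 1 := (Complex.re_le_norm _).trans_lt h2
  have h4 : discSum U w = (1 - discSum V w)⁻¹ := eq_inv_of_mul_eq_one_left h1
  rw [h4, Complex.inv_re]
  refine div_pos ?_ (Complex.normSq_pos.2 fun h0 => ?_)
  · rw [Complex.sub_re, Complex.one_re]
    linarith
  · rw [h0, mul_zero] at h1
    exact zero_ne_one h1

end UnitDisc

/-! ### Generating functions of closed walks -/

section GeneratingFunctions

open PowerSeries

variable {d : ℕ}

theorem convergesOnDisc_returnSeries (d : ℕ) : ConvergesOnDisc (returnSeries d) :=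
  .of_bounded (C := 1) fun m => by
    rw [abs_of_nonneg (coeff_returnSeries_nonneg d m)]
    exact coeff_returnSeries_le_one d m

theorem convergesOnDisc_firstReturnSeries (d : ℕ) : ConvergesOnDisc (firstReturnSeries d) :=
  .of_bounded (C := 1) fun m => by
    rw [abs_of_nonneg (coeff_firstReturnSeries_nonneg d m)]
    exact (coeff_firstReturnSeries_le d m).trans (coeff_returnSeries_le_one d m)

theorem norm_two_mul_lt_one (hd : 1 ≤ d) {z : ℂ} (hz : ‖z‖ < 1 / (2 * (d : ℝ))) :
    ‖2 * (d : ℂ) * z‖ < 1 := by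
  have hd' : (0 : ℝ) < 2 * d := by positivity
  rw [lt_div_iff₀ hd'] at hz
  simp only [norm_mul, Complex.norm_natCast, Complex.norm_ofNat]
  linarith

theorem coeff_returnSeries_mul_pow (hd : 1 ≤ d) (m : ℕ) (z : ℂ) :
    ((coeff m (returnSeries d) : ℝ) : ℂ) * (2 * (d : ℂ) * z) ^ m
      = ((closedStepSeqs d m).card : ℂ) * z ^ m := by
  have hd0 : (2 * (d : ℂ)) ≠ 0 := by
    simp only [ne_eq, mul_eq_zero, OfNat.ofNat_ne_zero, false_or, Nat.cast_eq_zero]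
    omega
  rw [coeff_returnSeries, mul_pow (2 * (d : ℂ)) z]
  push_cast
  rw [← mul_assoc, div_mul_cancel₀ _ (pow_ne_zero m hd0)]

theorem integrableOn_walkIntegrand (hd : 1 ≤ d) {z : ℂ} (hz : ‖z‖ < 1 / (2 * (d : ℝ))) :
    IntegrableOn (walkIntegrand (0 : Fin d → ℤ) z) (Set.Ioi 0) ∧
      1 + walkH (0 : Fin d → ℤ) z = discSum (returnSeries d) (2 * d * z) := by
  have hw := norm_two_mul_lt_one hd hz
  have hs : Summable fun m : ℕ => ((closedStepSeqs d m).card : ℝ) * ‖z‖ ^ m := by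
    have h := (convergesOnDisc_returnSeries d).summable_norm hw
    simp only [coeff_returnSeries_mul_pow hd] at h
    simpa using h
  obtain ⟨h1, h2⟩ := integrableOn_walkIntegrand_and_hasSum hs
  refine ⟨h1, h2.unique ?_⟩
  exact ((convergesOnDisc_returnSeries d).hasSum hw).of_forall_eq
    (fun m => (coeff_returnSeries_mul_pow hd m z).symm) rfl

theorem eventually_one_add_walkH_eq (hd : 1 ≤ d) {z : ℂ} (hz : ‖z‖ < 1 / (2 * (d : ℝ))) :
    ∀ᶠ ζ in 𝓝 z, 1 + walkH (0 : Fin d → ℤ) ζ = discSum (returnSeries d) (2 * d * ζ) := by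
  have h : ∀ᶠ ζ in 𝓝 z, ‖ζ‖ < 1 / (2 * (d : ℝ)) :=
    continuous_norm.continuousAt.eventually_lt continuousAt_const hz
  filter_upwards [h] with ζ hζ using (integrableOn_walkIntegrand hd hζ).2

theorem hasDerivAt_discSum_comp {A : ℝ⟦X⟧} (hA : ConvergesOnDisc A) {c z : ℂ} (hw : ‖c * z‖ < 1) :
    ∃ D : ℂ, HasDerivAt (fun ζ => discSum A (c * ζ)) D z ∧
      z * D = discSum (X * derivative ℝ A) (c * z) := by
  obtain ⟨D, h1, h2⟩ := hasDerivAt_discSum hA hw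
  refine ⟨D * c, ?_, by rw [← h2]; ring⟩
  have h3 := h1.comp z ((hasDerivAt_id z).const_mul c)
  rw [mul_one] at h3
  exact h3

theorem differentiableAt_walkH (hd : 1 ≤ d) {z : ℂ} (hz : ‖z‖ < 1 / (2 * (d : ℝ))) :
    DifferentiableAt ℂ (fun ζ : ℂ => walkH (0 : Fin d → ℤ) ζ) z := by
  obtain ⟨D, h, -⟩ := hasDerivAt_discSum_comp (convergesOnDisc_returnSeries d)
    (norm_two_mul_lt_one hd hz)
  have h1 : (fun ζ : ℂ => walkH (0 : Fin d → ℤ) ζ)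
      =ᶠ[𝓝 z] fun ζ => discSum (returnSeries d) (2 * d * ζ) - 1 := by
    filter_upwards [eventually_one_add_walkH_eq hd hz] with ζ hζ
    rw [← hζ]
    ring
  exact ((h.sub_const 1).congr_of_eventuallyEq h1).differentiableAt

theorem re_one_add_walkH_pos (hd : 1 ≤ d) {z : ℂ} (hz : ‖z‖ < 1 / (2 * (d : ℝ))) :
    0 < (1 + walkH (0 : Fin d → ℤ) z).re := by
  rw [(integrableOn_walkIntegrand hd hz).2]
  exact re_discSum_pos (returnSeries_renewal d) (convergesOnDisc_returnSeries d)
    (convergesOnDisc_firstReturnSeries d) (coeff_returnSeries_nonneg d)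
    (coeff_firstReturnSeries_nonneg d) (norm_two_mul_lt_one hd hz)

theorem walkH_div_eq (hd : 1 ≤ d) {z : ℂ} (hz : ‖z‖ < 1 / (2 * (d : ℝ))) :
    walkH (0 : Fin d → ℤ) z / (1 + walkH (0 : Fin d → ℤ) z)
      = discSum (firstReturnSeries d) (2 * d * z) := by
  have h0 : 1 + walkH (0 : Fin d → ℤ) z ≠ 0 := fun h => by
    have := re_one_add_walkH_pos hd hz
    rw [h, Complex.zero_re] at this
    exact lt_irrefl _ this
  have h1 := discSum_renewal (returnSeries_renewal d) (convergesOnDisc_returnSeries d)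
    (convergesOnDisc_firstReturnSeries d) (norm_two_mul_lt_one hd hz)
  rw [← (integrableOn_walkIntegrand hd hz).2] at h1
  rw [div_eq_iff h0]
  linear_combination h1

theorem mul_deriv_pow_walkH (hd : 1 ≤ d) {z : ℂ} (hz : ‖z‖ < 1 / (2 * (d : ℝ))) (k : ℕ) :
    z * deriv (fun ζ : ℂ => (1 / (k : ℂ)) *
        (walkH (0 : Fin d → ℤ) ζ / (1 + walkH (0 : Fin d → ℤ) ζ)) ^ k) z
      = (1 / (k : ℂ)) * discSum (X * derivative ℝ (firstReturnSeries d ^ k)) (2 * d * z) := by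
  have hQ := convergesOnDisc_firstReturnSeries d
  obtain ⟨D, h1, h2⟩ := hasDerivAt_discSum_comp (hQ.pow k) (norm_two_mul_lt_one hd hz)
  have h : ∀ᶠ ζ in 𝓝 z, ‖ζ‖ < 1 / (2 * (d : ℝ)) :=
    continuous_norm.continuousAt.eventually_lt continuousAt_const hz
  have h3 : (fun ζ : ℂ => (1 / (k : ℂ)) *
        (walkH (0 : Fin d → ℤ) ζ / (1 + walkH (0 : Fin d → ℤ) ζ)) ^ k)
      =ᶠ[𝓝 z] fun ζ => (1 / (k : ℂ)) * discSum (firstReturnSeries d ^ k) (2 * d * ζ) := by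
    filter_upwards [h] with ζ hζ
    rw [walkH_div_eq hd hζ, discSum_pow hQ (norm_two_mul_lt_one hd hζ)]
  rw [h3.deriv_eq, (h1.const_mul (1 / (k : ℂ))).deriv, ← h2]
  ring

theorem mul_deriv_log_walkH (hd : 1 ≤ d) {z : ℂ} (hz : ‖z‖ < 1 / (2 * (d : ℝ))) :
    z * deriv (fun ζ : ℂ => Complex.log (1 + walkH (0 : Fin d → ℤ) ζ)) z
      = discSum (X * derivative ℝ (returnSeries d) * (1 - firstReturnSeries d)) (2 * d * z) := by
  have hP := convergesOnDisc_returnSeries d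
  have hQ := convergesOnDisc_firstReturnSeries d
  have hw := norm_two_mul_lt_one hd hz
  obtain ⟨D, h1, h2⟩ := hasDerivAt_discSum_comp hP hw
  have h3 : (fun ζ : ℂ => Complex.log (1 + walkH (0 : Fin d → ℤ) ζ))
      =ᶠ[𝓝 z] fun ζ => Complex.log (discSum (returnSeries d) (2 * d * ζ)) := by
    filter_upwards [eventually_one_add_walkH_eq hd hz] with ζ hζ
    rw [hζ]
  have hre := re_one_add_walkH_pos hd hz
  rw [(integrableOn_walkIntegrand hd hz).2] at hre
  have h4 := discSum_renewal (returnSeries_renewal d) hP hQ hw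
  rw [h3.deriv_eq, (h1.clog (Or.inl hre)).deriv, discSum_mul hP.X_mul_derivative (.sub .one hQ) hw,
    discSum_sub .one hQ hw, discSum_one, ← h2, ← mul_div_assoc, div_eq_mul_inv]
  congr 1
  exact inv_eq_of_mul_eq_one_right h4

/-- Closed walks of positive length from `0` as pairs of a length and a step sequence. -/
def closedWalksEquiv (d : ℕ) : closedWalks d ≃
    Σ m : ℕ, {s : Fin m → LatticeStep d // 0 < m ∧ stepSum s m = 0} where
  toFun w := ⟨w.1.length, w.1.step, w.2.2.2, by
    obtain ⟨⟨p, m, s⟩, hp, hc, hm⟩ := w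
    obtain rfl : p = 0 := hp
    exact (isClosed_mk_zero s).1 hc⟩
  invFun x := ⟨⟨0, x.1, x.2.1⟩, rfl, (isClosed_mk_zero x.2.1).2 x.2.2.2, x.2.2.1⟩
  left_inv := by
    rintro ⟨⟨p, m, s⟩, hp, hc, hm⟩
    obtain rfl : p = 0 := hp
    rfl
  right_inv := fun _ => rfl

/-- Walks are grouped by length. As `f` is nonnegative, the norms within one length add up to the
norm of the corresponding term of `A`, so the disc convergence of `A` gives absolute convergence
over all walks. -/
theorem hasSum_closedWalks (hd : 1 ≤ d) {z : ℂ} (hz : ‖z‖ < 1 / (2 * (d : ℝ)))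
    {f : LatticeWalk d → ℕ}
    {A : ℝ⟦X⟧} (hA : ConvergesOnDisc A) (hA0 : coeff 0 A = 0)
    (hfA : ∀ m : ℕ, 0 < m →
      (∑ s ∈ closedStepSeqs d m, (f ⟨0, m, s⟩ : ℝ)) / (2 * d : ℝ) ^ m = coeff m A) :
    HasSum (fun w : closedWalks d => (f w.1 : ℂ) * z ^ w.1.length) (discSum A (2 * d * z)) := by
  classical
  have hw := norm_two_mul_lt_one hd hz
  have hd0 : (2 * d : ℝ) ≠ 0 := by positivity
  rw [← (closedWalksEquiv d).symm.hasSum_iff]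
  set g : (Σ m : ℕ, {s : Fin m → LatticeStep d // 0 < m ∧ stepSum s m = 0}) → ℂ :=
    (fun w : closedWalks d => (f w.1 : ℂ) * z ^ w.1.length) ∘ (closedWalksEquiv d).symm with hg
  have hgx : ∀ m s, g ⟨m, s⟩ = (f ⟨0, m, s.1⟩ : ℂ) * z ^ m := fun m s => rfl
  have hsum : ∀ m : ℕ, ∑ s : {s : Fin m → LatticeStep d // 0 < m ∧ stepSum s m = 0},
      (f ⟨0, m, s.1⟩ : ℝ) = coeff m A * (2 * d : ℝ) ^ m := by
    intro m
    rcases Nat.eq_zero_or_pos m with rfl | hm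
    · rw [hA0, zero_mul]
      exact Finset.sum_eq_zero fun s _ => absurd s.2.1 (lt_irrefl _)
    · rw [← hfA m hm, div_mul_cancel₀ _ (pow_ne_zero _ hd0)]
      symm
      refine Finset.sum_subtype _ (fun s => ?_) _
      rw [mem_closedStepSeqs]
      exact ⟨fun h => ⟨hm, h⟩, fun h => h.2⟩
  have hs : Summable g := by
    refine Summable.of_norm ?_
    rw [summable_sigma_of_nonneg fun x => norm_nonneg _]
    refine ⟨fun m => Summable.of_finite, ?_⟩
    have h := hA.summable_norm hw
    refine h.congr fun m => ?_
    rw [tsum_fintype]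
    simp only [hgx, norm_mul, norm_pow, Complex.norm_natCast, Complex.norm_ofNat,
      Complex.norm_real]
    rw [← Finset.sum_mul, hsum, mul_pow, Real.norm_eq_abs, abs_of_nonneg]
    · ring
    · have h1 : 0 ≤ coeff m A * (2 * d : ℝ) ^ m := by
        rw [← hsum]
        exact Finset.sum_nonneg fun s _ => Nat.cast_nonneg _
      exact nonneg_of_mul_nonneg_left h1 (by positivity)
  have h1 : HasSum (fun m => ∑ s : {s : Fin m → LatticeStep d // 0 < m ∧ stepSum s m = 0},
      g ⟨m, s⟩) (∑' x, g x) := hs.hasSum.sigma fun m => hasSum_fintype _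
  have h2 : HasSum (fun m => ∑ s : {s : Fin m → LatticeStep d // 0 < m ∧ stepSum s m = 0},
      g ⟨m, s⟩) (discSum A (2 * d * z)) := by
    refine (hA.hasSum hw).of_forall_eq (fun m => ?_) rfl
    simp only [hgx]
    have h3 := congrArg (Complex.ofReal) (hsum m)
    push_cast at h3
    rw [← Finset.sum_mul, h3]
    ring
  rw [h2.unique h1]
  exact hs.hasSum

theorem hasSum_multRange (hd : 1 ≤ d) {z : ℂ} (hz : ‖z‖ < 1 / (2 * (d : ℝ))) {k : ℕ}
    (hk : 1 ≤ k) :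
    HasSum (fun w : closedWalks d => (w.1.multRange k : ℂ) * z ^ w.1.length)
      (z * deriv (fun ζ : ℂ => (1 / (k : ℂ)) *
        (walkH (0 : Fin d → ℤ) ζ / (1 + walkH (0 : Fin d → ℤ) ζ)) ^ k) z) := by
  have hU := returnSeries_renewal d
  have hQ := convergesOnDisc_firstReturnSeries d
  have h := hasSum_closedWalks hd hz (f := LatticeWalk.multRange k)
    (A := X * derivative ℝ (returnSeries d) *
      ((1 - firstReturnSeries d) ^ 2 * firstReturnSeries d ^ (k - 1)))
    ((convergesOnDisc_returnSeries d).X_mul_derivative.mul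
      (((ConvergesOnDisc.one.sub hQ).pow 2).mul (hQ.pow (k - 1))))
    (by rw [← coeff_pow_of_renewal hU hk]; simp)
    (fun m hm => by rw [sum_multRange_div hm hk, coeff_pow_of_renewal hU hk])
  convert h using 1
  rw [mul_deriv_pow_walkH hd hz]
  have hk0 : (k : ℂ) ≠ 0 := by
    rw [Nat.cast_ne_zero]
    omega
  unfold discSum
  rw [← tsum_mul_left]
  refine tsum_congr fun m => ?_
  rw [← coeff_pow_of_renewal hU hk, coeff_X_mul_derivative]
  push_cast
  ring

theorem hasSum_range (hd : 1 ≤ d) {z : ℂ} (hz : ‖z‖ < 1 / (2 * (d : ℝ))) :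
    HasSum (fun w : closedWalks d => (w.1.range : ℂ) * z ^ w.1.length)
      (z * deriv (fun ζ : ℂ => Complex.log (1 + walkH (0 : Fin d → ℤ) ζ)) z) := by
  rw [mul_deriv_log_walkH hd hz]
  refine hasSum_closedWalks hd hz (f := LatticeWalk.range)
    ((convergesOnDisc_returnSeries d).X_mul_derivative.mul
      (ConvergesOnDisc.one.sub (convergesOnDisc_firstReturnSeries d))) ?_ fun m hm => ?_
  · rw [mul_assoc, coeff_zero_X_mul]
  · rw [sum_range_div hm]
    exact sum_coeff_pow_of_renewal (returnSeries_renewal d) (constantCoeff_firstReturnSeries d)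
      le_rfl

end GeneratingFunctions

/-! ### The series in the number of pairs of steps -/

section EvenSeries

open PowerSeries

/-- The generating function of the return probabilities after `2 n` steps. -/
noncomputable def evenReturnSeries (d : ℕ) : ℝ⟦X⟧ := evenPart (returnSeries d)

/-- The generating function of the first return probabilities after `2 n` steps. -/
noncomputable def evenFirstReturnSeries (d : ℕ) : ℝ⟦X⟧ := evenPart (firstReturnSeries d)

variable (d : ℕ)

theorem coeff_evenReturnSeries (n : ℕ) : coeff n (evenReturnSeries d)
    = ((closedStepSeqs d (2 * n)).card : ℝ) / (2 * d : ℝ) ^ (2 * n) := by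
  unfold evenReturnSeries
  rw [coeff_evenPart, coeff_returnSeries]

theorem coeff_evenReturnSeries_nonneg (n : ℕ) : 0 ≤ coeff n (evenReturnSeries d) := by
  unfold evenReturnSeries
  rw [coeff_evenPart]
  exact coeff_returnSeries_nonneg d _

theorem coeff_evenReturnSeries_le_one (n : ℕ) : coeff n (evenReturnSeries d) ≤ 1 := by
  unfold evenReturnSeries
  rw [coeff_evenPart]
  exact coeff_returnSeries_le_one d _

theorem coeff_zero_evenReturnSeries : coeff 0 (evenReturnSeries d) = 1 := by
  unfold evenReturnSeries
  rw [coeff_evenPart, mul_zero, coeff_zero_returnSeries]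

theorem coeff_evenFirstReturnSeries_nonneg (n : ℕ) : 0 ≤ coeff n (evenFirstReturnSeries d) := by
  unfold evenFirstReturnSeries
  rw [coeff_evenPart]
  exact coeff_firstReturnSeries_nonneg d _

theorem coeff_evenFirstReturnSeries_le (n : ℕ) :
    coeff n (evenFirstReturnSeries d) ≤ coeff n (evenReturnSeries d) := by
  unfold evenFirstReturnSeries evenReturnSeries
  rw [coeff_evenPart, coeff_evenPart]
  exact coeff_firstReturnSeries_le d _

theorem constantCoeff_evenFirstReturnSeries : constantCoeff (evenFirstReturnSeries d) = 0 := by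
  unfold evenFirstReturnSeries
  rw [← coeff_zero_eq_constantCoeff_apply, coeff_evenPart, mul_zero,
    coeff_zero_eq_constantCoeff_apply, constantCoeff_firstReturnSeries]

theorem evenReturnSeries_renewal : evenReturnSeries d * (1 - evenFirstReturnSeries d) = 1 := by
  unfold evenReturnSeries evenFirstReturnSeries
  have h1 : (1 : ℝ⟦X⟧) - evenPart (firstReturnSeries d) = evenPart (1 - firstReturnSeries d) := by
    ext n
    rw [coeff_evenPart, map_sub, map_sub, coeff_evenPart, ← coeff_evenPart 1, evenPart_one]
  rw [h1, ← evenPart_mul fun m hm => coeff_returnSeries_of_odd d hm, returnSeries_renewal,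
    evenPart_one]

theorem convergesOnDisc_evenReturnSeries : ConvergesOnDisc (evenReturnSeries d) :=
  .of_bounded (C := 1) fun m => by
    rw [abs_of_nonneg (coeff_evenReturnSeries_nonneg d m)]
    exact coeff_evenReturnSeries_le_one d m

theorem convergesOnDisc_evenFirstReturnSeries : ConvergesOnDisc (evenFirstReturnSeries d) :=
  .of_bounded (C := 1) fun m => by
    rw [abs_of_nonneg (coeff_evenFirstReturnSeries_nonneg d m)]
    exact (coeff_evenFirstReturnSeries_le d m).trans (coeff_evenReturnSeries_le_one d m)

variable {d}

theorem one_add_walkH_eq_even (hd : 1 ≤ d) {z : ℂ} (hz : ‖z‖ < 1 / (2 * (d : ℝ))) :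
    1 + walkH (0 : Fin d → ℤ) z = discSum (evenReturnSeries d) ((2 * d * z) ^ 2) := by
  rw [(integrableOn_walkIntegrand hd hz).2]
  exact discSum_evenPart (fun m hm => coeff_returnSeries_of_odd d hm) _

theorem closedWalkMean_eq (hd : 1 ≤ d) (n : ℕ) (f : LatticeWalk d → ℕ) :
    closedWalkMean d n f = ((∑ s ∈ closedStepSeqs d (2 * n), (f ⟨0, 2 * n, s⟩ : ℝ))
      / (2 * d : ℝ) ^ (2 * n)) / coeff n (evenReturnSeries d) := by
  have h : (2 * d : ℝ) ^ (2 * n) ≠ 0 := by positivity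
  unfold closedWalkMean
  rw [coeff_evenReturnSeries, div_div_div_cancel_right₀ h]

theorem coeff_two_mul_firstReturnSeries_pow (n k : ℕ) :
    coeff (2 * n) (firstReturnSeries d ^ k) = coeff n (evenFirstReturnSeries d ^ k) := by
  unfold evenFirstReturnSeries
  rw [← evenPart_pow (coeff_firstReturnSeries_of_odd d), coeff_evenPart]

/-- The factor `2` appears because the length is `2 * n`, whereas `X * d/dX` of the even series
produces only `n`. -/
theorem closedWalkMean_multRange (hd : 1 ≤ d) {n k : ℕ} (hn : 0 < n) (hk : 1 ≤ k) :
    closedWalkMean d n (LatticeWalk.multRange k) =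
      2 * coeff n (X * derivative ℝ (evenReturnSeries d) *
        ((1 - evenFirstReturnSeries d) ^ 2 * evenFirstReturnSeries d ^ (k - 1)))
        / coeff n (evenReturnSeries d) := by
  rw [closedWalkMean_eq hd, sum_multRange_div (by omega) hk, coeff_two_mul_firstReturnSeries_pow,
    ← coeff_pow_of_renewal (evenReturnSeries_renewal d) hk]
  push_cast
  ring

theorem closedWalkMean_range (hd : 1 ≤ d) {n : ℕ} (hn : 0 < n) :
    closedWalkMean d n LatticeWalk.range =
      2 * coeff n (X * derivative ℝ (evenReturnSeries d) * (1 - evenFirstReturnSeries d))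
        / coeff n (evenReturnSeries d) := by
  rw [closedWalkMean_eq hd, sum_range_div (by omega),
    ← sum_coeff_pow_of_renewal (evenReturnSeries_renewal d) (constantCoeff_evenFirstReturnSeries d)
      (K := 2 * n) (by omega), Finset.mul_sum]
  congr 1
  refine Finset.sum_congr rfl fun k _ => ?_
  rw [coeff_two_mul_firstReturnSeries_pow]
  push_cast
  ring

theorem coeff_evenReturnSeries_one (n : ℕ) :
    coeff n (evenReturnSeries 1) = (n.centralBinom : ℝ) / 4 ^ n := by
  rw [coeff_evenReturnSeries, card_closedStepSeqs_one, pow_mul]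
  norm_num

theorem coeff_evenReturnSeries_two (n : ℕ) :
    coeff n (evenReturnSeries 2) = coeff n (evenReturnSeries 1) ^ 2 := by
  rw [coeff_evenReturnSeries, card_closedStepSeqs_two, coeff_evenReturnSeries_one, div_pow,
    ← pow_mul, pow_mul, mul_comm n 2, pow_mul]
  norm_num

theorem coeff_succ_evenReturnSeries_one (n : ℕ) :
    ((n : ℝ) + 1) * coeff (n + 1) (evenReturnSeries 1)
      = ((n : ℝ) + 1 / 2) * coeff n (evenReturnSeries 1) := by
  rw [coeff_evenReturnSeries_one, coeff_evenReturnSeries_one]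
  have h : ((n : ℝ) + 1) * ((n + 1).centralBinom : ℝ) = 2 * (2 * n + 1) * (n.centralBinom : ℝ) := by
    exact_mod_cast Nat.succ_mul_centralBinom_succ n
  rw [pow_succ, mul_div_assoc', h]
  field_simp
  ring

/-- The recursion for central binomials says `(1 - X) * U' = U / 2`; hence `(1 - X) * U ^ 2` has
derivative zero. -/
theorem one_sub_X_mul_evenReturnSeries_one_sq :
    (1 - X) * evenReturnSeries 1 ^ 2 = (1 : ℝ⟦X⟧) := by
  set U := evenReturnSeries 1 with hU
  have h1 : (1 - X) * derivative ℝ U = (1 / 2 : ℝ) • U := by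
    ext n
    rw [sub_mul, one_mul, map_sub, coeff_X_mul_derivative, coeff_derivative, coeff_smul,
      mul_comm, coeff_succ_evenReturnSeries_one, smul_eq_mul]
    ring
  refine derivative.ext ?_ ?_
  · rw [Derivation.leibniz, derivative_pow, map_sub, Derivation.map_one_eq_zero, derivative_X,
      smul_eq_mul, smul_eq_mul]
    have h2 : (1 - X) * (((2 : ℕ) : ℝ⟦X⟧) * U ^ (2 - 1) * derivative ℝ U)
        = 2 * U * ((1 - X) * derivative ℝ U) := by
      push_cast
      ring
    rw [h2, h1, smul_eq_C_mul]
    have h3 : (2 : ℝ⟦X⟧) * C (1 / 2 : ℝ) = 1 := by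
      rw [← map_ofNat (C (R := ℝ)) 2, ← map_mul]
      norm_num
    linear_combination U ^ 2 * h3
  · rw [map_mul, map_pow, map_sub, constantCoeff_X, ← coeff_zero_eq_constantCoeff_apply U,
      coeff_zero_evenReturnSeries]
    simp

/-- The equation fixes `u⁻¹` up to sign; the principal root has nonnegative real part, which decides
the sign. -/
theorem sqrt_eq_inv_of_sq_mul {x u : ℂ} (h : x * u ^ 2 = 1) (hu : 0 < u.re) :
    Complex.sqrt x = u⁻¹ := by
  have hu0 : u ≠ 0 := fun h0 => by simp [h0] at hu
  have h1 : Complex.sqrt x ^ 2 = x := by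
    exact Complex.cpow_nat_inv_pow x two_ne_zero
  have h2 : 0 ≤ (Complex.sqrt x).re := by
    unfold Complex.sqrt
    rw [Complex.cpow_inv_two_re]
    exact Real.sqrt_nonneg _
  have h3 : (Complex.sqrt x * u) ^ 2 = 1 := by rw [mul_pow, h1, h]
  rcases mul_self_eq_one_iff.1 ((sq _).symm.trans h3) with h4 | h4
  · exact eq_inv_of_mul_eq_one_left h4
  · exfalso
    have h5 : Complex.sqrt x = -u⁻¹ := by
      rw [eq_div_of_mul_eq hu0 h4, neg_div, one_div]
    rw [h5, Complex.neg_re, Complex.inv_re] at h2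
    have := div_pos hu (Complex.normSq_pos.2 hu0)
    linarith

theorem sqrt_one_sub_eq {w : ℂ} (hw : ‖w‖ < 1) :
    Complex.sqrt (1 - w) = (discSum (evenReturnSeries 1) w)⁻¹ := by
  have hU := convergesOnDisc_evenReturnSeries 1
  refine sqrt_eq_inv_of_sq_mul ?_ ?_
  · have hX : discSum X w = w := by simpa using discSum_X_pow 1 w
    have hXc : ConvergesOnDisc (X : ℝ⟦X⟧) := by simpa using ConvergesOnDisc.X_pow 1
    have h : discSum ((1 - X) * evenReturnSeries 1 ^ 2) w = 1 := by
      rw [one_sub_X_mul_evenReturnSeries_one_sq, discSum_one]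
    rwa [discSum_mul (.sub .one hXc) (hU.pow 2) hw, discSum_sub .one hXc hw, discSum_one, hX,
      discSum_pow hU hw] at h
  · exact re_discSum_pos (evenReturnSeries_renewal 1) hU (convergesOnDisc_evenFirstReturnSeries 1)
      (coeff_evenReturnSeries_nonneg 1) (coeff_evenFirstReturnSeries_nonneg 1) hw

theorem walkH_one {z : ℂ} (hz : ‖z‖ < 1 / 2) : walkH (0 : Fin 1 → ℤ) z =
    (1 - Complex.sqrt (1 - 4 * z ^ 2)) / Complex.sqrt (1 - 4 * z ^ 2) := by
  have hz' : ‖z‖ < 1 / (2 * ((1 : ℕ) : ℝ)) := by simpa using hz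
  have h1 := one_add_walkH_eq_even le_rfl hz'
  have hw : ‖4 * z ^ 2‖ < 1 := by
    have := norm_nonneg z
    simp only [norm_mul, norm_pow, Complex.norm_ofNat]
    nlinarith
  have h2 : (2 * ((1 : ℕ) : ℂ) * z) ^ 2 = 4 * z ^ 2 := by
    push_cast
    ring
  rw [h2] at h1
  have h0 : discSum (evenReturnSeries 1) (4 * z ^ 2) ≠ 0 := by
    intro h0
    have h3 := re_one_add_walkH_pos le_rfl hz'
    rw [h1, h0, Complex.zero_re] at h3
    exact lt_irrefl _ h3
  rw [sqrt_one_sub_eq hw, ← h1, sub_div, div_self (inv_ne_zero (h1 ▸ h0)), one_div, inv_inv]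
  ring

theorem prod_eq_coeff_evenReturnSeries_one (n : ℕ) :
    ∏ i ∈ Finset.range n, (2 * (i : ℝ) + 1) / (2 * i + 2) = coeff n (evenReturnSeries 1) := by
  induction n with
  | zero => rw [coeff_zero_evenReturnSeries, Finset.prod_range_zero]
  | succ n ih =>
    have h4 : (n : ℝ) + 1 ≠ 0 := by positivity
    rw [Finset.prod_range_succ, ih]
    apply mul_left_cancel₀ h4
    rw [coeff_succ_evenReturnSeries_one]
    field_simp

theorem integral_sin_pow_even_half (n : ℕ) : ∫ θ in (0 : ℝ)..(Real.pi / 2), Real.sin θ ^ (2 * n)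
    = Real.pi / 2 * coeff n (evenReturnSeries 1) := by
  have h1 : ∫ θ in (0 : ℝ)..(Real.pi / 2), Real.sin θ ^ (2 * n)
      = ∫ θ in (0 : ℝ)..(Real.pi / 2), Real.cos θ ^ (2 * n) := by
    have := intervalIntegral.integral_comp_sub_left (a := 0) (b := Real.pi / 2)
      (fun θ => Real.sin θ ^ (2 * n)) (Real.pi / 2)
    simp only [Real.sin_pi_div_two_sub, sub_self, sub_zero] at this
    exact this.symm
  rw [h1, EulerSine.integral_cos_pow_eq, integral_sin_pow_even]
  rw [prod_eq_coeff_evenReturnSeries_one]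
  ring

/-- Expand the inverse square root with the one-dimensional coefficients. The integral of `sin ^ (2
* n)` supplies the same coefficient again, and its square is the two-dimensional one. -/
theorem ellipticK_eq {m : ℂ} (hm : ‖m‖ < 1) :
    ellipticK m = Real.pi / 2 * discSum (evenReturnSeries 2) m := by
  have hU := convergesOnDisc_evenReturnSeries 1
  have hsin : ∀ θ : ℝ, ‖m * ((Real.sin θ : ℝ) : ℂ) ^ 2‖ ≤ ‖m‖ := by
    intro θ
    rw [norm_mul, norm_pow, Complex.norm_real, Real.norm_eq_abs, sq_abs]
    exact mul_le_of_le_one_right (norm_nonneg m) (Real.sin_sq_le_one θ)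
  have h : HasSum (fun n : ℕ => ∫ θ in (0 : ℝ)..(Real.pi / 2),
      ((coeff n (evenReturnSeries 1) : ℝ) : ℂ) * (m * ((Real.sin θ : ℝ) : ℂ) ^ 2) ^ n)
      (∫ θ in (0 : ℝ)..(Real.pi / 2),
        discSum (evenReturnSeries 1) (m * ((Real.sin θ : ℝ) : ℂ) ^ 2)) := by
    refine intervalIntegral.hasSum_integral_of_dominated_convergence
      (fun n _ => ‖m‖ ^ n) (fun n => ?_) (fun n => ?_) ?_ ?_ ?_
    · exact Continuous.aestronglyMeasurable (by fun_prop)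
    · refine ae_of_all _ fun θ _ => ?_
      rw [norm_mul, norm_pow, Complex.norm_real,
        Real.norm_of_nonneg (coeff_evenReturnSeries_nonneg 1 n)]
      calc _ ≤ 1 * ‖m‖ ^ n := by
            gcongr
            · exact coeff_evenReturnSeries_le_one 1 n
            · exact hsin θ
        _ = _ := one_mul _
    · exact ae_of_all _ fun θ _ => summable_geometric_of_lt_one (norm_nonneg m) hm
    · exact intervalIntegrable_const
    · exact ae_of_all _ fun θ _ => hU.hasSum ((hsin θ).trans_lt hm)
  have h1 : ellipticK m = ∫ θ in (0 : ℝ)..(Real.pi / 2),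
      discSum (evenReturnSeries 1) (m * ((Real.sin θ : ℝ) : ℂ) ^ 2) := by
    unfold ellipticK
    congr 1
    ext θ
    rw [sqrt_one_sub_eq ((hsin θ).trans_lt hm), one_div, inv_inv]
  rw [h1, ← h.tsum_eq]
  unfold discSum
  rw [← tsum_mul_left]
  refine tsum_congr fun n => ?_
  have h2 : ∀ θ : ℝ, ((coeff n (evenReturnSeries 1) : ℝ) : ℂ) * (m * ((Real.sin θ : ℝ) : ℂ) ^ 2) ^ n
      = (((coeff n (evenReturnSeries 1) : ℝ) : ℂ) * m ^ n) * ((Real.sin θ ^ (2 * n) : ℝ) : ℂ) := by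
    intro θ
    push_cast
    ring
  simp only [h2]
  rw [intervalIntegral.integral_const_mul, intervalIntegral.integral_ofReal,
    integral_sin_pow_even_half, coeff_evenReturnSeries_two]
  push_cast
  ring

theorem walkH_two {z : ℂ} (hz : ‖z‖ < 1 / 4) :
    walkH (0 : Fin 2 → ℤ) z = 2 / (Real.pi : ℂ) * ellipticK (16 * z ^ 2) - 1 := by
  have hz' : ‖z‖ < 1 / (2 * ((2 : ℕ) : ℝ)) := by
    norm_num
    norm_num at hz
    exact hz
  have h1 := one_add_walkH_eq_even one_le_two hz'
  have hw : ‖16 * z ^ 2‖ < 1 := by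
    have := norm_nonneg z
    simp only [norm_mul, norm_pow, Complex.norm_ofNat]
    nlinarith
  have h2 : (2 * ((2 : ℕ) : ℂ) * z) ^ 2 = 16 * z ^ 2 := by
    push_cast
    ring
  have hpi : (Real.pi : ℂ) ≠ 0 := Complex.ofReal_ne_zero.2 Real.pi_ne_zero
  rw [h2] at h1
  rw [ellipticK_eq hw, ← h1]
  field_simp
  ring

end EvenSeries

/-! ### Size and regularity of the return probabilities -/

section ReturnBounds

open PowerSeries

variable {d : ℕ}

/-- The square of the characteristic function of a step. -/
noncomputable def stepCharSq (θ : Fin d → ℝ) : ℝ := (stepCos θ / (2 * d)) ^ 2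

theorem continuous_stepCharSq : Continuous (stepCharSq (d := d)) :=
  (continuous_stepCos.div_const _).pow 2

theorem stepCharSq_nonneg (θ : Fin d → ℝ) : 0 ≤ stepCharSq θ := sq_nonneg _

theorem stepCharSq_le_one (θ : Fin d → ℝ) : stepCharSq θ ≤ 1 := by
  unfold stepCharSq
  rw [sq_le_one_iff_abs_le_one, abs_div, abs_of_nonneg (a := (2 * d : ℝ)) (by positivity)]
  exact div_le_one_of_le₀ (abs_stepCos_le θ) (by positivity)

/-- The `u_n` are thus moments of a variable with values in `[0, 1]`, hence decreasing and convex in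
`n`; the argument never needs finer local estimates. -/
theorem coeff_evenReturnSeries_eq_integral (n : ℕ) :
    coeff n (evenReturnSeries d) = ∫ θ, stepCharSq θ ^ n ∂(torusUniform d) := by
  rw [coeff_evenReturnSeries, card_closedStepSeqs_eq_integral, ← integral_div]
  congr 1
  ext θ
  unfold stepCharSq
  rw [← pow_mul, div_pow]

theorem integrable_of_continuous_of_bound {g : (Fin d → ℝ) → ℝ} (hg : Continuous g) {C : ℝ}
    (hC : ∀ θ, |g θ| ≤ C) : Integrable g (torusUniform d) :=
  Integrable.of_bound hg.aestronglyMeasurable C (ae_of_all _ hC)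

theorem integrable_stepCharSq_pow (n : ℕ) :
    Integrable (fun θ => stepCharSq θ ^ n) (torusUniform d) :=
  integrable_of_continuous_of_bound (continuous_stepCharSq.pow n) (C := 1) fun θ => by
    rw [abs_of_nonneg (pow_nonneg (stepCharSq_nonneg θ) n)]
    exact pow_le_one₀ (stepCharSq_nonneg θ) (stepCharSq_le_one θ)

theorem antitone_coeff_evenReturnSeries (d : ℕ) :
    Antitone fun n => coeff n (evenReturnSeries d) := by
  refine antitone_nat_of_succ_le fun n => ?_
  simp only [coeff_evenReturnSeries_eq_integral]
  refine integral_mono (integrable_stepCharSq_pow _) (integrable_stepCharSq_pow _) fun θ => ?_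
  exact pow_le_pow_of_le_one (stepCharSq_nonneg θ) (stepCharSq_le_one θ) (Nat.le_succ n)

theorem antitone_coeff_sub_evenReturnSeries (d : ℕ) :
    Antitone fun n => coeff n (evenReturnSeries d) - coeff (n + 1) (evenReturnSeries d) := by
  refine antitone_nat_of_succ_le fun n => ?_
  simp only [coeff_evenReturnSeries_eq_integral]
  rw [← integral_sub (integrable_stepCharSq_pow _) (integrable_stepCharSq_pow _),
    ← integral_sub (integrable_stepCharSq_pow _) (integrable_stepCharSq_pow _)]
  refine integral_mono ((integrable_stepCharSq_pow _).sub (integrable_stepCharSq_pow _))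
    ((integrable_stepCharSq_pow _).sub (integrable_stepCharSq_pow _)) fun θ => ?_
  have h0 := stepCharSq_nonneg θ
  have h1 := stepCharSq_le_one θ
  have h2 : 0 ≤ stepCharSq θ ^ n * (1 - stepCharSq θ) ^ 2 := by positivity
  simp only [pow_succ]
  nlinarith

/-- Cauchy-Schwarz, then `1 - t ≤ exp (-t)`. Using `sin ^ 2` treats the two maxima of the squared
characteristic function, at `0` and at `(π, ..., π)`, together, and the bound factors over the
coordinates. -/
theorem stepCharSq_le_exp (hd : 1 ≤ d) (θ : Fin d → ℝ) :
    stepCharSq θ ≤ ∏ i, Real.exp (-(Real.sin (θ i) ^ 2 / d)) := by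
  have hd0 : (0 : ℝ) < d := by positivity
  have h1 : (∑ i, Real.cos (θ i)) ^ 2 ≤ d * ∑ i, Real.cos (θ i) ^ 2 := by
    simpa using sq_sum_le_card_mul_sum_sq (s := Finset.univ) (f := fun i => Real.cos (θ i))
  have h2 : stepCharSq θ = (∑ i, Real.cos (θ i)) ^ 2 / d ^ 2 := by
    unfold stepCharSq stepCos
    rw [← Finset.mul_sum, mul_div_mul_left _ _ two_ne_zero, div_pow]
  have h3 : ∑ i, Real.cos (θ i) ^ 2 = d - ∑ i, Real.sin (θ i) ^ 2 := by
    simp only [Real.cos_sq', Finset.sum_sub_distrib]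
    simp
  rw [← Real.exp_sum, Finset.sum_neg_distrib, ← Finset.sum_div, h2]
  refine le_trans ?_ (Real.add_one_le_exp _)
  rw [h3] at h1
  rw [div_le_iff₀ (by positivity)]
  refine h1.trans (le_of_eq ?_)
  field_simp
  ring

/-- By periodicity it is enough to integrate over `[-π / 2, π / 2]`, where `|sin x| ≥ 2 * |x| / π`
gives a Gaussian majorant. -/
theorem integral_exp_neg_mul_sin_sq_le {t : ℝ} (ht : 0 < t) :
    ∫ x, Real.exp (-(t * Real.sin x ^ 2)) ∂circleUniform ≤ √(Real.pi / t) := by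
  have hpi := Real.pi_pos
  have hper : Function.Periodic (fun x => Real.exp (-(t * Real.sin x ^ 2))) Real.pi := by
    intro x
    simp only [Real.sin_add_pi, neg_sq]
  have hcont : Continuous fun x => Real.exp (-(t * Real.sin x ^ 2)) := by fun_prop
  have h1 : ∫ x in (-Real.pi)..Real.pi, Real.exp (-(t * Real.sin x ^ 2))
      = 2 * ∫ x in (-(Real.pi / 2))..(Real.pi / 2), Real.exp (-(t * Real.sin x ^ 2)) := by
    rw [← intervalIntegral.integral_add_adjacent_intervals (b := 0)
      (hcont.intervalIntegrable _ _) (hcont.intervalIntegrable _ _)]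
    have e1 := hper.intervalIntegral_add_eq (-Real.pi) (-(Real.pi / 2))
    have e2 := hper.intervalIntegral_add_eq 0 (-(Real.pi / 2))
    rw [neg_add_cancel] at e1
    rw [zero_add] at e2
    rw [e1, e2, show -(Real.pi / 2) + Real.pi = Real.pi / 2 by ring]
    ring
  have hb : 0 < t * (2 / Real.pi) ^ 2 := by positivity
  have hint := integrable_exp_neg_mul_sq hb
  have h2 : ∫ x in (-(Real.pi / 2))..(Real.pi / 2), Real.exp (-(t * Real.sin x ^ 2))
      ≤ √(Real.pi / (t * (2 / Real.pi) ^ 2)) := by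
    rw [← integral_gaussian, intervalIntegral.integral_of_le (by linarith)]
    refine (setIntegral_mono_on (hcont.integrableOn_Ioc) hint.integrableOn measurableSet_Ioc
      fun x hx => ?_).trans (setIntegral_le_integral hint (ae_of_all _ fun x => by positivity))
    rw [Real.exp_le_exp, neg_mul, neg_le_neg_iff, mul_assoc]
    refine mul_le_mul_of_nonneg_left ?_ ht.le
    have h3 := Real.mul_abs_le_abs_sin (x := x) (abs_le.2 ⟨by linarith [hx.1], hx.2⟩)
    rw [← sq_abs x, ← sq_abs (Real.sin x), ← mul_pow]
    exact pow_le_pow_left₀ (by positivity) h3 2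
  rw [integral_circleUniform, h1, smul_eq_mul]
  have h4 : Real.pi / (t * (2 / Real.pi) ^ 2) = (Real.pi / t) * (Real.pi / 2) ^ 2 := by
    field_simp
  rw [h4, Real.sqrt_mul (by positivity), Real.sqrt_sq (by positivity)] at h2
  have h5 : 0 ≤ √(Real.pi / t) := Real.sqrt_nonneg _
  calc _ ≤ (2 * Real.pi)⁻¹ * (2 * (√(Real.pi / t) * (Real.pi / 2))) := by gcongr
    _ = √(Real.pi / t) / 2 := by field_simp
    _ ≤ _ := by linarith

theorem rpow_neg_half_eq (x : ℝ) (hx : 0 ≤ x) (d : ℕ) :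
    x ^ (-((d : ℝ) / 2)) = (1 / √x) ^ d := by
  rw [Real.rpow_neg hx, div_pow, one_pow, ← inv_eq_one_div, Real.sqrt_eq_rpow, ← Real.rpow_mul_natCast hx]
  congr 2
  ring

theorem coeff_evenReturnSeries_le (hd : 1 ≤ d) : ∃ C : ℝ, 0 < C ∧ ∀ n : ℕ,
    coeff n (evenReturnSeries d) ≤ C * ((n : ℝ) + 1) ^ (-((d : ℝ) / 2)) := by
  have hd0 : (1 : ℝ) ≤ d := by exact_mod_cast hd
  have hpi := Real.pi_gt_three
  -- For `n ≥ 1` the Gaussian bound is `√(π * d / n) ≤ K / √(n + 1)`; the case `n = 0` needs only `1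
  -- ≤ K`.
  set K : ℝ := √(2 * Real.pi * d) with hK
  have hK1 : 1 ≤ K := by
    rw [hK, Real.one_le_sqrt]
    nlinarith
  refine ⟨K ^ d, by positivity, fun n => ?_⟩
  rw [rpow_neg_half_eq _ (by positivity), ← mul_pow]
  rcases Nat.eq_zero_or_pos n with rfl | hn
  · rw [coeff_zero_evenReturnSeries]
    refine one_le_pow₀ ?_
    simpa using hK1
  have hn0 : (1 : ℝ) ≤ n := by exact_mod_cast hn
  rw [coeff_evenReturnSeries_eq_integral]
  calc ∫ θ, stepCharSq θ ^ n ∂(torusUniform d)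
      ≤ ∫ θ, ∏ i, Real.exp (-((n : ℝ) / d * Real.sin (θ i) ^ 2)) ∂(torusUniform d) := by
        refine integral_mono (integrable_stepCharSq_pow n) (integrable_of_continuous_of_bound
          (by fun_prop) (C := 1) fun θ => ?_) fun θ => ?_
        · rw [abs_of_nonneg (by positivity)]
          refine Finset.prod_le_one (fun i _ => by positivity) fun i _ => ?_
          rw [Real.exp_le_one_iff, neg_nonpos]
          positivity
        · refine (pow_le_pow_left₀ (stepCharSq_nonneg θ) (stepCharSq_le_exp hd θ) n).trans
            (le_of_eq ?_)
          rw [← Finset.prod_pow]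
          refine Finset.prod_congr rfl fun i _ => ?_
          rw [← Real.exp_nat_mul]
          congr 1
          ring
    _ = (∫ x, Real.exp (-((n : ℝ) / d * Real.sin x ^ 2)) ∂circleUniform) ^ d := by
        unfold torusUniform
        rw [integral_fintype_prod_eq_prod (𝕜 := ℝ)
          fun _ x => Real.exp (-((n : ℝ) / d * Real.sin x ^ 2))]
        simp
    _ ≤ (K * (1 / √((n : ℝ) + 1))) ^ d := by
        refine pow_le_pow_left₀ (integral_nonneg fun x => by positivity) ?_ d
        refine (integral_exp_neg_mul_sin_sq_le (by positivity)).trans ?_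
        rw [hK, mul_one_div, ← Real.sqrt_div (by positivity)]
        refine Real.sqrt_le_sqrt ?_
        rw [div_div_eq_mul_div, div_le_div_iff₀ (by positivity) (by positivity)]
        nlinarith [mul_pos Real.pi_pos (show (0 : ℝ) < d by linarith)]

theorem integral_indicator_circleUniform {δ : ℝ} (h0 : 0 ≤ δ) (h1 : δ < Real.pi) :
    ∫ x, (Set.Icc (-δ) δ).indicator (fun _ => (1 : ℝ)) x ∂circleUniform = δ / Real.pi := by
  rw [integral_indicator measurableSet_Icc, setIntegral_const, smul_eq_mul, mul_one]
  unfold circleUniform Measure.real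
  rw [Measure.smul_apply, Measure.restrict_apply measurableSet_Icc, Set.inter_eq_left.2,
    Real.volume_Icc, smul_eq_mul, ← ENNReal.ofReal_mul (by positivity), ENNReal.toReal_ofReal]
  · field_simp
    ring
  · have : 0 ≤ δ - -δ := by linarith
    positivity
  · exact fun x hx => ⟨by linarith [hx.1], by linarith [hx.2]⟩

theorem le_coeff_evenReturnSeries (hd : 1 ≤ d) : ∃ c : ℝ, 0 < c ∧ ∀ n : ℕ,
    c * ((n : ℝ) + 1) ^ (-((d : ℝ) / 2)) ≤ coeff n (evenReturnSeries d) := by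
  have hd0 : (1 : ℝ) ≤ d := by exact_mod_cast hd
  have hpi := Real.pi_gt_three
  refine ⟨1 / 2 * (1 / (√2 * Real.pi)) ^ d, by positivity, fun n => ?_⟩
  have hn1 : (1 : ℝ) ≤ (n : ℝ) + 1 := by linarith [Nat.cast_nonneg (α := ℝ) n]
  -- On the box `|θ i| ≤ δ` the characteristic function is at least `1 - 1 / (4 * (n + 1))`, so by
  -- Bernoulli its power `2 * n` is at least `1 / 2`; the box has measure `(δ / π) ^ d`.
  set δ : ℝ := 1 / √(2 * ((n : ℝ) + 1)) with hδ
  have hδ0 : 0 < δ := by positivity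
  have hδ2 : δ ^ 2 = 1 / (2 * ((n : ℝ) + 1)) := by
    rw [hδ, div_pow, Real.sq_sqrt (by positivity), one_pow]
  have hδ1 : δ ≤ 1 := by
    rw [hδ]
    refine div_le_one_of_le₀ ?_ (by positivity)
    rw [Real.one_le_sqrt]
    linarith
  have hbox : ∀ θ : Fin d → ℝ,
      1 / 2 * ∏ i, (Set.Icc (-δ) δ).indicator (fun _ => (1 : ℝ)) (θ i) ≤ stepCharSq θ ^ n := by
    intro θ
    by_cases hθ : ∀ i, θ i ∈ Set.Icc (-δ) δ
    · rw [Finset.prod_congr rfl fun i _ => Set.indicator_of_mem (hθ i) _, Finset.prod_const_one,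
        mul_one]
      have hcos : ∀ i, 1 - 1 / (4 * ((n : ℝ) + 1)) ≤ Real.cos (θ i) := by
        intro i
        refine le_trans ?_ (Real.one_sub_sq_div_two_le_cos)
        have h1 : (θ i) ^ 2 ≤ δ ^ 2 := sq_le_sq' (hθ i).1 (hθ i).2
        rw [hδ2] at h1
        have h2 : 1 / (4 * ((n : ℝ) + 1)) = 1 / (2 * ((n : ℝ) + 1)) / 2 := by field_simp; norm_num
        rw [h2]
        linarith
      have hsum : 1 - 1 / (4 * ((n : ℝ) + 1)) ≤ stepCos θ / (2 * d) := by
        rw [le_div_iff₀ (by positivity)]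
        unfold stepCos
        have := Finset.sum_le_sum fun i (_ : i ∈ Finset.univ) =>
          mul_le_mul_of_nonneg_left (hcos i) zero_le_two
        refine le_trans (le_of_eq ?_) this
        simp
        ring
      have h4 : 1 / (4 * ((n : ℝ) + 1)) ≤ 1 := div_le_one_of_le₀ (by linarith) (by positivity)
      unfold stepCharSq
      rw [← pow_mul]
      refine le_trans ?_ (pow_le_pow_left₀ (by linarith) hsum (2 * n))
      have h5 := one_add_mul_le_pow (a := -(1 / (4 * ((n : ℝ) + 1)))) (by linarith) (2 * n)
      rw [← sub_eq_add_neg] at h5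
      refine le_trans ?_ h5
      push_cast
      have h6 : 2 * (n : ℝ) * (1 / (4 * ((n : ℝ) + 1))) ≤ 1 / 2 := by
        rw [mul_one_div, div_le_div_iff₀ (by positivity) two_pos]
        linarith
      linarith
    · push Not at hθ
      obtain ⟨i, hi⟩ := hθ
      rw [Finset.prod_eq_zero (Finset.mem_univ i) (Set.indicator_of_notMem hi _), mul_zero]
      exact pow_nonneg (stepCharSq_nonneg θ) n
  rw [coeff_evenReturnSeries_eq_integral]
  calc 1 / 2 * (1 / (√2 * Real.pi)) ^ d * ((n : ℝ) + 1) ^ (-((d : ℝ) / 2))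
      = 1 / 2 * (δ / Real.pi) ^ d := by
        rw [rpow_neg_half_eq _ (by positivity), mul_assoc, ← mul_pow, hδ,
          Real.sqrt_mul zero_le_two]
        congr 2
        field_simp
    _ = ∫ θ : Fin d → ℝ, 1 / 2 * ∏ i, (Set.Icc (-δ) δ).indicator (fun _ => (1 : ℝ)) (θ i)
          ∂(torusUniform d) := by
        rw [integral_const_mul]
        unfold torusUniform
        rw [integral_fintype_prod_eq_prod (𝕜 := ℝ)
          fun _ x => (Set.Icc (-δ) δ).indicator (fun _ => (1 : ℝ)) x]
        simp only [integral_indicator_circleUniform hδ0.le (by linarith : δ < Real.pi)]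
        simp [div_pow]
    _ ≤ _ := integral_mono_of_nonneg (ae_of_all _ fun θ => mul_nonneg (by norm_num)
          (Finset.prod_nonneg fun i _ => Set.indicator_nonneg (fun _ _ => zero_le_one) _))
          (integrable_stepCharSq_pow n) (ae_of_all _ hbox)

end ReturnBounds

/-! ### Sequences of polynomial decay -/

section Decay

open PowerSeries

/-- The weight `(n + 1) ^ (-s)`. -/
noncomputable def decayWeight (s : ℝ) (n : ℕ) : ℝ := ((n : ℝ) + 1) ^ (-s)

theorem decayWeight_pos (s : ℝ) (n : ℕ) : 0 < decayWeight s n :=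
  Real.rpow_pos_of_pos (by positivity) _

theorem decayWeight_nonneg (s : ℝ) (n : ℕ) : 0 ≤ decayWeight s n := (decayWeight_pos s n).le

theorem antitone_decayWeight {s : ℝ} (hs : 0 ≤ s) : Antitone (decayWeight s) := by
  intro m n hmn
  unfold decayWeight
  refine Real.rpow_le_rpow_of_nonpos (by positivity) ?_ (neg_nonpos.2 hs)
  have : (m : ℝ) ≤ n := by exact_mod_cast hmn
  linarith

/-- In a convolution one of the two indices is at least half of `n`; replacing its weight by that of
`n` costs only a constant. -/
theorem decayWeight_le_of_le_two_mul {s : ℝ} (hs : 0 ≤ s) {j n : ℕ} (h : n ≤ 2 * j + 1) :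
    decayWeight s j ≤ 2 ^ s * decayWeight s n := by
  have h1 : ((n : ℝ) + 1) / 2 ≤ (j : ℝ) + 1 := by
    have : (n : ℝ) ≤ 2 * j + 1 := by exact_mod_cast h
    linarith
  unfold decayWeight
  refine (Real.rpow_le_rpow_of_nonpos (by positivity) h1 (neg_nonpos.2 hs)).trans (le_of_eq ?_)
  rw [Real.div_rpow (by positivity) zero_le_two, Real.rpow_neg zero_le_two, div_inv_eq_mul,
    mul_comm]

theorem mul_decayWeight (s : ℝ) (n : ℕ) :
    ((n : ℝ) + 1) * decayWeight s n = decayWeight (s - 1) n := by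
  unfold decayWeight
  rw [neg_sub, sub_eq_neg_add, Real.rpow_add_one (by positivity), mul_comm]

/-- A discrete form of the derivative of `x ^ (1 - s)`; it telescopes to the tail bound
`sum_decayWeight_tail_le`. -/
theorem mul_sub_decayWeight_le {s : ℝ} (hs : 1 ≤ s) (n : ℕ) :
    (s - 1) * decayWeight s (n + 1) ≤ decayWeight (s - 1) n - decayWeight (s - 1) (n + 1) := by
  have hy : (0 : ℝ) < (n : ℝ) + 1 + 1 := by positivity
  have hx : (0 : ℝ) < (n : ℝ) + 1 := by positivity
  have h1 : 1 + (s - 1) / ((n : ℝ) + 1 + 1)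
      ≤ (((n : ℝ) + 1) / ((n : ℝ) + 1 + 1)) ^ (-(s - 1)) := by
    rw [Real.rpow_def_of_pos (by positivity)]
    have h2 : Real.log (((n : ℝ) + 1) / ((n : ℝ) + 1 + 1)) ≤ -(1 / ((n : ℝ) + 1 + 1)) := by
      refine (Real.log_le_sub_one_of_pos (by positivity)).trans (le_of_eq ?_)
      field_simp
      ring
    refine le_trans ?_ (Real.add_one_le_exp _)
    have h3 := mul_le_mul_of_nonneg_right h2 (by linarith : 0 ≤ s - 1)
    rw [div_eq_mul_one_div]
    linarith
  have h4 := mul_le_mul_of_nonneg_left h1 (decayWeight_nonneg (s - 1) (n + 1))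
  have h5 : decayWeight (s - 1) (n + 1) * (((n : ℝ) + 1) / ((n : ℝ) + 1 + 1)) ^ (-(s - 1))
      = decayWeight (s - 1) n := by
    unfold decayWeight
    push_cast
    rw [← Real.mul_rpow hy.le (by positivity), mul_div_cancel₀ _ hy.ne']
  have h6 : decayWeight (s - 1) (n + 1) * ((s - 1) / ((n : ℝ) + 1 + 1))
      = (s - 1) * decayWeight s (n + 1) := by
    rw [← mul_decayWeight]
    push_cast
    field_simp
  rw [h5, mul_add, mul_one, h6] at h4
  linarith

theorem summable_decayWeight {s : ℝ} (hs : 1 < s) : Summable (decayWeight s) := by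
  have h := (summable_nat_add_iff 1).2 (Real.summable_nat_rpow.2 (by linarith : -s < -1))
  refine h.congr fun n => ?_
  unfold decayWeight
  push_cast
  rfl

theorem sum_decayWeight_tail_le {s : ℝ} (hs : 1 < s) (n N : ℕ) :
    ∑ j ∈ Finset.range N, decayWeight s (j + (n + 1)) ≤ decayWeight (s - 1) n / (s - 1) := by
  have h : ∑ j ∈ Finset.range N, decayWeight s (j + (n + 1))
      ≤ (decayWeight (s - 1) n - decayWeight (s - 1) (n + N)) / (s - 1) := by
    induction N with
    | zero => simp
    | succ N ih =>
      have h1 := mul_sub_decayWeight_le hs.le (n + N)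
      rw [mul_comm, ← le_div_iff₀ (by linarith)] at h1
      rw [Finset.sum_range_succ, show N + (n + 1) = n + N + 1 by ring, ← add_assoc]
      refine (add_le_add ih h1).trans (le_of_eq ?_)
      ring
  refine h.trans ?_
  have := decayWeight_nonneg (s - 1) (n + N)
  gcongr
  linarith

/-- Absolutely summable coefficients of size `O((n + 1) ^ (-s))`. -/
structure HasDecay (s : ℝ) (A : ℝ⟦X⟧) : Prop where
  summable : Summable fun n => |coeff n A|
  bound : ∃ C : ℝ, ∀ n, |coeff n A| ≤ C * decayWeight s n

variable {s : ℝ} {A B : ℝ⟦X⟧}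

theorem HasDecay.of_bound (hs : 1 < s) {C : ℝ} (h : ∀ n, |coeff n A| ≤ C * decayWeight s n) :
    HasDecay s A :=
  ⟨Summable.of_nonneg_of_le (fun _ => abs_nonneg _) h ((summable_decayWeight hs).mul_left C), C, h⟩

theorem HasDecay.one (s : ℝ) : HasDecay s 1 := by
  refine ⟨summable_of_ne_finset_zero (s := {0}) fun n hn => ?_, 1, fun n => ?_⟩
  · rw [coeff_one, if_neg (by simpa using hn), abs_zero]
  · rw [coeff_one]
    split_ifs with h
    · simp [h, decayWeight]
    · rw [abs_zero, one_mul]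
      exact decayWeight_nonneg s n

theorem HasDecay.sub (hA : HasDecay s A) (hB : HasDecay s B) : HasDecay s (A - B) := by
  obtain ⟨C, hC⟩ := hA.bound
  obtain ⟨D, hD⟩ := hB.bound
  have h : ∀ n, |coeff n (A - B)| ≤ |coeff n A| + |coeff n B| := fun n => by
    rw [map_sub]
    exact abs_sub _ _
  refine ⟨Summable.of_nonneg_of_le (fun _ => abs_nonneg _) h (hA.summable.add hB.summable),
    C + D, fun n => (h n).trans ?_⟩
  rw [add_mul]
  exact add_le_add (hC n) (hD n)

theorem summable_abs_coeff_mul (hA : Summable fun n => |coeff n A|)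
    (hB : Summable fun n => |coeff n B|) : Summable fun n => |coeff n (A * B)| := by
  have h := summable_norm_sum_mul_antidiagonal_of_summable_norm
    (f := fun n => coeff n A) (g := fun n => coeff n B) hA hB
  refine h.congr fun n => ?_
  rw [coeff_mul, Real.norm_eq_abs]

theorem tsum_coeff_mul (hA : Summable fun n => |coeff n A|)
    (hB : Summable fun n => |coeff n B|) :
    ∑' n, coeff n (A * B) = (∑' n, coeff n A) * ∑' n, coeff n B := by
  rw [tsum_mul_tsum_eq_tsum_sum_antidiagonal_of_summable_norm (f := fun n => coeff n A)
    (g := fun n => coeff n B) hA hB]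
  exact tsum_congr fun n => coeff_mul n A B

theorem sum_antidiagonal_fst_le_tsum {u : ℕ → ℝ} (hu : Summable u) (h0 : ∀ n, 0 ≤ u n) (n : ℕ) :
    ∑ x ∈ antidiagonal n, u x.1 ≤ ∑' n, u n := by
  rw [Finset.Nat.sum_antidiagonal_eq_sum_range_succ_mk]
  exact hu.sum_le_tsum _ fun i _ => h0 i

theorem sum_antidiagonal_snd_eq_fst (u : ℕ → ℝ) (n : ℕ) :
    ∑ x ∈ antidiagonal n, u x.2 = ∑ x ∈ antidiagonal n, u x.1 :=
  Finset.Nat.sum_antidiagonal_swap (f := fun x : ℕ × ℕ => u x.1)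

/-- The decay bound is applied to the factor with the larger index, and the other factor is summed.
-/
theorem HasDecay.mul (hs : 0 ≤ s) (hA : HasDecay s A) (hB : HasDecay s B) :
    HasDecay s (A * B) := by
  obtain ⟨C, hC⟩ := hA.bound
  obtain ⟨D, hD⟩ := hB.bound
  have hC0 : 0 ≤ C := nonneg_of_mul_nonneg_left ((abs_nonneg _).trans (hC 0)) (decayWeight_pos s 0)
  have hD0 : 0 ≤ D := nonneg_of_mul_nonneg_left ((abs_nonneg _).trans (hD 0)) (decayWeight_pos s 0)
  refine ⟨summable_abs_coeff_mul hA.summable hB.summable,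
    C * 2 ^ s * (∑' n, |coeff n B|) + D * 2 ^ s * ∑' n, |coeff n A|, fun n => ?_⟩
  have hw := decayWeight_nonneg s n
  have hterm : ∀ x ∈ antidiagonal n, |coeff x.1 A * coeff x.2 B|
      ≤ (C * (2 ^ s * decayWeight s n)) * |coeff x.2 B|
        + (D * (2 ^ s * decayWeight s n)) * |coeff x.1 A| := by
    intro x hx
    rw [mem_antidiagonal] at hx
    rw [abs_mul]
    by_cases h : n ≤ 2 * x.1
    · refine le_add_of_le_of_nonneg ?_ (by positivity)
      refine mul_le_mul_of_nonneg_right ((hC x.1).trans ?_) (abs_nonneg _)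
      exact mul_le_mul_of_nonneg_left (decayWeight_le_of_le_two_mul hs (by omega)) hC0
    · refine le_add_of_nonneg_of_le (by positivity) ?_
      rw [mul_comm]
      refine mul_le_mul_of_nonneg_right ((hD x.2).trans ?_) (abs_nonneg _)
      exact mul_le_mul_of_nonneg_left (decayWeight_le_of_le_two_mul hs (by omega)) hD0
  rw [coeff_mul]
  refine (Finset.abs_sum_le_sum_abs _ _).trans ((Finset.sum_le_sum hterm).trans ?_)
  rw [Finset.sum_add_distrib, ← Finset.mul_sum, ← Finset.mul_sum,
    sum_antidiagonal_snd_eq_fst fun i => |coeff i B|]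
  have h1 := sum_antidiagonal_fst_le_tsum hA.summable (fun _ => abs_nonneg _) n
  have h2 := sum_antidiagonal_fst_le_tsum hB.summable (fun _ => abs_nonneg _) n
  calc _ ≤ (C * (2 ^ s * decayWeight s n)) * (∑' n, |coeff n B|)
        + (D * (2 ^ s * decayWeight s n)) * ∑' n, |coeff n A| := by gcongr
    _ = _ := by ring

theorem HasDecay.pow (hs : 0 ≤ s) (hA : HasDecay s A) (k : ℕ) : HasDecay s (A ^ k) := by
  induction k with
  | zero => exact pow_zero A ▸ .one s
  | succ k ih => exact pow_succ A k ▸ ih.mul hs hA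

theorem tsum_coeff_one : ∑' n, coeff n (1 : ℝ⟦X⟧) = 1 := by
  simp only [coeff_one]
  exact tsum_ite_eq 0 1

theorem tsum_coeff_pow (hA : HasDecay s A) (hs : 0 ≤ s) (k : ℕ) :
    ∑' n, coeff n (A ^ k) = (∑' n, coeff n A) ^ k := by
  induction k with
  | zero => rw [pow_zero, pow_zero, tsum_coeff_one]
  | succ k ih => rw [pow_succ, tsum_coeff_mul (hA.pow hs k).summable hA.summable, ih, pow_succ]

theorem HasDecay.summable_coeff (hA : HasDecay s A) : Summable fun n => coeff n A :=
  hA.summable.of_abs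

theorem HasDecay.tsum_one_sub (hA : HasDecay s A) :
    ∑' n, coeff n (1 - A) = 1 - ∑' n, coeff n A := by
  simp only [map_sub]
  rw [(HasDecay.one s).summable_coeff.tsum_sub hA.summable_coeff, tsum_coeff_one]

theorem abs_sub_le_of_decay {b : ℕ → ℝ} {C : ℝ} (hs : 0 ≤ s) (hC : 0 ≤ C)
    (hb : ∀ n, |b (n + 1) - b n| ≤ C * decayWeight s n) (i j : ℕ) :
    |b (i + j) - b i| ≤ j * (C * decayWeight s i) := by
  induction j with
  | zero => simp
  | succ j ih =>
    have h1 : b (i + (j + 1)) - b i = (b (i + j + 1) - b (i + j)) + (b (i + j) - b i) := by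
      rw [← add_assoc]
      ring
    have h2 := hb (i + j)
    have h3 := mul_le_mul_of_nonneg_left (antitone_decayWeight hs (Nat.le_add_right i j)) hC
    rw [h1]
    refine (abs_add_le _ _).trans ((add_le_add (h2.trans h3) ih).trans (le_of_eq ?_))
    push_cast
    ring

/-- Convolution of a slowly varying sequence with a summable one. -/
theorem exists_convolution_bound (hs : 1 < s) {b : ℕ → ℝ} {C : ℝ}
    (hb : ∀ n, |b (n + 1) - b n| ≤ C * decayWeight s n)
    (hb' : ∀ n, |b n| ≤ C * decayWeight (s - 1) n) (hA : HasDecay s A) :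
    ∃ K : ℝ, ∀ n, |∑ x ∈ antidiagonal n, b x.1 * coeff x.2 A - b n * ∑' j, coeff j A|
      ≤ K * (decayWeight s n * ∑ j ∈ Finset.range (n + 1), decayWeight (s - 1) j) := by
  obtain ⟨D, hD⟩ := hA.bound
  have hs0 : 0 ≤ s := by linarith
  have hs1 : 0 ≤ s - 1 := by linarith
  have hC0 : 0 ≤ C := nonneg_of_mul_nonneg_left ((abs_nonneg _).trans (hb 0)) (decayWeight_pos s 0)
  have hD0 : 0 ≤ D := nonneg_of_mul_nonneg_left ((abs_nonneg _).trans (hD 0)) (decayWeight_pos s 0)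
  set M : ℝ := 2 * C * D * 2 ^ s with hM
  have hM0 : 0 ≤ M := by positivity
  refine ⟨2 * M + C * D / (s - 1), fun n => ?_⟩
  set E := ∑ j ∈ Finset.range (n + 1), decayWeight (s - 1) j with hE
  have hw := decayWeight_nonneg s n
  have hterm : ∀ x ∈ antidiagonal n, |(b x.1 - b n) * coeff x.2 A|
      ≤ M * decayWeight s n * (decayWeight (s - 1) x.1 + decayWeight (s - 1) x.2) := by
    rintro ⟨i, j⟩ hx
    rw [mem_antidiagonal] at hx
    simp only at hx ⊢
    have hi := decayWeight_nonneg (s - 1) i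
    have hj := decayWeight_nonneg (s - 1) j
    rw [abs_mul]
    -- For large `j` the decay of `A` gives the weight at `n`. For small `j` it comes from the `j`
    -- increments of `b` between `i` and `n`, and the factor `j` lowers the exponent of the weight
    -- at `j` by one.
    by_cases h : n ≤ 2 * j
    · have h1 : |coeff j A| ≤ D * (2 ^ s * decayWeight s n) := (hD j).trans
        (mul_le_mul_of_nonneg_left (decayWeight_le_of_le_two_mul hs0 (by omega)) hD0)
      have h2 : |b i - b n| ≤ 2 * C * decayWeight (s - 1) i := by
        have h3 := mul_le_mul_of_nonneg_left
          (antitone_decayWeight hs1 (show i ≤ n by omega)) hC0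
        have h4 := abs_sub (b i) (b n)
        linarith [hb' i, hb' n]
      calc _ ≤ (2 * C * decayWeight (s - 1) i) * (D * (2 ^ s * decayWeight s n)) := by gcongr
        _ = M * decayWeight s n * decayWeight (s - 1) i := by rw [hM]; ring
        _ ≤ _ := by gcongr; linarith
    · have h1 : |b i - b n| ≤ j * (C * (2 ^ s * decayWeight s n)) := by
        rw [abs_sub_comm, ← hx]
        refine (abs_sub_le_of_decay hs0 hC0 hb i j).trans ?_
        have := decayWeight_le_of_le_two_mul hs0 (show i + j ≤ 2 * i + 1 by omega)
        gcongr
      have h2 : (j : ℝ) * decayWeight s j ≤ decayWeight (s - 1) j := by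
        rw [← mul_decayWeight]
        have := decayWeight_nonneg s j
        nlinarith
      calc _ ≤ (j * (C * (2 ^ s * decayWeight s n))) * (D * decayWeight s j) := by
            gcongr
            exact hD j
        _ = (C * D * 2 ^ s) * decayWeight s n * (j * decayWeight s j) := by ring
        _ ≤ M * decayWeight s n * (decayWeight (s - 1) i + decayWeight (s - 1) j) := by
            have h3 : C * D * 2 ^ s ≤ M := by
              rw [hM]
              have : 0 ≤ C * D * 2 ^ s := by positivity
              linarith
            have h4 : 0 ≤ decayWeight s j := decayWeight_nonneg s j
            gcongr
            linarith
  have hmain : |∑ x ∈ antidiagonal n, (b x.1 - b n) * coeff x.2 A|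
      ≤ 2 * M * (decayWeight s n * E) := by
    refine (Finset.abs_sum_le_sum_abs _ _).trans ((Finset.sum_le_sum hterm).trans ?_)
    rw [← Finset.mul_sum, Finset.sum_add_distrib, sum_antidiagonal_snd_eq_fst,
      Finset.Nat.sum_antidiagonal_eq_sum_range_succ_mk]
    exact le_of_eq (by ring)
  have hsplit : ∑' j, coeff j A = ∑ x ∈ antidiagonal n, coeff x.2 A
      + ∑' j, coeff (j + (n + 1)) A := by
    rw [sum_antidiagonal_snd_eq_fst fun i => coeff i A,
      Finset.Nat.sum_antidiagonal_eq_sum_range_succ_mk]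
    exact (hA.summable_coeff.sum_add_tsum_nat_add (n + 1)).symm
  have htail : |∑' j, coeff (j + (n + 1)) A| ≤ D * (decayWeight (s - 1) n / (s - 1)) := by
    have h1 : Summable fun j => |coeff (j + (n + 1)) A| :=
      (summable_nat_add_iff (f := fun j => |coeff j A|) (n + 1)).2 hA.summable
    have h2 : |∑' j, coeff (j + (n + 1)) A| ≤ ∑' j, |coeff (j + (n + 1)) A| :=
      norm_tsum_le_tsum_norm (f := fun j => coeff (j + (n + 1)) A) h1
    refine h2.trans (h1.tsum_le_of_sum_range_le fun N => ?_)
    refine (Finset.sum_le_sum fun j _ => hD (j + (n + 1))).trans ?_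
    rw [← Finset.mul_sum]
    exact mul_le_mul_of_nonneg_left (sum_decayWeight_tail_le hs n N) hD0
  -- This absorbs the part of the infinite sum beyond `n` into the same error term.
  have hEn : ((n : ℝ) + 1) * decayWeight (s - 1) n ≤ E := by
    have := Finset.card_nsmul_le_sum (Finset.range (n + 1)) (decayWeight (s - 1))
      (decayWeight (s - 1) n) fun j hj =>
        antitone_decayWeight hs1 (Nat.lt_succ_iff.1 (Finset.mem_range.1 hj))
    simpa using this
  have htail' : |b n * ∑' j, coeff (j + (n + 1)) A| ≤ C * D / (s - 1) * (decayWeight s n * E) := by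
    rw [abs_mul]
    have h0 : 0 < s - 1 := by linarith
    calc _ ≤ (C * decayWeight (s - 1) n) * (D * (decayWeight (s - 1) n / (s - 1))) :=
          mul_le_mul (hb' n) htail (abs_nonneg _)
            (mul_nonneg hC0 (decayWeight_nonneg _ _))
      _ = C * D / (s - 1) * (decayWeight s n * (((n : ℝ) + 1) * decayWeight (s - 1) n)) := by
          rw [← mul_decayWeight s]
          ring
      _ ≤ _ := by gcongr
  have hfin : ∑ x ∈ antidiagonal n, b x.1 * coeff x.2 A - b n * ∑' j, coeff j A
      = ∑ x ∈ antidiagonal n, (b x.1 - b n) * coeff x.2 A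
        - b n * ∑' j, coeff (j + (n + 1)) A := by
    rw [hsplit, mul_add, Finset.mul_sum]
    simp only [sub_mul, Finset.sum_sub_distrib]
    ring
  rw [hfin, add_mul]
  exact (abs_sub _ _).trans (add_le_add hmain htail')

end Decay

/-! ### Transient dimensions -/

section Transient

open PowerSeries

variable {d : ℕ}

/-- By convexity the differences decrease, so the one at `n` is at most their average over `[n / 2,
n]`; that sum telescopes and is at most `u_(n / 2)`. -/
theorem coeff_sub_evenReturnSeries_le (hd : 1 ≤ d) : ∃ C : ℝ, 0 < C ∧ ∀ n : ℕ,
    coeff n (evenReturnSeries d) - coeff (n + 1) (evenReturnSeries d)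
      ≤ C * decayWeight ((d : ℝ) / 2 + 1) n := by
  obtain ⟨C, hC0, hC⟩ := coeff_evenReturnSeries_le hd
  set a : ℕ → ℝ := fun n => coeff n (evenReturnSeries d) with ha
  have hanti := antitone_coeff_sub_evenReturnSeries d
  have hs : (0 : ℝ) ≤ (d : ℝ) / 2 := by positivity
  refine ⟨2 * C * 2 ^ ((d : ℝ) / 2), by positivity, fun n => ?_⟩
  have h1 : ∑ i ∈ Finset.Ico (n / 2) (n + 1), (a i - a (i + 1)) = a (n / 2) - a (n + 1) := by
    have := Finset.sum_Ico_sub a (show n / 2 ≤ n + 1 by omega)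
    rw [← neg_inj, ← Finset.sum_neg_distrib, neg_sub]
    simpa only [neg_sub] using this
  have h2 := Finset.card_nsmul_le_sum (Finset.Ico (n / 2) (n + 1)) (fun i => a i - a (i + 1))
    (a n - a (n + 1)) fun i hi => hanti (Nat.lt_succ_iff.1 (Finset.mem_Ico.1 hi).2)
  rw [h1, Nat.card_Ico, nsmul_eq_mul] at h2
  have h3 : ((n : ℝ) + 1) / 2 ≤ ((n + 1 - n / 2 : ℕ) : ℝ) := by
    have : n + 1 ≤ 2 * (n + 1 - n / 2) := by omega
    have h : ((n + 1 : ℕ) : ℝ) ≤ 2 * ((n + 1 - n / 2 : ℕ) : ℝ) := by exact_mod_cast this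
    push_cast at h
    linarith
  have h4 : 0 ≤ a (n + 1) := coeff_evenReturnSeries_nonneg d _
  have h5 : 0 ≤ a n - a (n + 1) := sub_nonneg.2 (antitone_coeff_evenReturnSeries d (Nat.le_succ n))
  have hC' : a (n + 1) ≤ a n ∧ a (n / 2) ≤ C * decayWeight ((d : ℝ) / 2) (n / 2) :=
    ⟨by linarith, hC (n / 2)⟩
  have hdiff : ((n : ℝ) + 1) / 2 * (a n - a (n + 1)) ≤ C * decayWeight ((d : ℝ) / 2) (n / 2) := by
    calc _ ≤ ((n + 1 - n / 2 : ℕ) : ℝ) * (a n - a (n + 1)) := by gcongr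
      _ ≤ _ := by linarith [hC'.2]
  have h6 := decayWeight_le_of_le_two_mul hs (show n ≤ 2 * (n / 2) + 1 by omega)
  have h8 := mul_decayWeight ((d : ℝ) / 2 + 1) n
  rw [add_sub_cancel_right] at h8
  have hn : (0 : ℝ) < (n : ℝ) + 1 := by positivity
  refine le_of_mul_le_mul_left ?_ (by positivity : (0 : ℝ) < ((n : ℝ) + 1) / 2)
  calc _ ≤ _ := hdiff
    _ ≤ C * (2 ^ ((d : ℝ) / 2) * decayWeight ((d : ℝ) / 2) n) := by gcongr
    _ = _ := by
      rw [← h8]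
      ring

/-- These are the two hypotheses of `exists_convolution_bound` for `b n = n * u_n` with exponent `d
/ 2`. -/
theorem exists_mul_coeff_bounds (hd : 1 ≤ d) : ∃ C : ℝ,
    (∀ n : ℕ, |((n + 1 : ℕ) : ℝ) * coeff (n + 1) (evenReturnSeries d)
      - n * coeff n (evenReturnSeries d)| ≤ C * decayWeight ((d : ℝ) / 2) n) ∧
    ∀ n : ℕ, |(n : ℝ) * coeff n (evenReturnSeries d)| ≤ C * decayWeight ((d : ℝ) / 2 - 1) n := by
  obtain ⟨C, hC0, hC⟩ := coeff_evenReturnSeries_le hd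
  obtain ⟨D, hD0, hD⟩ := coeff_sub_evenReturnSeries_le hd
  refine ⟨C + D, fun n => ?_, fun n => ?_⟩
  · have h1 := hC n
    have h2 := hD n
    have h3 := antitone_coeff_evenReturnSeries d (Nat.le_succ n)
    have h4 := coeff_evenReturnSeries_nonneg d (n + 1)
    have hn := Nat.cast_nonneg (α := ℝ) n
    have h5 := mul_decayWeight ((d : ℝ) / 2 + 1) n
    rw [add_sub_cancel_right] at h5
    have h6 : (n : ℝ) * (coeff n (evenReturnSeries d) - coeff (n + 1) (evenReturnSeries d))
        ≤ D * decayWeight ((d : ℝ) / 2) n := by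
      rw [← h5]
      have := mul_le_mul_of_nonneg_left h2 hn
      have h7 := mul_nonneg hD0.le (decayWeight_nonneg ((d : ℝ) / 2 + 1) n)
      linarith
    have h8 : 0 ≤ (n : ℝ) * (coeff n (evenReturnSeries d) - coeff (n + 1) (evenReturnSeries d)) :=
      mul_nonneg hn (sub_nonneg.2 h3)
    have h9 : coeff n (evenReturnSeries d) ≤ C * decayWeight ((d : ℝ) / 2) n := h1
    simp only [Nat.succ_eq_add_one] at h3
    have h10 : ((n + 1 : ℕ) : ℝ) * coeff (n + 1) (evenReturnSeries d)
        - n * coeff n (evenReturnSeries d) = coeff (n + 1) (evenReturnSeries d)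
        - n * (coeff n (evenReturnSeries d) - coeff (n + 1) (evenReturnSeries d)) := by
      push_cast
      ring
    rw [h10, add_mul, abs_le]
    have h11 := mul_nonneg hD0.le (decayWeight_nonneg ((d : ℝ) / 2) n)
    constructor <;> linarith
  · rw [abs_of_nonneg (mul_nonneg (Nat.cast_nonneg n) (coeff_evenReturnSeries_nonneg d n)),
      ← mul_decayWeight]
    have h1 : coeff n (evenReturnSeries d) ≤ C * decayWeight ((d : ℝ) / 2) n := hC n
    have h2 := decayWeight_nonneg ((d : ℝ) / 2) n
    calc (n : ℝ) * coeff n (evenReturnSeries d)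
        ≤ ((n : ℝ) + 1) * (C * decayWeight ((d : ℝ) / 2) n) := by
          gcongr
          · exact coeff_evenReturnSeries_nonneg d n
          · linarith
      _ ≤ ((n : ℝ) + 1) * ((C + D) * decayWeight ((d : ℝ) / 2) n) := by
          gcongr
          linarith
      _ = _ := by ring

theorem hasDecay_evenReturnSeries (hd : 2 < d) :
    HasDecay ((d : ℝ) / 2) (evenReturnSeries d) := by
  obtain ⟨C, -, hC⟩ := coeff_evenReturnSeries_le (show 1 ≤ d by omega)
  have hd' : (2 : ℝ) < d := by exact_mod_cast hd
  refine .of_bound (by linarith) (C := C) fun n => ?_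
  rw [abs_of_nonneg (coeff_evenReturnSeries_nonneg d n)]
  exact hC n

theorem hasDecay_evenFirstReturnSeries (hd : 2 < d) :
    HasDecay ((d : ℝ) / 2) (evenFirstReturnSeries d) := by
  obtain ⟨C, -, hC⟩ := coeff_evenReturnSeries_le (show 1 ≤ d by omega)
  have hd' : (2 : ℝ) < d := by exact_mod_cast hd
  refine .of_bound (by linarith) (C := C) fun n => ?_
  rw [abs_of_nonneg (coeff_evenFirstReturnSeries_nonneg d n)]
  exact (coeff_evenFirstReturnSeries_le d n).trans (hC n)

theorem hasSum_of_even {A : ℝ⟦X⟧} (hA : ∀ m, ¬ Even m → coeff m A = 0) {t : ℝ} :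
    HasSum (fun n => coeff n (evenPart A)) t ↔ HasSum (fun m => coeff m A) t := by
  have hinj : Function.Injective fun n : ℕ => 2 * n := fun a b hab => by simpa using hab
  rw [← hinj.hasSum_iff (f := fun m => coeff m A)]
  · simp only [coeff_evenPart, Function.comp_def]
  · intro m hm
    exact hA m fun ⟨r, hr⟩ => hm ⟨r, by simp only; omega⟩

theorem ofReal_besselI (μ : ℕ) (x : ℝ) : besselI μ (x : ℂ) = ((besselI μ x : ℝ) : ℂ) := by
  unfold besselI
  push_cast
  rfl

theorem walkIntegrand_inv (hd : 0 < d) (y : ℝ) :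
    walkIntegrand (0 : Fin d → ℤ) (1 / (2 * (d : ℂ))) y = (walkGIntegrand d y : ℂ) := by
  have hd0 : (d : ℂ) ≠ 0 := Nat.cast_ne_zero.2 hd.ne'
  have h : 2 * (1 / (2 * (d : ℂ))) * (y : ℂ) = ((y / d : ℝ) : ℂ) := by
    push_cast
    field_simp
  unfold walkIntegrand walkGIntegrand
  simp only [Pi.zero_apply, Int.natAbs_zero, h, ofReal_besselI, Finset.prod_const,
    Finset.card_univ, Fintype.card_fin]
  push_cast
  ring

/-- For `d > 2` the `u_n` are summable, so the identity between the integral and the series extends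
to the boundary point `1 / (2 * d)`. -/
theorem transient_green (hd : 2 < d) :
    IntegrableOn (walkGIntegrand d) (Set.Ioi 0) ∧
      walkH (0 : Fin d → ℤ) (1 / (2 * (d : ℂ))) = (walkG d : ℂ) ∧
      HasSum (fun n => coeff n (evenReturnSeries d)) (1 + walkG d) := by
  have hd1 : 1 ≤ d := by omega
  have hd0 : (2 * (d : ℂ)) ≠ 0 := by
    simp only [ne_eq, mul_eq_zero, OfNat.ofNat_ne_zero, false_or, Nat.cast_eq_zero]
    omega
  have hodd : ∀ m, ¬ Even m → coeff m (returnSeries d) = 0 :=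
    fun m hm => coeff_returnSeries_of_odd d hm
  obtain ⟨t, ht⟩ := (hasDecay_evenReturnSeries hd).summable_coeff
  have ht' : HasSum (fun m => coeff m (returnSeries d)) t := (hasSum_of_even hodd).1 ht
  have hc : ∀ m : ℕ, ((closedStepSeqs d m).card : ℂ) * (1 / (2 * (d : ℂ))) ^ m
      = ((coeff m (returnSeries d) : ℝ) : ℂ) := by
    intro m
    rw [← coeff_returnSeries_mul_pow hd1, mul_one_div, div_self hd0, one_pow, mul_one]
  have hs : Summable fun m : ℕ => ((closedStepSeqs d m).card : ℝ) * ‖(1 / (2 * (d : ℂ)))‖ ^ m := by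
    refine ht'.summable.congr fun m => ?_
    have := congrArg norm (hc m)
    rw [norm_mul, norm_pow, Complex.norm_natCast, Complex.norm_real,
      Real.norm_of_nonneg (coeff_returnSeries_nonneg d m)] at this
    exact this.symm
  obtain ⟨h1, h2⟩ := integrableOn_walkIntegrand_and_hasSum hs
  have h3 : walkH (0 : Fin d → ℤ) (1 / (2 * (d : ℂ))) = (walkG d : ℂ) := by
    unfold walkH walkG
    simp only [walkIntegrand_inv (show 0 < d by omega), if_true]
    rw [integral_complex_ofReal]
    push_cast
    rfl
  refine ⟨?_, h3, ?_⟩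
  · have h4 : (walkIntegrand (0 : Fin d → ℤ) (1 / (2 * (d : ℂ))))
        = fun y => (walkGIntegrand d y : ℂ) := funext (walkIntegrand_inv (by omega))
    rw [h4] at h1
    exact h1.re
  · rw [h3] at h2
    have h5 : t = 1 + walkG d := by
      have h6 : HasSum (fun m => ((coeff m (returnSeries d) : ℝ) : ℂ)) (t : ℂ) :=
        Complex.hasSum_ofReal.2 ht'
      have h7 := h6.unique (h2.of_forall_eq (fun m => (hc m).symm) rfl)
      exact_mod_cast h7
    rw [← h5]
    exact ht

theorem coeff_evenReturnSeries_pos (hd : 1 ≤ d) (n : ℕ) : 0 < coeff n (evenReturnSeries d) := by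
  obtain ⟨c, hc0, hc⟩ := le_coeff_evenReturnSeries hd
  exact (mul_pos hc0 (decayWeight_pos ((d : ℝ) / 2) n)).trans_le (hc n)

theorem walkG_pos (hd : 2 < d) : 0 < walkG d := by
  have h := (transient_green hd).2.2
  have h1 := sum_le_hasSum {0, 1} (fun n _ => coeff_evenReturnSeries_nonneg d n) h
  rw [Finset.sum_pair zero_ne_one, coeff_zero_evenReturnSeries] at h1
  linarith [coeff_evenReturnSeries_pos (show 1 ≤ d by omega) 1]

/-- The renewal identity evaluated at `1`: the return probability `V(1)` satisfies `(1 + G) * (1 -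
V(1)) = 1`. -/
theorem tsum_evenFirstReturnSeries (hd : 2 < d) :
    ∑' n, coeff n (evenFirstReturnSeries d) = walkG d / (1 + walkG d) := by
  have hV := hasDecay_evenFirstReturnSeries hd
  have h := tsum_coeff_mul (hasDecay_evenReturnSeries hd).summable
    ((HasDecay.one _).sub hV).summable
  rw [evenReturnSeries_renewal, tsum_coeff_one, hV.tsum_one_sub,
    (transient_green hd).2.2.tsum_eq] at h
  have hG := walkG_pos hd
  field_simp
  linarith

theorem tendsto_noReturnProb (hd : 2 < d) :
    Tendsto (noReturnProb d) atTop (𝓝 (1 / (1 + walkG d))) := by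
  have hV := (hasDecay_evenFirstReturnSeries hd).summable_coeff.hasSum
  rw [tsum_evenFirstReturnSeries hd] at hV
  have hQ : HasSum (fun m => coeff m (firstReturnSeries d)) (walkG d / (1 + walkG d)) :=
    (hasSum_of_even (coeff_firstReturnSeries_of_odd d)).1 hV
  have h1 := (hQ.tendsto_sum_nat.comp (tendsto_add_atTop_nat 1)).const_sub 1
  have hG := walkG_pos hd
  have h2 : 1 - walkG d / (1 + walkG d) = 1 / (1 + walkG d) := by
    field_simp
    ring
  rw [h2] at h1
  exact h1.congr fun m => (noReturnProb_eq (by omega) m).symm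

/-- The sum of `j ^ (1 - d / 2)` grows like `√n` for `d = 3`, is harmonic for `d = 4`, and converges
for `d ≥ 5`. -/
theorem sum_decayWeight_isBigO (hd : 2 < d) :
    (fun n : ℕ => ∑ j ∈ Finset.range (n + 1), decayWeight ((d : ℝ) / 2 - 1) j)
      =O[atTop] transientError d := by
  rcases eq_or_ne d 4 with rfl | h4
  · have h1 : ∀ n : ℕ, ∑ j ∈ Finset.range (n + 1), decayWeight (((4 : ℕ) : ℝ) / 2 - 1) j
        = (harmonic (n + 1) : ℝ) := by
      intro n
      simp only [harmonic, decayWeight]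
      push_cast
      refine Finset.sum_congr rfl fun j _ => ?_
      norm_num
      rw [Real.rpow_neg_one]
    simp only [h1]
    refine IsBigO.of_bound 3 ?_
    filter_upwards [eventually_ge_atTop 3] with n hn
    have hn' : (3 : ℝ) ≤ n := by exact_mod_cast hn
    have hlog : 1 ≤ Real.log n := by
      rw [Real.le_log_iff_exp_le (by linarith)]
      linarith [Real.exp_one_lt_d9]
    have h2 := harmonic_le_one_add_log (n + 1)
    have h3 : Real.log ((n + 1 : ℕ) : ℝ) ≤ Real.log n + 1 := by
      have h5 : ((n + 1 : ℕ) : ℝ) ≤ n * Real.exp 1 := by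
        push_cast
        nlinarith [Real.add_one_le_exp (1 : ℝ)]
      refine (Real.log_le_log (by positivity) h5).trans ?_
      rw [Real.log_mul (by linarith) (Real.exp_pos 1).ne', Real.log_exp]
    have h6 : (0 : ℝ) ≤ (harmonic (n + 1) : ℝ) := by
      rw [← h1]
      exact Finset.sum_nonneg fun j _ => decayWeight_nonneg _ _
    rw [Real.norm_of_nonneg h6, transientError, if_pos rfl, Real.norm_of_nonneg (by linarith)]
    linarith
  rcases Nat.lt_or_ge d 4 with h | h
  · obtain rfl : d = 3 := by omega
    refine IsBigO.of_bound 4 ?_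
    filter_upwards [eventually_ge_atTop 1] with n hn
    have hn' : (1 : ℝ) ≤ n := by exact_mod_cast hn
    have h1 : ∀ N : ℕ, ∑ j ∈ Finset.range N, decayWeight (((3 : ℕ) : ℝ) / 2 - 1) j ≤ 2 * √N := by
      intro N
      induction N with
      | zero => simp
      | succ N ih =>
        rw [Finset.sum_range_succ]
        have h2 : decayWeight (((3 : ℕ) : ℝ) / 2 - 1) N = 1 / √((N : ℝ) + 1) := by
          unfold decayWeight
          rw [Real.rpow_neg (by positivity), Real.sqrt_eq_rpow, one_div]
          norm_num
        have h3 : 0 < √((N : ℝ) + 1) := by positivity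
        have h5 : √(N : ℝ) ^ 2 = N := Real.sq_sqrt (by positivity)
        have h6 : √((N : ℝ) + 1) ^ 2 = N + 1 := Real.sq_sqrt (by positivity)
        have h7 : 1 / √((N : ℝ) + 1) ≤ 2 * √((N : ℝ) + 1) - 2 * √(N : ℝ) := by
          rw [div_le_iff₀ h3]
          nlinarith [sq_nonneg (√((N : ℝ) + 1) - √(N : ℝ))]
        rw [h2]
        push_cast
        linarith
    rw [Real.norm_of_nonneg (Finset.sum_nonneg fun j _ => decayWeight_nonneg _ _), transientError,
      if_neg (by norm_num)]
    have h2 : √((n + 1 : ℕ) : ℝ) ≤ 2 * √(n : ℝ) := by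
      rw [← Real.sqrt_sq zero_le_two, ← Real.sqrt_mul (by positivity)]
      refine Real.sqrt_le_sqrt ?_
      push_cast
      linarith
    have h3 : √(n : ℝ) ≤ max 1 ((n : ℝ) ^ (2 - ((3 : ℕ) : ℝ) / 2)) := by
      refine le_trans (le_of_eq ?_) (le_max_right _ _)
      rw [Real.sqrt_eq_rpow]
      norm_num
    rw [Real.norm_of_nonneg (zero_le_one.trans (le_max_left _ _))]
    linarith [h1 (n + 1)]
  · have hd5 : (5 : ℝ) ≤ d := by exact_mod_cast (by omega : 5 ≤ d)
    have hsum := summable_decayWeight (show 1 < (d : ℝ) / 2 - 1 by linarith)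
    refine IsBigO.of_bound (∑' j, decayWeight ((d : ℝ) / 2 - 1) j) (Eventually.of_forall fun n => ?_)
    rw [Real.norm_of_nonneg (Finset.sum_nonneg fun j _ => decayWeight_nonneg _ _), transientError,
      if_neg h4, Real.norm_of_nonneg (zero_le_one.trans (le_max_left _ _))]
    refine (hsum.sum_le_tsum _ fun j _ => decayWeight_nonneg _ _).trans ?_
    exact le_mul_of_one_le_right (tsum_nonneg fun j => decayWeight_nonneg _ _) (le_max_left _ _)

theorem coeff_X_mul_derivative_mul (A B : ℝ⟦X⟧) (n : ℕ) :
    coeff n (X * derivative ℝ A * B)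
      = ∑ x ∈ antidiagonal n, ((x.1 : ℝ) * coeff x.1 A) * coeff x.2 B := by
  rw [coeff_mul]
  simp only [coeff_X_mul_derivative]

/-- Dividing the convolution error by `u_n`, which is at least a constant times `n ^ (-d / 2)`,
cancels the weight and leaves the sum of `sum_decayWeight_isBigO`. -/
theorem transient_isBigO (hd : 2 < d) {B : ℝ⟦X⟧} (hB : HasDecay ((d : ℝ) / 2) B) :
    (fun n : ℕ => 2 * coeff n (X * derivative ℝ (evenReturnSeries d) * B)
        / coeff n (evenReturnSeries d) - 2 * (n : ℝ) * ∑' j, coeff j B)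
      =O[atTop] transientError d := by
  have hd1 : 1 ≤ d := by omega
  have hd' : (2 : ℝ) < d := by exact_mod_cast hd
  obtain ⟨C, hC1, hC2⟩ := exists_mul_coeff_bounds hd1
  obtain ⟨K, hK⟩ := exists_convolution_bound (by linarith)
    (b := fun n => (n : ℝ) * coeff n (evenReturnSeries d)) hC1 hC2 hB
  obtain ⟨c, hc0, hc⟩ := le_coeff_evenReturnSeries hd1
  refine IsBigO.trans (IsBigO.of_bound (2 * |K| / c) (Eventually.of_forall fun n => ?_))
    (sum_decayWeight_isBigO hd)
  set E := ∑ j ∈ Finset.range (n + 1), decayWeight ((d : ℝ) / 2 - 1) j with hE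
  have hE0 : 0 ≤ E := Finset.sum_nonneg fun j _ => decayWeight_nonneg _ _
  have hpos := coeff_evenReturnSeries_pos hd1 n
  have hw := decayWeight_pos ((d : ℝ) / 2) n
  have hcn : c * decayWeight ((d : ℝ) / 2) n ≤ coeff n (evenReturnSeries d) := hc n
  have h1 := hK n
  rw [← coeff_X_mul_derivative_mul] at h1
  have h2 : 2 * coeff n (X * derivative ℝ (evenReturnSeries d) * B)
        / coeff n (evenReturnSeries d) - 2 * (n : ℝ) * ∑' j, coeff j B
      = 2 * (coeff n (X * derivative ℝ (evenReturnSeries d) * B)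
        - (n : ℝ) * coeff n (evenReturnSeries d) * ∑' j, coeff j B)
        / coeff n (evenReturnSeries d) := by
    field_simp
  rw [h2, Real.norm_eq_abs, Real.norm_of_nonneg hE0, abs_div, abs_mul, abs_two, abs_of_pos hpos,
    div_le_iff₀ hpos]
  have h3 : K * (decayWeight ((d : ℝ) / 2) n * E) ≤ |K| * (decayWeight ((d : ℝ) / 2) n * E) := by
    gcongr
    exact le_abs_self K
  calc _ ≤ 2 * (|K| * (decayWeight ((d : ℝ) / 2) n * E)) := by linarith
    _ = 2 * |K| / c * E * (c * decayWeight ((d : ℝ) / 2) n) := by field_simp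
    _ ≤ _ := by gcongr

theorem transient_multRange (hd : 2 < d) {k : ℕ} (hk : 1 ≤ k) :
    (fun n : ℕ => closedWalkMean d n (LatticeWalk.multRange k)
      - 2 * (n : ℝ) * (walkG d ^ (k - 1) / (1 + walkG d) ^ (k + 1))) =O[atTop] transientError d := by
  have hs : (0 : ℝ) ≤ (d : ℝ) / 2 := by positivity
  have hV := hasDecay_evenFirstReturnSeries hd
  have h1V := (HasDecay.one ((d : ℝ) / 2)).sub hV
  have hG := walkG_pos hd
  have h := transient_isBigO hd ((h1V.pow hs 2).mul hs (hV.pow hs (k - 1)))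
  rw [tsum_coeff_mul (h1V.pow hs 2).summable (hV.pow hs (k - 1)).summable,
    tsum_coeff_pow h1V hs, tsum_coeff_pow hV hs, hV.tsum_one_sub,
    tsum_evenFirstReturnSeries hd] at h
  have h2 : (1 - walkG d / (1 + walkG d)) ^ 2 * (walkG d / (1 + walkG d)) ^ (k - 1)
      = walkG d ^ (k - 1) / (1 + walkG d) ^ (k + 1) := by
    rw [show 1 - walkG d / (1 + walkG d) = 1 / (1 + walkG d) by field_simp; ring, div_pow, div_pow,
      one_pow, div_mul_div_comm, one_mul, ← pow_add, show 2 + (k - 1) = k + 1 by omega]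
  rw [h2] at h
  refine h.congr' ?_ EventuallyEq.rfl
  filter_upwards [eventually_gt_atTop 0] with n hn
  rw [closedWalkMean_multRange (by omega) hn hk]

theorem transient_range (hd : 2 < d) :
    (fun n : ℕ => closedWalkMean d n LatticeWalk.range - 2 * (n : ℝ) * (1 / (1 + walkG d)))
      =O[atTop] transientError d := by
  have hV := hasDecay_evenFirstReturnSeries hd
  have hG := walkG_pos hd
  have h := transient_isBigO hd ((HasDecay.one ((d : ℝ) / 2)).sub hV)
  rw [hV.tsum_one_sub, tsum_evenFirstReturnSeries hd,
    show 1 - walkG d / (1 + walkG d) = 1 / (1 + walkG d) by field_simp; ring] at h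
  refine h.congr' ?_ EventuallyEq.rfl
  filter_upwards [eventually_gt_atTop 0] with n hn
  rw [closedWalkMean_range (by omega) hn]

end Transient

/-! ### Dimension one -/

section DimensionOne

open PowerSeries

theorem wallis_eq_inv (n : ℕ) :
    Real.Wallis.W n * ((2 * n + 1) * coeff n (evenReturnSeries 1) ^ 2) = 1 := by
  have hn : (n ! : ℝ) ≠ 0 := by exact_mod_cast n.factorial_ne_zero
  have h2n : ((2 * n)! : ℝ) ≠ 0 := by exact_mod_cast (2 * n).factorial_ne_zero
  have h0 : (2 * (n : ℝ) + 1) ≠ 0 := by positivity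
  have h : (n.centralBinom : ℝ) * ((n ! : ℝ) * (n ! : ℝ)) = ((2 * n)! : ℝ) := by
    have := Nat.add_choose_mul_factorial_mul_factorial n n
    rw [← two_mul] at this
    rw [← this, Nat.centralBinom]
    push_cast
    ring
  have h4 : (2 : ℝ) ^ (4 * n) = (4 ^ n) ^ 2 := by
    rw [← pow_mul, mul_comm n 2, pow_mul, pow_mul]
    norm_num
  rw [Real.Wallis.W_eq_factorial_ratio, coeff_evenReturnSeries_one, h4, ← h]
  have hc : (n.centralBinom : ℝ) ≠ 0 := by exact_mod_cast n.centralBinom_ne_zero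
  field_simp

/-- Wallis' partial product is exactly `1 / ((2 * n + 1) * u_n ^ 2)`, and it lies between `(2 * n +
1) / (2 * n + 2) * π / 2` and `π / 2`. -/
theorem pi_mul_coeff_sq_bounds (n : ℕ) :
    Real.pi * n * coeff n (evenReturnSeries 1) ^ 2 ≤ 1 ∧
      1 ≤ Real.pi * (n + 1 / 2) * coeff n (evenReturnSeries 1) ^ 2 := by
  have h := wallis_eq_inv n
  have h1 := Real.Wallis.W_le n
  have h2 := Real.Wallis.le_W n
  have hq : 0 < coeff n (evenReturnSeries 1) ^ 2 := pow_pos (coeff_evenReturnSeries_pos le_rfl n) 2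
  set q := coeff n (evenReturnSeries 1) ^ 2 with hq'
  have hn := Nat.cast_nonneg (α := ℝ) n
  have hpi := Real.pi_pos
  constructor
  · rw [← h]
    have h3 : Real.pi * n ≤ (2 * n + 1) / (2 * n + 2) * (Real.pi / 2) * (2 * n + 1) := by
      have h4 : (2 * (n : ℝ) + 1) / (2 * n + 2) * (Real.pi / 2) * (2 * n + 1)
          = Real.pi * ((2 * n + 1) ^ 2 / (4 * (n + 1))) := by
        field_simp
        ring
      rw [h4]
      refine mul_le_mul_of_nonneg_left ?_ hpi.le
      rw [le_div_iff₀ (by positivity)]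
      nlinarith
    calc Real.pi * n * q ≤ (2 * n + 1) / (2 * n + 2) * (Real.pi / 2) * (2 * n + 1) * q := by gcongr
      _ ≤ Real.Wallis.W n * (2 * n + 1) * q := by gcongr
      _ = _ := by ring
  · calc (1 : ℝ) = Real.Wallis.W n * ((2 * n + 1) * q) := h.symm
      _ ≤ Real.pi / 2 * ((2 * n + 1) * q) := by gcongr
      _ = _ := by ring

theorem evenReturnSeries_one_sq : evenReturnSeries 1 ^ 2 = PowerSeries.mk 1 := by
  have h1 := PowerSeries.mk_one_mul_one_sub_eq_one ℝ
  have h2 := one_sub_X_mul_evenReturnSeries_one_sq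
  linear_combination (PowerSeries.mk 1) * h2 - evenReturnSeries 1 ^ 2 * h1

theorem one_sub_evenFirstReturnSeries_one :
    1 - evenFirstReturnSeries 1 = (1 - X) * evenReturnSeries 1 := by
  linear_combination (1 - X) * evenReturnSeries 1 * evenReturnSeries_renewal 1
    - (1 - evenFirstReturnSeries 1) * one_sub_X_mul_evenReturnSeries_one_sq

theorem two_mul_one_sub_X_mul_derivative :
    2 * ((1 - X) * derivative ℝ (evenReturnSeries 1)) = evenReturnSeries 1 := by
  ext n
  have h2 : (2 : ℝ⟦X⟧) = C (2 : ℝ) := (map_ofNat C 2).symm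
  rw [h2, coeff_C_mul, sub_mul, one_mul, map_sub, coeff_X_mul_derivative, coeff_derivative,
    mul_comm (coeff (n + 1) _), coeff_succ_evenReturnSeries_one]
  ring

/-- Here `1 - V = (1 - X) * U` and `2 * (1 - X) * U' = U`, so the numerator is `X * U ^ 2 = X / (1 -
X)`, with all positive-index coefficients equal to `1`. -/
theorem closedWalkMean_range_one {n : ℕ} (hn : 0 < n) :
    closedWalkMean 1 n LatticeWalk.range = 1 / coeff n (evenReturnSeries 1) := by
  rw [closedWalkMean_range le_rfl hn]
  congr 1
  obtain ⟨m, rfl⟩ : ∃ m, n = m + 1 := ⟨n - 1, by omega⟩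
  have h : C (2 : ℝ) * (X * derivative ℝ (evenReturnSeries 1) * (1 - evenFirstReturnSeries 1))
      = X * PowerSeries.mk 1 := by
    rw [one_sub_evenFirstReturnSeries_one, ← evenReturnSeries_one_sq, map_ofNat C 2]
    linear_combination X * evenReturnSeries 1 * two_mul_one_sub_X_mul_derivative
  have h2 := congrArg (coeff (m + 1)) h
  rw [coeff_C_mul, coeff_succ_X_mul, coeff_mk] at h2
  exact h2

theorem mul_pow_of_renewal {U V : ℝ⟦X⟧} (h : U * (1 - V) = 1) (k : ℕ) :
    U * V ^ k = U - ∑ i ∈ Finset.range k, V ^ i := by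
  have h2 : (∑ i ∈ Finset.range k, V ^ i) * (V - 1) = V ^ k - 1 := geom_sum_mul V k
  linear_combination (∑ i ∈ Finset.range k, V ^ i) * (-h) - U * h2

/-- The numerator collapses to `X * U * V ^ (k - 1)`, and `U` is the geometric series in `V`, so
only finitely many powers of `V` are subtracted from `U`. -/
theorem closedWalkMean_multRange_one {m k : ℕ} (hk : 1 ≤ k) :
    closedWalkMean 1 (m + 1) (LatticeWalk.multRange k)
      = (coeff m (evenReturnSeries 1)
          - coeff m (∑ i ∈ Finset.range (k - 1), evenFirstReturnSeries 1 ^ i))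
        / coeff (m + 1) (evenReturnSeries 1) := by
  rw [closedWalkMean_multRange le_rfl (Nat.succ_pos m) hk, ← map_sub,
    ← mul_pow_of_renewal (evenReturnSeries_renewal 1)]
  congr 1
  have h : C (2 : ℝ) * (X * derivative ℝ (evenReturnSeries 1) *
      ((1 - evenFirstReturnSeries 1) ^ 2 * evenFirstReturnSeries 1 ^ (k - 1)))
      = X * (evenReturnSeries 1 * evenFirstReturnSeries 1 ^ (k - 1)) := by
    rw [one_sub_evenFirstReturnSeries_one, map_ofNat C 2]
    linear_combination X * evenFirstReturnSeries 1 ^ (k - 1) * ((1 - X) * evenReturnSeries 1 ^ 2 *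
      two_mul_one_sub_X_mul_derivative
      + evenReturnSeries 1 * one_sub_X_mul_evenReturnSeries_one_sq)
  have h2 := congrArg (coeff (m + 1)) h
  rw [coeff_C_mul, coeff_succ_X_mul] at h2
  exact h2

/-- For `d = 1` a first return probability is a difference of consecutive `u_n`. -/
theorem hasDecay_evenFirstReturnSeries_one : HasDecay (3 / 2) (evenFirstReturnSeries 1) := by
  obtain ⟨C, hC0, hC⟩ := coeff_sub_evenReturnSeries_le (d := 1) le_rfl
  refine .of_bound (by norm_num) (C := C * 2 ^ (3 / 2 : ℝ)) fun n => ?_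
  rw [abs_of_nonneg (coeff_evenFirstReturnSeries_nonneg 1 n)]
  cases n with
  | zero =>
    rw [coeff_zero_eq_constantCoeff_apply, constantCoeff_evenFirstReturnSeries]
    have := decayWeight_nonneg (3 / 2) 0
    positivity
  | succ n =>
    have h : coeff (n + 1) (evenFirstReturnSeries 1)
        = coeff n (evenReturnSeries 1) - coeff (n + 1) (evenReturnSeries 1) := by
      have := congrArg (coeff (n + 1)) one_sub_evenFirstReturnSeries_one
      rw [sub_mul, one_mul, map_sub, map_sub, coeff_succ_X_mul, coeff_one,
        if_neg (Nat.succ_ne_zero n)] at this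
      linarith
    rw [h, mul_assoc]
    have h1 := hC n
    rw [show ((1 : ℕ) : ℝ) / 2 + 1 = 3 / 2 by norm_num] at h1
    refine h1.trans (mul_le_mul_of_nonneg_left ?_ hC0.le)
    exact decayWeight_le_of_le_two_mul (by norm_num) (by omega)

theorem HasDecay.sum_pow {s : ℝ} {A : ℝ⟦X⟧} (hs : 0 ≤ s) (hA : HasDecay s A) (k : ℕ) :
    HasDecay s (∑ i ∈ Finset.range k, A ^ i) := by
  induction k with
  | zero => simpa using (HasDecay.one s).sub (.one s)
  | succ k ih =>
    rw [Finset.sum_range_succ]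
    have h := ih.sub (((HasDecay.one s).sub (.one s)).sub (hA.pow hs k))
    convert h using 1
    ring

/-- The ratio of consecutive `u_n` is `1 + O(1 / n)`, and the powers of `V` have coefficients `O(n ^
(-3 / 2))` against `u_n` of order `n ^ (-1 / 2)`. -/
theorem multRange_one_isBigO {k : ℕ} (hk : 1 ≤ k) :
    (fun n : ℕ => closedWalkMean 1 n (LatticeWalk.multRange k) - 1)
      =O[atTop] fun n : ℕ => 1 / (n : ℝ) := by
  obtain ⟨D, hD⟩ := (hasDecay_evenFirstReturnSeries_one.sum_pow (by norm_num) (k - 1)).bound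
  obtain ⟨c, hc0, hc⟩ := le_coeff_evenReturnSeries (d := 1) le_rfl
  set R := ∑ i ∈ Finset.range (k - 1), evenFirstReturnSeries 1 ^ i with hR
  have hD0 : 0 ≤ D := nonneg_of_mul_nonneg_left ((abs_nonneg _).trans (hD 0)) (decayWeight_pos _ 0)
  refine IsBigO.of_bound (1 + D * 2 ^ (1 / 2 : ℝ) / c) ?_
  filter_upwards [eventually_gt_atTop 0] with n hn
  obtain ⟨m, rfl⟩ : ∃ m, n = m + 1 := ⟨n - 1, by omega⟩
  rw [closedWalkMean_multRange_one hk]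
  set a := coeff m (evenReturnSeries 1) with ha
  set a' := coeff (m + 1) (evenReturnSeries 1) with ha'
  have hrec : ((m : ℝ) + 1) * a' = (m + 1 / 2) * a := coeff_succ_evenReturnSeries_one m
  have ha0 : 0 < a' := coeff_evenReturnSeries_pos le_rfl _
  have hm := Nat.cast_nonneg (α := ℝ) m
  have h1 : |a / a' - 1| ≤ 1 / ((m : ℝ) + 1) := by
    have h2 : a / a' = (m + 1) / (m + 1 / 2) := by
      rw [div_eq_div_iff ha0.ne' (by positivity)]
      linarith
    have h3 : a / a' - 1 = 1 / (2 * m + 1) := by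
      rw [h2]
      field_simp
      ring
    rw [h3, abs_of_pos (by positivity)]
    exact one_div_le_one_div_of_le (by positivity) (by linarith)
  have h4 : |coeff m R / a'| ≤ D * 2 ^ (1 / 2 : ℝ) / c * (1 / ((m : ℝ) + 1)) := by
    rw [abs_div, abs_of_pos ha0, div_le_iff₀ ha0]
    have h5 : c * decayWeight (1 / 2) (m + 1) ≤ a' := by
      have := hc (m + 1)
      rwa [show ((1 : ℕ) : ℝ) / 2 = 1 / 2 by norm_num] at this
    have h6 : decayWeight (1 / 2) m ≤ 2 ^ (1 / 2 : ℝ) * decayWeight (1 / 2) (m + 1) :=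
      decayWeight_le_of_le_two_mul (by norm_num) (by omega)
    have h7 := mul_decayWeight (3 / 2) m
    rw [show (3 / 2 : ℝ) - 1 = 1 / 2 by norm_num] at h7
    have h8 : decayWeight (3 / 2) m = decayWeight (1 / 2) m / ((m : ℝ) + 1) := by
      rw [← h7]
      field_simp
    calc |coeff m R| ≤ D * decayWeight (3 / 2) m := hD m
      _ = D * (1 / ((m : ℝ) + 1)) * decayWeight (1 / 2) m := by rw [h8]; ring
      _ ≤ D * (1 / ((m : ℝ) + 1)) * (2 ^ (1 / 2 : ℝ) * decayWeight (1 / 2) (m + 1)) := by gcongr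
      _ = D * 2 ^ (1 / 2 : ℝ) / c * (1 / ((m : ℝ) + 1)) * (c * decayWeight (1 / 2) (m + 1)) := by
          field_simp
      _ ≤ _ := by gcongr
  have h9 : (a - coeff m R) / a' - 1 = (a / a' - 1) - coeff m R / a' := by ring
  rw [h9, Real.norm_eq_abs, Real.norm_of_nonneg (by positivity), add_mul, one_mul]
  push_cast
  exact (abs_sub _ _).trans (add_le_add h1 h4)

theorem range_one_isBigO :
    (fun n : ℕ => closedWalkMean 1 n LatticeWalk.range - √(Real.pi * n))
      =O[atTop] fun n : ℕ => √(Real.pi * n) * (1 / (n : ℝ)) := by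
  refine IsBigO.of_bound 1 ?_
  filter_upwards [eventually_gt_atTop 0] with n hn
  have hn' : (0 : ℝ) < n := by exact_mod_cast hn
  have hpi := Real.pi_pos
  rw [closedWalkMean_range_one hn]
  obtain ⟨h1, h2⟩ := pi_mul_coeff_sq_bounds n
  set a := coeff n (evenReturnSeries 1) with ha
  have ha0 : 0 < a := coeff_evenReturnSeries_pos le_rfl _
  have hlow : √(Real.pi * n) ≤ 1 / a := by
    refine Real.sqrt_le_iff.2 ⟨by positivity, ?_⟩
    rw [div_pow, one_pow, le_div_iff₀ (by positivity)]
    exact h1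
  have hup : 1 / a ≤ √(Real.pi * n) * (1 + 1 / n) := by
    refine le_of_sq_le_sq ?_ (by positivity)
    rw [div_pow, one_pow, mul_pow, Real.sq_sqrt (by positivity), div_le_iff₀ (by positivity)]
    refine h2.trans ?_
    refine mul_le_mul_of_nonneg_right ?_ (by positivity)
    have : Real.pi * n * (1 + 1 / n) ^ 2 = Real.pi * (n + 2 + 1 / n) := by
      field_simp
      ring
    rw [this]
    refine mul_le_mul_of_nonneg_left ?_ hpi.le
    have h3 : 0 < 1 / (n : ℝ) := by positivity
    linarith
  rw [Real.norm_of_nonneg (by linarith), Real.norm_of_nonneg (by positivity)]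
  linarith

end DimensionOne

/-! ### Logarithmic weights -/

section Logarithm

open PowerSeries

/-- The sequence `log (n + 8)`, which is at least `2`. -/
noncomputable def shiftedLog (n : ℕ) : ℝ := Real.log ((n : ℝ) + 8)

theorem monotone_shiftedLog : Monotone shiftedLog := by
  intro m n hmn
  have : (m : ℝ) ≤ n := by exact_mod_cast hmn
  exact Real.log_le_log (by positivity) (by linarith)

theorem two_le_shiftedLog (n : ℕ) : 2 ≤ shiftedLog n := by
  refine le_trans ?_ (monotone_shiftedLog (Nat.zero_le n))
  unfold shiftedLog
  rw [Nat.cast_zero, zero_add, show (8 : ℝ) = 2 ^ 3 by norm_num, Real.log_pow]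
  have := Real.log_two_gt_d9
  push_cast
  linarith

theorem shiftedLog_pos (n : ℕ) : 0 < shiftedLog n := two_pos.trans_le (two_le_shiftedLog n)

theorem shiftedLog_le_add_one {j n : ℕ} (h : n ≤ 2 * j + 1) : shiftedLog n ≤ shiftedLog j + 1 := by
  have h1 : (n : ℝ) ≤ 2 * j + 1 := by exact_mod_cast h
  have h2 : shiftedLog n ≤ Real.log (2 * ((j : ℝ) + 8)) :=
    Real.log_le_log (by positivity) (by linarith)
  rw [Real.log_mul two_ne_zero (by positivity)] at h2
  have := Real.log_two_lt_d9
  unfold shiftedLog at h2 ⊢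
  linarith

theorem shiftedLog_le_two_mul {j n : ℕ} (h : n ≤ 2 * j + 1) : shiftedLog n ≤ 2 * shiftedLog j := by
  linarith [shiftedLog_le_add_one h, two_le_shiftedLog j]

theorem inv_shiftedLog_le {j n : ℕ} (h : n ≤ 2 * j + 1) :
    (shiftedLog j)⁻¹ ≤ 2 * (shiftedLog n)⁻¹ := by
  have hj := shiftedLog_pos j
  have hn := shiftedLog_pos n
  rw [← div_eq_mul_inv, ← one_div, div_le_div_iff₀ hj hn]
  linarith [shiftedLog_le_two_mul h]

theorem inv_shiftedLog_le_one (n : ℕ) : (shiftedLog n)⁻¹ ≤ 1 :=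
  inv_le_one_of_one_le₀ (by linarith [two_le_shiftedLog n])

theorem shiftedLog_pow_four_le (n : ℕ) : shiftedLog n ^ 4 ≤ 2048 * ((n : ℝ) + 1) := by
  -- With `x = n + 8` this reads `log x ≤ 4 * x ^ (1 / 4)`; the fourth power gives `256 * x`, and `x
  -- ≤ 8 * (n + 1)`.
  have h := Real.log_le_rpow_div (x := (n : ℝ) + 8) (ε := 1 / 4) (by positivity) (by norm_num)
  have h2 := pow_le_pow_left₀ (shiftedLog_pos n).le h 4
  refine h2.trans ?_
  rw [div_pow, ← Real.rpow_natCast, ← Real.rpow_mul (by positivity)]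
  norm_num
  have := Nat.cast_nonneg (α := ℝ) n
  linarith

theorem shiftedLog_succ_sub_le (n : ℕ) :
    ((n : ℝ) + 1) * (shiftedLog (n + 1) - shiftedLog n) ≤ 1 := by
  have hn : (0 : ℝ) < (n : ℝ) + 8 := by positivity
  have h : shiftedLog (n + 1) - shiftedLog n ≤ 1 / ((n : ℝ) + 8) := by
    unfold shiftedLog
    rw [← Real.log_div (by positivity) hn.ne']
    refine (Real.log_le_sub_one_of_pos (by positivity)).trans (le_of_eq ?_)
    push_cast
    field_simp
    ring
  calc _ ≤ ((n : ℝ) + 1) * (1 / ((n : ℝ) + 8)) := by gcongr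
    _ ≤ 1 := by
      rw [mul_one_div, div_le_one hn]
      linarith

/-- The induction closes because `2 * (n + 1)` times the increment of the logarithm is at most `2`,
hence at most the logarithm itself; this is where the shift by `8` is used. -/
theorem sum_inv_shiftedLog_le (n : ℕ) :
    ∑ i ∈ Finset.range (n + 1), (shiftedLog i)⁻¹ ≤ 2 * ((n : ℝ) + 1) * (shiftedLog n)⁻¹ := by
  induction n with
  | zero =>
    have := inv_pos.2 (shiftedLog_pos 0)
    rw [zero_add, Finset.sum_range_one]
    push_cast
    linarith
  | succ n ih =>
    rw [Finset.sum_range_succ]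
    have hn := shiftedLog_pos n
    have hn1 := shiftedLog_pos (n + 1)
    have h1 := shiftedLog_succ_sub_le n
    have h2 := two_le_shiftedLog n
    have h3 : 2 * ((n : ℝ) + 1) * (shiftedLog n)⁻¹
        ≤ (2 * ((n : ℝ) + 1) + 1) * (shiftedLog (n + 1))⁻¹ := by
      rw [← div_eq_mul_inv, ← div_eq_mul_inv, div_le_div_iff₀ hn hn1]
      nlinarith
    push_cast
    linarith

theorem sum_inv_succ_le (n : ℕ) :
    ∑ i ∈ Finset.range (n + 1), ((i : ℝ) + 1)⁻¹ ≤ 2 * shiftedLog n := by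
  have h := harmonic_le_one_add_log (n + 1)
  unfold harmonic at h
  push_cast at h
  have h2 : Real.log ((n : ℝ) + 1) ≤ shiftedLog n :=
    Real.log_le_log (by positivity) (by linarith)
  linarith [two_le_shiftedLog n]

theorem shiftedLog_sub_le_sum_inv_succ (n : ℕ) :
    shiftedLog n - 3 ≤ ∑ i ∈ Finset.range (n + 1), ((i : ℝ) + 1)⁻¹ := by
  have h := log_add_one_le_harmonic (n + 1)
  unfold harmonic at h
  push_cast at h
  refine le_trans ?_ h
  have h2 : shiftedLog n ≤ Real.log (4 * ((n : ℝ) + 1 + 1)) := by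
    have := Nat.cast_nonneg (α := ℝ) n
    exact Real.log_le_log (by positivity) (by linarith)
  rw [Real.log_mul (by norm_num) (by positivity)] at h2
  have := Real.log_le_sub_one_of_pos (show (0 : ℝ) < 4 by norm_num)
  linarith

/-- The weight `1 / ((n + 1) log (n + 8) ^ 2)`. -/
noncomputable def logDecayWeight (n : ℕ) : ℝ := (((n : ℝ) + 1) * shiftedLog n ^ 2)⁻¹

theorem logDecayWeight_pos (n : ℕ) : 0 < logDecayWeight n := by
  have := shiftedLog_pos n
  unfold logDecayWeight
  positivity

theorem succ_mul_logDecayWeight (n : ℕ) :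
    ((n : ℝ) + 1) * logDecayWeight n = (shiftedLog n ^ 2)⁻¹ := by
  have := shiftedLog_pos n
  unfold logDecayWeight
  field_simp

theorem logDecayWeight_le {j n : ℕ} (h : n ≤ 2 * j + 1) :
    logDecayWeight j ≤ 8 * logDecayWeight n := by
  have hj := shiftedLog_pos j
  have hn := shiftedLog_pos n
  have h1 : (n : ℝ) ≤ 2 * j + 1 := by exact_mod_cast h
  have h2 := pow_le_pow_left₀ hn.le (shiftedLog_le_two_mul h) 2
  unfold logDecayWeight
  rw [← div_eq_mul_inv, ← one_div, div_le_div_iff₀ (by positivity) (by positivity), one_mul]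
  calc ((n : ℝ) + 1) * shiftedLog n ^ 2 ≤ (2 * j + 2) * (2 * shiftedLog j) ^ 2 :=
        mul_le_mul (by linarith) h2 (by positivity) (by positivity)
    _ = _ := by ring

/-- A convolution that splits into its two ends. -/
theorem sum_antidiagonal_le_of_log_bound {g : ℕ × ℕ → ℝ} {C : ℝ} (hC : 0 ≤ C) {n : ℕ}
    (hg : ∀ x ∈ antidiagonal n,
      g x ≤ C * logDecayWeight n * ((shiftedLog x.1)⁻¹ + (shiftedLog x.2)⁻¹)) :
    ∑ x ∈ antidiagonal n, g x ≤ 4 * C * (shiftedLog n)⁻¹ ^ 3 := by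
  refine (Finset.sum_le_sum hg).trans ?_
  rw [← Finset.mul_sum, Finset.sum_add_distrib,
    sum_antidiagonal_snd_eq_fst fun i => (shiftedLog i)⁻¹,
    Finset.Nat.sum_antidiagonal_eq_sum_range_succ_mk]
  have h := sum_inv_shiftedLog_le n
  have hw := (logDecayWeight_pos n).le
  calc _ ≤ C * logDecayWeight n * (2 * ((n : ℝ) + 1) * (shiftedLog n)⁻¹
        + 2 * ((n : ℝ) + 1) * (shiftedLog n)⁻¹) := by gcongr
    _ = 4 * C * (((n : ℝ) + 1) * logDecayWeight n) * (shiftedLog n)⁻¹ := by ring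
    _ = _ := by
      rw [succ_mul_logDecayWeight]
      ring

end Logarithm

/-! ### Dimension two: the probability of not returning -/

section PlanarTail

open PowerSeries

theorem planar_coeff_bounds (n : ℕ) :
    Real.pi * n * coeff n (evenReturnSeries 2) ≤ 1 ∧
      1 ≤ Real.pi * (n + 1 / 2) * coeff n (evenReturnSeries 2) := by
  rw [coeff_evenReturnSeries_two]
  exact pi_mul_coeff_sq_bounds n

theorem planar_coeff_le (n : ℕ) : coeff n (evenReturnSeries 2) ≤ ((n : ℝ) + 1)⁻¹ := by
  cases n with
  | zero => simp [coeff_zero_evenReturnSeries]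
  | succ n =>
    have h := (planar_coeff_bounds (n + 1)).1
    have hpos := coeff_evenReturnSeries_nonneg 2 (n + 1)
    have hpi := Real.two_le_pi
    have hn := Nat.cast_nonneg (α := ℝ) n
    rw [← one_div, le_div_iff₀ (by positivity)]
    push_cast at h ⊢
    refine le_trans ?_ h
    rw [mul_comm]
    gcongr
    nlinarith

theorem planar_mul_coeff_bound (n : ℕ) :
    |n * coeff n (evenReturnSeries 2) - 1 / Real.pi| ≤ ((n : ℝ) + 1)⁻¹ := by
  obtain ⟨h1, h2⟩ := planar_coeff_bounds n
  have hpi := Real.two_le_pi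
  have hpi0 := Real.pi_pos
  have h3 := planar_coeff_le n
  have hpos : 0 < ((n : ℝ) + 1)⁻¹ := by positivity
  set a := coeff n (evenReturnSeries 2)
  have h4 : n * a ≤ 1 / Real.pi := by
    rw [le_div_iff₀ hpi0]
    linarith
  have h5 : 1 / Real.pi ≤ (n + 1 / 2) * a := by
    rw [div_le_iff₀ hpi0]
    linarith
  rw [abs_sub_comm, abs_of_nonneg (by linarith)]
  linarith

theorem coeff_mk_one_mul (A : ℝ⟦X⟧) (n : ℕ) :
    coeff n (PowerSeries.mk 1 * A) = ∑ j ∈ Finset.range (n + 1), coeff j A := by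
  rw [mul_comm, coeff_mul, Finset.Nat.sum_antidiagonal_eq_sum_range_succ_mk]
  simp

/-- The generating series of the probability of not returning within `2 n` steps. -/
noncomputable def tailSeries (d : ℕ) : ℝ⟦X⟧ := PowerSeries.mk 1 * (1 - evenFirstReturnSeries d)

theorem coeff_tailSeries (d n : ℕ) : coeff n (tailSeries d)
    = 1 - ∑ j ∈ Finset.range (n + 1), coeff j (evenFirstReturnSeries d) := by
  rw [tailSeries, coeff_mk_one_mul]
  simp only [map_sub, Finset.sum_sub_distrib, coeff_one]
  simp

theorem evenReturnSeries_mul_tailSeries (d : ℕ) :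
    evenReturnSeries d * tailSeries d = PowerSeries.mk 1 := by
  unfold tailSeries
  linear_combination (PowerSeries.mk 1) * evenReturnSeries_renewal d

theorem antitone_coeff_tailSeries (d : ℕ) : Antitone fun n => coeff n (tailSeries d) := by
  refine antitone_nat_of_succ_le fun n => ?_
  rw [coeff_tailSeries, coeff_tailSeries, Finset.sum_range_succ _ (n + 1)]
  linarith [coeff_evenFirstReturnSeries_nonneg d (n + 1)]

theorem noReturnProb_nonneg (d m : ℕ) : 0 ≤ noReturnProb d m := by
  unfold noReturnProb
  positivity

/-- The coefficient is bounded below by an actual probability of not returning. -/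
theorem coeff_tailSeries_nonneg {d : ℕ} (hd : 1 ≤ d) (n : ℕ) : 0 ≤ coeff n (tailSeries d) := by
  have h := noReturnProb_nonneg d (2 * n)
  rw [noReturnProb_eq hd] at h
  rw [coeff_tailSeries]
  have h2 : ∑ j ∈ Finset.range (n + 1), coeff j (evenFirstReturnSeries d)
      ≤ ∑ j ∈ Finset.range (2 * n + 1), coeff j (firstReturnSeries d) := by
    have h3 : ∑ j ∈ Finset.range (n + 1), coeff j (evenFirstReturnSeries d)
        = ∑ j ∈ (Finset.range (n + 1)).image (2 * ·), coeff j (firstReturnSeries d) := by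
      rw [Finset.sum_image fun x _ y _ hxy => by simpa using hxy]
      exact Finset.sum_congr rfl fun j _ => coeff_evenPart _ j
    rw [h3]
    refine Finset.sum_le_sum_of_subset_of_nonneg ?_ fun j _ _ => coeff_firstReturnSeries_nonneg d j
    intro j hj
    simp only [Finset.mem_image, Finset.mem_range] at hj ⊢
    omega
  linarith

theorem coeff_tailSeries_le_one (d n : ℕ) : coeff n (tailSeries d) ≤ 1 := by
  rw [coeff_tailSeries]
  linarith [Finset.sum_nonneg fun j (_ : j ∈ Finset.range (n + 1)) =>
    coeff_evenFirstReturnSeries_nonneg d j]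

theorem planar_sum_coeff_bounds (n : ℕ) :
    shiftedLog n / Real.pi - 2 ≤ ∑ i ∈ Finset.range (n + 1), coeff i (evenReturnSeries 2) ∧
      ∑ i ∈ Finset.range (n + 1), coeff i (evenReturnSeries 2) ≤ shiftedLog n / Real.pi + 2 := by
  have hpi := Real.two_le_pi
  have hpi0 := Real.pi_pos
  constructor
  · have h1 : ∑ i ∈ Finset.range (n + 1), ((i : ℝ) + 1)⁻¹ / Real.pi
        ≤ ∑ i ∈ Finset.range (n + 1), coeff i (evenReturnSeries 2) := by
      refine Finset.sum_le_sum fun i _ => ?_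
      have h2 := (planar_coeff_bounds i).2
      have h3 := coeff_evenReturnSeries_nonneg 2 i
      rw [div_le_iff₀ hpi0, ← one_div, div_le_iff₀ (by positivity)]
      nlinarith
    rw [← Finset.sum_div] at h1
    refine le_trans ?_ h1
    rw [le_div_iff₀ hpi0, sub_mul, div_mul_cancel₀ _ hpi0.ne']
    linarith [shiftedLog_sub_le_sum_inv_succ n]
  · rw [Finset.sum_range_succ', coeff_zero_evenReturnSeries]
    have h1 : ∑ i ∈ Finset.range n, coeff (i + 1) (evenReturnSeries 2)
        ≤ ∑ i ∈ Finset.range n, ((i : ℝ) + 1)⁻¹ / Real.pi := by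
      refine Finset.sum_le_sum fun i _ => ?_
      have h2 := (planar_coeff_bounds (i + 1)).1
      rw [le_div_iff₀ hpi0, ← one_div, le_div_iff₀ (by positivity)]
      push_cast at h2
      linarith
    have h2 := harmonic_le_one_add_log n
    unfold harmonic at h2
    push_cast at h2
    have h3 : Real.log n ≤ shiftedLog n := by
      rcases Nat.eq_zero_or_pos n with rfl | hn
      · simpa using (shiftedLog_pos 0).le
      · exact Real.log_le_log (by exact_mod_cast hn) (by linarith)
    rw [← Finset.sum_div] at h1
    have h4 : (∑ i ∈ Finset.range n, ((i : ℝ) + 1)⁻¹) / Real.pi ≤ shiftedLog n / Real.pi + 1 := by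
      rw [div_le_iff₀ hpi0, add_mul, div_mul_cancel₀ _ hpi0.ne']
      linarith
    linarith

/-- Compare coefficients in `U * R = 1 / (1 - X)`: as `r` decreases, each `r_(n - i)` is at least
`r_n`. -/
theorem coeff_tailSeries_mul_sum_le (n : ℕ) :
    coeff n (tailSeries 2) * ∑ i ∈ Finset.range (n + 1), coeff i (evenReturnSeries 2) ≤ 1 := by
  have h := congrArg (coeff n) (evenReturnSeries_mul_tailSeries 2)
  rw [coeff_mul, coeff_mk, Pi.one_apply] at h
  rw [← h, Finset.mul_sum, ← Finset.Nat.sum_antidiagonal_eq_sum_range_succ_mk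
    (fun x => coeff n (tailSeries 2) * coeff x.1 (evenReturnSeries 2))]
  refine Finset.sum_le_sum fun x hx => ?_
  rw [mul_comm]
  refine mul_le_mul_of_nonneg_left ?_ (coeff_evenReturnSeries_nonneg 2 _)
  exact antitone_coeff_tailSeries 2 (by rw [← mem_antidiagonal.1 hx]; omega)

theorem coeff_tailSeries_le (n : ℕ) : coeff n (tailSeries 2) ≤ 3 * Real.pi * (shiftedLog n)⁻¹ := by
  have hpi0 := Real.pi_pos
  have h1 := coeff_tailSeries_mul_sum_le n
  have h2 := (planar_sum_coeff_bounds n).1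
  have h3 := coeff_tailSeries_le_one 2 n
  have h4 := coeff_tailSeries_nonneg (d := 2) (by norm_num) n
  have h5 := mul_le_mul_of_nonneg_left h2 h4
  have hl := shiftedLog_pos n
  rw [← div_eq_mul_inv, le_div_iff₀ hl]
  have h6 : coeff n (tailSeries 2) * (shiftedLog n / Real.pi) ≤ 3 := by linarith
  rw [← mul_div_assoc, div_le_iff₀ hpi0] at h6
  exact h6

/-- The same identity at index `2 * n`. For `i ≤ n` one has `r_(2 * n - i) ≤ r_n`; for `i > n` one
has `u_i ≤ 1 / (n + 1)`, and the sum of the `r_j` is `O(n / log n)` by the upper bound already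
known. -/
theorem one_le_coeff_tailSeries_mul (n : ℕ) :
    1 ≤ (∑ i ∈ Finset.range (n + 1), coeff i (evenReturnSeries 2)) * coeff n (tailSeries 2)
      + 6 * Real.pi * (shiftedLog n)⁻¹ := by
  have hpi0 := Real.pi_pos
  have h := congrArg (coeff (2 * n)) (evenReturnSeries_mul_tailSeries 2)
  rw [coeff_mul, coeff_mk, Pi.one_apply, Finset.Nat.sum_antidiagonal_eq_sum_range_succ_mk,
    show (2 * n).succ = n + 1 + n by omega, Finset.sum_range_add] at h
  have h1 : ∑ x ∈ Finset.range (n + 1), coeff x (evenReturnSeries 2)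
        * coeff (2 * n - x) (tailSeries 2)
      ≤ (∑ i ∈ Finset.range (n + 1), coeff i (evenReturnSeries 2)) * coeff n (tailSeries 2) := by
    rw [Finset.sum_mul]
    refine Finset.sum_le_sum fun i hi => ?_
    refine mul_le_mul_of_nonneg_left ?_ (coeff_evenReturnSeries_nonneg 2 _)
    have := Finset.mem_range.1 hi
    exact antitone_coeff_tailSeries 2 (by omega)
  have h2 : ∑ x ∈ Finset.range n, coeff (n + 1 + x) (evenReturnSeries 2)
        * coeff (2 * n - (n + 1 + x)) (tailSeries 2)
      ≤ ∑ x ∈ Finset.range n, ((n : ℝ) + 1)⁻¹ * coeff (n - 1 - x) (tailSeries 2) := by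
    refine Finset.sum_le_sum fun x _ => ?_
    rw [show 2 * n - (n + 1 + x) = n - 1 - x by omega]
    refine mul_le_mul_of_nonneg_right ?_ (coeff_tailSeries_nonneg (by norm_num) _)
    exact (antitone_coeff_evenReturnSeries 2 (by omega : n ≤ n + 1 + x)).trans (planar_coeff_le n)
  rw [← Finset.mul_sum, Finset.sum_range_reflect (fun i => coeff i (tailSeries 2))] at h2
  have h3 : ∑ i ∈ Finset.range n, coeff i (tailSeries 2)
      ≤ 3 * Real.pi * (2 * ((n : ℝ) + 1) * (shiftedLog n)⁻¹) := by
    calc _ ≤ ∑ i ∈ Finset.range (n + 1), coeff i (tailSeries 2) :=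
          Finset.sum_le_sum_of_subset_of_nonneg (Finset.range_mono (Nat.le_succ n))
            fun i _ _ => coeff_tailSeries_nonneg (by norm_num) i
      _ ≤ ∑ i ∈ Finset.range (n + 1), 3 * Real.pi * (shiftedLog i)⁻¹ :=
          Finset.sum_le_sum fun i _ => coeff_tailSeries_le i
      _ ≤ _ := by
          rw [← Finset.mul_sum]
          exact mul_le_mul_of_nonneg_left (sum_inv_shiftedLog_le n) (by positivity)
  have h4 : ((n : ℝ) + 1)⁻¹ * ∑ i ∈ Finset.range n, coeff i (tailSeries 2)
      ≤ 6 * Real.pi * (shiftedLog n)⁻¹ := by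
    refine (mul_le_mul_of_nonneg_left h3 (by positivity)).trans (le_of_eq ?_)
    field_simp
    ring
  linarith

theorem abs_coeff_tailSeries_sub_le (n : ℕ) :
    |coeff n (tailSeries 2) - Real.pi * (shiftedLog n)⁻¹|
      ≤ 12 * Real.pi ^ 2 * (shiftedLog n)⁻¹ ^ 2 := by
  have hpi0 := Real.pi_pos
  have hl := shiftedLog_pos n
  have h1 := coeff_tailSeries_mul_sum_le n
  have h2 := one_le_coeff_tailSeries_mul n
  obtain ⟨h3, h4⟩ := planar_sum_coeff_bounds n
  have h5 := coeff_tailSeries_le n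
  have h6 := coeff_tailSeries_nonneg (d := 2) (by norm_num) n
  have h7 := mul_le_mul_of_nonneg_left h3 h6
  have h8 := mul_le_mul_of_nonneg_right h4 h6
  set r := coeff n (tailSeries 2)
  have h9 : |r * (shiftedLog n / Real.pi) - 1| ≤ 12 * Real.pi * (shiftedLog n)⁻¹ := by
    rw [abs_le]
    constructor <;> nlinarith [mul_pos hpi0 (inv_pos.2 hl)]
  have h10 : r - Real.pi * (shiftedLog n)⁻¹
      = (r * (shiftedLog n / Real.pi) - 1) * (Real.pi * (shiftedLog n)⁻¹) := by
    field_simp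
  have h11 : 0 ≤ Real.pi * (shiftedLog n)⁻¹ := by positivity
  rw [h10, abs_mul, abs_of_nonneg h11]
  exact (mul_le_mul_of_nonneg_right h9 h11).trans (le_of_eq (by ring))

end PlanarTail

/-! ### Dimension two: first returns and convolutions -/

section PlanarConvolution

open PowerSeries

theorem decayWeight_one (n : ℕ) : decayWeight 1 n = ((n : ℝ) + 1)⁻¹ := by
  unfold decayWeight
  rw [Real.rpow_neg_one]

theorem shiftedLog_mul_inv_le (n : ℕ) :
    shiftedLog n * ((n : ℝ) + 1)⁻¹ ≤ 2048 * (shiftedLog n)⁻¹ ^ 3 := by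
  have hl := shiftedLog_pos n
  have h := shiftedLog_pow_four_le n
  rw [← div_eq_mul_inv, inv_pow, ← div_eq_mul_inv, div_le_div_iff₀ (by positivity) (by positivity)]
  linarith

theorem sum_antidiagonal_evenFirstReturnSeries (d n : ℕ) :
    ∑ x ∈ antidiagonal n, coeff x.2 (evenFirstReturnSeries d) = 1 - coeff n (tailSeries d) := by
  rw [sum_antidiagonal_snd_eq_fst fun i => coeff i (evenFirstReturnSeries d),
    Finset.Nat.sum_antidiagonal_eq_sum_range_succ_mk, coeff_tailSeries]
  ring

/-- For exponent `1` the pointwise bound does not imply summability; that comes from the partial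
sums being at most `1`. -/
theorem hasDecay_planar : HasDecay 1 (evenFirstReturnSeries 2) := by
  have h0 := coeff_evenFirstReturnSeries_nonneg 2
  refine ⟨?_, 1, fun n => ?_⟩
  · simp only [abs_of_nonneg (h0 _)]
    refine summable_of_sum_range_le (c := 1) h0 fun n => ?_
    have h := coeff_tailSeries_nonneg (d := 2) (by norm_num) n
    rw [coeff_tailSeries, Finset.sum_range_succ] at h
    linarith [h0 n]
  · rw [abs_of_nonneg (h0 n), decayWeight_one, one_mul]
    exact (coeff_evenFirstReturnSeries_le 2 n).trans (planar_coeff_le n)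

/-- Replacing `n * u_n` by `1 / π` costs `O(1 / n)`. Convolved with `A = O(1 / n)` this is `O(log n
/ n)`, far below the required power of the logarithm. -/
theorem planar_derivative_mul_bound {A : ℝ⟦X⟧} (hA : HasDecay 1 A) : ∃ K : ℝ, 0 ≤ K ∧ ∀ n : ℕ,
    |coeff n (X * derivative ℝ (evenReturnSeries 2) * A)
      - 1 / Real.pi * coeff n (PowerSeries.mk 1 * A)| ≤ K * (shiftedLog n)⁻¹ ^ 3 := by
  obtain ⟨C, hC⟩ := hA.bound
  simp only [decayWeight_one] at hC
  have hC0 : 0 ≤ C := nonneg_of_mul_nonneg_left ((abs_nonneg _).trans (hC 0)) (by positivity)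
  refine ⟨8192 * C, by positivity, fun n => ?_⟩
  rw [coeff_X_mul_derivative_mul, coeff_mul, Finset.mul_sum, ← Finset.sum_sub_distrib]
  simp only [coeff_mk, Pi.one_apply, one_mul, ← sub_mul]
  have hterm : ∀ x ∈ antidiagonal n, |(x.1 * coeff x.1 (evenReturnSeries 2) - 1 / Real.pi)
      * coeff x.2 A| ≤ C * ((n : ℝ) + 1)⁻¹ * (((x.1 : ℝ) + 1)⁻¹ + ((x.2 : ℝ) + 1)⁻¹) := by
    rintro ⟨i, j⟩ hx
    have hij : (n : ℝ) = i + j := by exact_mod_cast (mem_antidiagonal.1 hx).symm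
    simp only
    rw [abs_mul]
    refine (mul_le_mul (planar_mul_coeff_bound i) (hC j) (abs_nonneg _) (by positivity)).trans ?_
    have h1 : ((i : ℝ) + 1)⁻¹ + ((j : ℝ) + 1)⁻¹
        = ((n : ℝ) + 2) * (((i : ℝ) + 1)⁻¹ * ((j : ℝ) + 1)⁻¹) := by
      rw [hij]
      field_simp
      ring
    have h2 : 1 ≤ ((n : ℝ) + 1)⁻¹ * ((n : ℝ) + 2) := by
      rw [inv_mul_eq_div, one_le_div (by positivity)]
      linarith
    rw [h1]
    calc _ = C * (((i : ℝ) + 1)⁻¹ * ((j : ℝ) + 1)⁻¹) * 1 := by ring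
      _ ≤ C * (((i : ℝ) + 1)⁻¹ * ((j : ℝ) + 1)⁻¹) * (((n : ℝ) + 1)⁻¹ * ((n : ℝ) + 2)) := by gcongr
      _ = _ := by ring
  refine (Finset.abs_sum_le_sum_abs _ _).trans ((Finset.sum_le_sum hterm).trans ?_)
  rw [← Finset.mul_sum, Finset.sum_add_distrib,
    sum_antidiagonal_snd_eq_fst fun i => ((i : ℝ) + 1)⁻¹,
    Finset.Nat.sum_antidiagonal_eq_sum_range_succ_mk]
  have h3 := sum_inv_succ_le n
  calc _ ≤ C * ((n : ℝ) + 1)⁻¹ * (2 * shiftedLog n + 2 * shiftedLog n) := by gcongr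
    _ = 4 * C * (shiftedLog n * ((n : ℝ) + 1)⁻¹) := by ring
    _ ≤ 4 * C * (2048 * (shiftedLog n)⁻¹ ^ 3) :=
      mul_le_mul_of_nonneg_left (shiftedLog_mul_inv_le n) (by positivity)
    _ = _ := by ring

theorem coeff_tailSeries_mul_one_sub (d n : ℕ) :
    coeff n (tailSeries d * (1 - evenFirstReturnSeries d)) = coeff n (tailSeries d) ^ 2
      - ∑ x ∈ antidiagonal n, (coeff x.1 (tailSeries d) - coeff n (tailSeries d))
          * coeff x.2 (evenFirstReturnSeries d) := by
  simp only [sub_mul, Finset.sum_sub_distrib]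
  rw [← Finset.mul_sum, sum_antidiagonal_evenFirstReturnSeries, ← coeff_mul, mul_sub, mul_one,
    map_sub]
  ring

/-- The renewal identity for `k = 1` expresses `n * f_n` through `R * (1 - V) / π`. Its coefficient
is at most `r_n ^ 2`, since the correction in `coeff_tailSeries_mul_one_sub` has a sign by
monotonicity. -/
theorem planar_first_return_bound : ∃ D : ℝ, 0 ≤ D ∧ ∀ n : ℕ,
    coeff n (evenFirstReturnSeries 2) ≤ D * logDecayWeight n := by
  have hg := ((HasDecay.one 1).sub hasDecay_planar).pow zero_le_one 2
  obtain ⟨K, hK0, hK⟩ := planar_derivative_mul_bound hg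
  have hpi0 := Real.pi_pos
  refine ⟨2 * (9 * Real.pi + K), by positivity, fun n => ?_⟩
  have hl := shiftedLog_pos n
  have hu : 0 < (shiftedLog n)⁻¹ := inv_pos.2 hl
  have hu1 := inv_shiftedLog_le_one n
  have h1 := coeff_pow_of_renewal (evenReturnSeries_renewal 2) le_rfl n
  rw [pow_one, Nat.sub_self, pow_zero, mul_one, Nat.cast_one, div_one] at h1
  have h2 := (abs_le.1 (hK n)).2
  rw [← h1, show PowerSeries.mk 1 * (1 - evenFirstReturnSeries 2) ^ 2
    = tailSeries 2 * (1 - evenFirstReturnSeries 2) by rw [tailSeries]; ring,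
    coeff_tailSeries_mul_one_sub] at h2
  have h3 : 0 ≤ ∑ x ∈ antidiagonal n, (coeff x.1 (tailSeries 2) - coeff n (tailSeries 2))
      * coeff x.2 (evenFirstReturnSeries 2) := by
    refine Finset.sum_nonneg fun x hx => mul_nonneg (sub_nonneg.2 ?_)
      (coeff_evenFirstReturnSeries_nonneg 2 _)
    exact antitone_coeff_tailSeries 2 (by rw [← mem_antidiagonal.1 hx]; omega)
  have h4 := pow_le_pow_left₀ (coeff_tailSeries_nonneg (d := 2) (by norm_num) n)
    (coeff_tailSeries_le n) 2
  set f := coeff n (evenFirstReturnSeries 2) with hf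
  have hf0 : 0 ≤ f := coeff_evenFirstReturnSeries_nonneg 2 n
  have h5 : 1 / Real.pi * (coeff n (tailSeries 2) ^ 2
      - ∑ x ∈ antidiagonal n, (coeff x.1 (tailSeries 2) - coeff n (tailSeries 2))
          * coeff x.2 (evenFirstReturnSeries 2)) ≤ 9 * Real.pi * (shiftedLog n)⁻¹ ^ 2 := by
    calc _ ≤ 1 / Real.pi * (3 * Real.pi * (shiftedLog n)⁻¹) ^ 2 := by
          refine mul_le_mul_of_nonneg_left ?_ (by positivity)
          linarith
      _ = _ := by
          field_simp
          ring
  have h6 : K * (shiftedLog n)⁻¹ ^ 3 ≤ K * (shiftedLog n)⁻¹ ^ 2 :=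
    mul_le_mul_of_nonneg_left (pow_le_pow_of_le_one hu.le hu1 (by norm_num)) hK0
  have h7 : n * f ≤ (9 * Real.pi + K) * (shiftedLog n)⁻¹ ^ 2 := by linarith
  have h8 : ((n : ℝ) + 1) * f ≤ 2 * (n * f) := by
    cases n with
    | zero =>
      rw [coeff_zero_eq_constantCoeff_apply, constantCoeff_evenFirstReturnSeries] at hf
      simp [hf]
    | succ n =>
      push_cast
      nlinarith [Nat.cast_nonneg (α := ℝ) n]
  unfold logDecayWeight
  rw [mul_inv, ← mul_assoc, mul_right_comm, ← div_eq_mul_inv _ ((n : ℝ) + 1),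
    le_div_iff₀ (by positivity), ← inv_pow]
  linarith

theorem coeff_tailSeries_sub_le {B : ℝ} {d j i : ℕ}
    (h : ∀ m, j < m → m ≤ j + i → coeff m (evenFirstReturnSeries d) ≤ B) :
    coeff j (tailSeries d) - coeff (j + i) (tailSeries d) ≤ i * B := by
  induction i with
  | zero => simp
  | succ i ih =>
    have h1 := ih fun m hm hm' => h m hm (by omega)
    have h2 := h (j + i + 1) (by omega) (by omega)
    rw [coeff_tailSeries d (j + i)] at h1
    rw [← add_assoc, coeff_tailSeries d (j + i + 1), Finset.sum_range_succ]
    push_cast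
    linarith

theorem planar_tail_mul_one_sub_bound : ∃ C : ℝ, 0 ≤ C ∧ ∀ n : ℕ,
    |coeff n (tailSeries 2 * (1 - evenFirstReturnSeries 2)) - Real.pi ^ 2 * (shiftedLog n)⁻¹ ^ 2|
      ≤ C * (shiftedLog n)⁻¹ ^ 3 := by
  obtain ⟨D, hD0, hD⟩ := planar_first_return_bound
  have hpi0 := Real.pi_pos
  set M := 24 * Real.pi * D + 8 * D ^ 2 with hM
  refine ⟨48 * Real.pi ^ 3 + 4 * M, by positivity, fun n => ?_⟩
  have hu : 0 < (shiftedLog n)⁻¹ := inv_pos.2 (shiftedLog_pos n)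
  have hr0 := coeff_tailSeries_nonneg (d := 2) (by norm_num)
  have hf0 := coeff_evenFirstReturnSeries_nonneg 2
  rw [coeff_tailSeries_mul_one_sub]
  have h1 : 0 ≤ ∑ x ∈ antidiagonal n, (coeff x.1 (tailSeries 2) - coeff n (tailSeries 2))
      * coeff x.2 (evenFirstReturnSeries 2) := by
    refine Finset.sum_nonneg fun x hx => mul_nonneg (sub_nonneg.2 ?_) (hf0 _)
    exact antitone_coeff_tailSeries 2 (by rw [← mem_antidiagonal.1 hx]; omega)
  have h2 : ∑ x ∈ antidiagonal n, (coeff x.1 (tailSeries 2) - coeff n (tailSeries 2))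
      * coeff x.2 (evenFirstReturnSeries 2) ≤ 4 * M * (shiftedLog n)⁻¹ ^ 3 := by
    refine sum_antidiagonal_le_of_log_bound (by positivity) ?_
    rintro ⟨j, i⟩ hx
    have hji : j + i = n := mem_antidiagonal.1 hx
    simp only
    have hw := logDecayWeight_pos n
    have hui : 0 < (shiftedLog i)⁻¹ := inv_pos.2 (shiftedLog_pos i)
    have huj : 0 < (shiftedLog j)⁻¹ := inv_pos.2 (shiftedLog_pos j)
    -- For large `i` the bound on `f_i` is of the right size. For small `i` the difference `r_j -
    -- r_n` is a sum of `i` terms `f_m` with `m > j ≥ n / 2`, and `i * f_i` is bounded by an inverse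
    -- logarithm.
    by_cases h : n ≤ 2 * i
    · have h3 : coeff i (evenFirstReturnSeries 2) ≤ D * (8 * logDecayWeight n) :=
        (hD i).trans (mul_le_mul_of_nonneg_left (logDecayWeight_le (by omega)) hD0)
      have h4 : coeff j (tailSeries 2) - coeff n (tailSeries 2)
          ≤ 3 * Real.pi * (shiftedLog j)⁻¹ := by
        linarith [hr0 n, coeff_tailSeries_le j]
      calc _ ≤ (3 * Real.pi * (shiftedLog j)⁻¹) * (D * (8 * logDecayWeight n)) :=
            mul_le_mul h4 h3 (hf0 i) (by positivity)
        _ = 24 * Real.pi * D * (logDecayWeight n * (shiftedLog j)⁻¹) := by ring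
        _ ≤ M * (logDecayWeight n * (shiftedLog j)⁻¹) := by
            refine mul_le_mul_of_nonneg_right ?_ (by positivity)
            rw [hM]
            linarith [sq_nonneg D]
        _ ≤ _ := by
            rw [mul_assoc M, mul_add (logDecayWeight n)]
            refine mul_le_mul_of_nonneg_left ?_ (by positivity)
            linarith [mul_pos hw hui]
    · have h3 : coeff j (tailSeries 2) - coeff n (tailSeries 2)
          ≤ i * (D * (8 * logDecayWeight n)) := by
        rw [← hji]
        refine coeff_tailSeries_sub_le fun m hm hm' => (hD m).trans ?_
        exact mul_le_mul_of_nonneg_left (logDecayWeight_le (by omega)) hD0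
      have h4 : i * coeff i (evenFirstReturnSeries 2) ≤ D * (shiftedLog i)⁻¹ := by
        have h5 := succ_mul_logDecayWeight i
        have h6 : (shiftedLog i ^ 2)⁻¹ ≤ (shiftedLog i)⁻¹ := by
          rw [← inv_pow]
          exact pow_le_of_le_one hui.le (inv_shiftedLog_le_one i) two_ne_zero
        have h7 := logDecayWeight_pos i
        calc _ ≤ i * (D * logDecayWeight i) := by
              gcongr
              exact hD i
          _ = D * (i * logDecayWeight i) := by ring
          _ ≤ _ := by
              refine mul_le_mul_of_nonneg_left ?_ hD0
              linarith
      calc _ ≤ (i * (D * (8 * logDecayWeight n))) * coeff i (evenFirstReturnSeries 2) :=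
            mul_le_mul_of_nonneg_right h3 (hf0 i)
        _ = 8 * D * logDecayWeight n * (i * coeff i (evenFirstReturnSeries 2)) := by ring
        _ ≤ 8 * D * logDecayWeight n * (D * (shiftedLog i)⁻¹) :=
            mul_le_mul_of_nonneg_left h4 (by positivity)
        _ = 8 * D ^ 2 * (logDecayWeight n * (shiftedLog i)⁻¹) := by ring
        _ ≤ M * (logDecayWeight n * (shiftedLog i)⁻¹) := by
            refine mul_le_mul_of_nonneg_right ?_ (by positivity)
            rw [hM]
            linarith [mul_nonneg hpi0.le hD0]
        _ ≤ _ := by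
            rw [mul_assoc M, mul_add (logDecayWeight n)]
            refine mul_le_mul_of_nonneg_left ?_ (by positivity)
            linarith [mul_pos hw huj]
  have h3 : |coeff n (tailSeries 2) ^ 2 - Real.pi ^ 2 * (shiftedLog n)⁻¹ ^ 2|
      ≤ 48 * Real.pi ^ 3 * (shiftedLog n)⁻¹ ^ 3 := by
    have h4 := abs_coeff_tailSeries_sub_le n
    have h5 := coeff_tailSeries_le n
    have h6 : coeff n (tailSeries 2) ^ 2 - Real.pi ^ 2 * (shiftedLog n)⁻¹ ^ 2
        = (coeff n (tailSeries 2) - Real.pi * (shiftedLog n)⁻¹)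
          * (coeff n (tailSeries 2) + Real.pi * (shiftedLog n)⁻¹) := by ring
    have h7 : 0 ≤ coeff n (tailSeries 2) + Real.pi * (shiftedLog n)⁻¹ :=
      add_nonneg (hr0 n) (by positivity)
    rw [h6, abs_mul, abs_of_nonneg h7]
    calc _ ≤ (12 * Real.pi ^ 2 * (shiftedLog n)⁻¹ ^ 2) * (4 * Real.pi * (shiftedLog n)⁻¹) :=
          mul_le_mul h4 (by linarith) h7 (by positivity)
      _ = _ := by ring
  have h4 := abs_le.1 h3
  rw [abs_le, add_mul]
  constructor <;> linarith [h4.1, h4.2]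

theorem abs_sub_inv_sq_le {j n : ℕ} (hjn : j ≤ n) (h : n ≤ 2 * j + 1) :
    |(shiftedLog j)⁻¹ ^ 2 - (shiftedLog n)⁻¹ ^ 2| ≤ 6 * (shiftedLog n)⁻¹ ^ 3 := by
  have hj := shiftedLog_pos j
  have hn := shiftedLog_pos n
  have h1 := inv_shiftedLog_le h
  have h2 : (shiftedLog j)⁻¹ - (shiftedLog n)⁻¹
      = (shiftedLog n - shiftedLog j) * ((shiftedLog j)⁻¹ * (shiftedLog n)⁻¹) := by
    field_simp
  have h3 := monotone_shiftedLog hjn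
  have h4 := shiftedLog_le_add_one h
  set u := (shiftedLog j)⁻¹ with hu
  set v := (shiftedLog n)⁻¹ with hv
  have hu0 : 0 < u := inv_pos.2 hj
  have hv0 : 0 < v := inv_pos.2 hn
  have h5 : 0 ≤ u - v := by
    rw [h2]
    exact mul_nonneg (by linarith) (by positivity)
  have h6 : u - v ≤ 2 * v ^ 2 := by
    rw [h2]
    calc _ ≤ 1 * (u * v) := mul_le_mul_of_nonneg_right (by linarith) (by positivity)
      _ ≤ 1 * (2 * v * v) := by gcongr
      _ = _ := by ring
  have h7 : u ^ 2 - v ^ 2 = (u - v) * (u + v) := by ring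
  rw [h7, abs_of_nonneg (mul_nonneg h5 (by positivity))]
  calc _ ≤ (2 * v ^ 2) * (3 * v) := mul_le_mul h6 (by linarith) (by positivity) (by positivity)
    _ = _ := by ring

/-- Multiplying by `V` averages the coefficients of `A` over a probability distribution. Their main
term varies slowly, so only the missing mass `r_n` and the oscillation of `A` contribute, both one
logarithm smaller. -/
theorem planar_mul_evenFirstReturnSeries {A : ℝ⟦X⟧} {c : ℝ} (hc : 0 ≤ c)
    (hA : ∃ C : ℝ, 0 ≤ C ∧ ∀ n : ℕ,
      |coeff n A - c * (shiftedLog n)⁻¹ ^ 2| ≤ C * (shiftedLog n)⁻¹ ^ 3) :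
    ∃ C : ℝ, 0 ≤ C ∧ ∀ n : ℕ,
      |coeff n (A * evenFirstReturnSeries 2) - c * (shiftedLog n)⁻¹ ^ 2|
        ≤ C * (shiftedLog n)⁻¹ ^ 3 := by
  obtain ⟨C, hC0, hC⟩ := hA
  obtain ⟨D, hD0, hD⟩ := planar_first_return_bound
  have hpi0 := Real.pi_pos
  have hu : ∀ n, 0 < (shiftedLog n)⁻¹ := fun n => inv_pos.2 (shiftedLog_pos n)
  have hu1 := inv_shiftedLog_le_one
  have hf0 := coeff_evenFirstReturnSeries_nonneg 2
  have hr0 := coeff_tailSeries_nonneg (d := 2) (by norm_num)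
  have hA2 : ∀ n, |coeff n A| ≤ (c + C) * (shiftedLog n)⁻¹ ^ 2 := fun n => by
    have h1 : C * (shiftedLog n)⁻¹ ^ 3 ≤ C * (shiftedLog n)⁻¹ ^ 2 :=
      mul_le_mul_of_nonneg_left (pow_le_pow_of_le_one (hu n).le (hu1 n) (by norm_num)) hC0
    have h2 := abs_le.1 (hC n)
    have h3 : 0 ≤ c * (shiftedLog n)⁻¹ ^ 2 := mul_nonneg hc (sq_nonneg _)
    rw [abs_le, add_mul]
    constructor <;> linarith [h2.1, h2.2]
  have hA1 : ∀ n, |coeff n A| ≤ (c + C) * (shiftedLog n)⁻¹ := fun n =>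
    (hA2 n).trans (mul_le_mul_of_nonneg_left
      (pow_le_of_le_one (hu n).le (hu1 n) two_ne_zero) (by positivity))
  refine ⟨C + 3 * Real.pi * (c + C) + 4 * (16 * (c + C) * D) + (9 * C + 6 * c), by positivity,
    fun n => ?_⟩
  set v := (shiftedLog n)⁻¹ with hv
  -- For `i < n / 2` the difference of `A` is small uniformly; this part is subtracted in proportion
  -- to `f_i` and later summed using that the `f_i` have total at most `1`.
  have hterm : ∀ x ∈ antidiagonal n,
      |(coeff x.1 A - coeff n A) * coeff x.2 (evenFirstReturnSeries 2)|
        - (9 * C + 6 * c) * v ^ 3 * coeff x.2 (evenFirstReturnSeries 2)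
      ≤ 16 * (c + C) * D * logDecayWeight n * ((shiftedLog x.1)⁻¹ + (shiftedLog x.2)⁻¹) := by
    rintro ⟨j, i⟩ hx
    have hji : j + i = n := mem_antidiagonal.1 hx
    simp only
    have hw := logDecayWeight_pos n
    rw [abs_mul, abs_of_nonneg (hf0 i)]
    have hrhs : 0 ≤ 16 * (c + C) * D * logDecayWeight n * (shiftedLog i)⁻¹ := by
      have := hu i
      positivity
    have hv0 : 0 < v := hu n
    by_cases h : n ≤ 2 * i
    · have h3 : coeff i (evenFirstReturnSeries 2) ≤ D * (8 * logDecayWeight n) :=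
        (hD i).trans (mul_le_mul_of_nonneg_left (logDecayWeight_le (by omega)) hD0)
      have h4 : v ≤ (shiftedLog j)⁻¹ :=
        inv_anti₀ (shiftedLog_pos j) (monotone_shiftedLog (by omega))
      have h5 : |coeff j A - coeff n A| ≤ 2 * (c + C) * (shiftedLog j)⁻¹ := by
        have h6 := mul_le_mul_of_nonneg_left h4 (show 0 ≤ c + C by positivity)
        linarith [abs_sub (coeff j A) (coeff n A), hA1 j, hA1 n]
      have h6 : 0 ≤ (9 * C + 6 * c) * v ^ 3 * coeff i (evenFirstReturnSeries 2) := by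
        have := hf0 i
        positivity
      have h7 : |coeff j A - coeff n A| * coeff i (evenFirstReturnSeries 2)
          ≤ (2 * (c + C) * (shiftedLog j)⁻¹) * (D * (8 * logDecayWeight n)) :=
        mul_le_mul h5 h3 (hf0 i) (by have := hu j; positivity)
      rw [mul_add]
      linarith
    · have h3 := abs_le.1 (hC j)
      have h4 := abs_le.1 (hC n)
      have h5 := abs_le.1 (abs_sub_inv_sq_le (show j ≤ n by omega) (show n ≤ 2 * j + 1 by omega))
      have h6 : (shiftedLog j)⁻¹ ^ 3 ≤ 8 * v ^ 3 := by
        refine (pow_le_pow_left₀ (hu j).le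
          (inv_shiftedLog_le (show n ≤ 2 * j + 1 by omega)) 3).trans (le_of_eq ?_)
        rw [← hv]
        ring
      have h7 := mul_le_mul_of_nonneg_left h6 hC0
      have h8 := mul_le_mul_of_nonneg_left h5.1 hc
      have h9 := mul_le_mul_of_nonneg_left h5.2 hc
      have h10 : |coeff j A - coeff n A| ≤ (9 * C + 6 * c) * v ^ 3 := by
        rw [abs_le]
        constructor <;> linarith [h3.1, h3.2, h4.1, h4.2]
      have h11 := mul_le_mul_of_nonneg_right h10 (hf0 i)
      have h12 : 0 ≤ 16 * (c + C) * D * logDecayWeight n * (shiftedLog j)⁻¹ := by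
        have := hu j
        positivity
      rw [mul_add]
      linarith
  have hmain := sum_antidiagonal_le_of_log_bound (by positivity) hterm
  rw [Finset.sum_sub_distrib, ← Finset.mul_sum, sum_antidiagonal_evenFirstReturnSeries] at hmain
  have h1 := Finset.abs_sum_le_sum_abs (fun x : ℕ × ℕ =>
    (coeff x.1 A - coeff n A) * coeff x.2 (evenFirstReturnSeries 2)) (antidiagonal n)
  have h2 : coeff n (A * evenFirstReturnSeries 2)
      = ∑ x ∈ antidiagonal n, (coeff x.1 A - coeff n A) * coeff x.2 (evenFirstReturnSeries 2)
        + coeff n A * (1 - coeff n (tailSeries 2)) := by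
    simp only [sub_mul, Finset.sum_sub_distrib]
    rw [← Finset.mul_sum, sum_antidiagonal_evenFirstReturnSeries, ← coeff_mul]
    ring
  have h3 : |coeff n A * coeff n (tailSeries 2)| ≤ 3 * Real.pi * (c + C) * v ^ 3 := by
    rw [abs_mul, abs_of_nonneg (hr0 n)]
    have hv0 : 0 < v := hu n
    calc _ ≤ ((c + C) * v ^ 2) * (3 * Real.pi * v) :=
          mul_le_mul (hA2 n) (coeff_tailSeries_le n) (hr0 n) (by positivity)
      _ = _ := by ring
  have h4 : (9 * C + 6 * c) * v ^ 3 * (1 - coeff n (tailSeries 2)) ≤ (9 * C + 6 * c) * v ^ 3 := by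
    have hv0 : 0 < v := hu n
    exact mul_le_of_le_one_right (by positivity) (by linarith [hr0 n])
  have h5 := abs_le.1 (hC n)
  have h6 := abs_le.1 h3
  have h7 := abs_le.1 (h1.trans (by linarith [hmain] : _ ≤ 4 * (16 * (c + C) * D) * v ^ 3
    + (9 * C + 6 * c) * v ^ 3))
  rw [h2, abs_le]
  simp only [add_mul]
  constructor <;> linarith [h5.1, h5.2, h6.1, h6.2, h7.1, h7.2]

theorem planar_tail_mul_pow_bound (k : ℕ) : ∃ C : ℝ, 0 ≤ C ∧ ∀ n : ℕ,
    |coeff n (tailSeries 2 * (1 - evenFirstReturnSeries 2) * evenFirstReturnSeries 2 ^ k)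
      - Real.pi ^ 2 * (shiftedLog n)⁻¹ ^ 2| ≤ C * (shiftedLog n)⁻¹ ^ 3 := by
  induction k with
  | zero => simpa using planar_tail_mul_one_sub_bound
  | succ k ih =>
    rw [pow_succ, ← mul_assoc]
    exact planar_mul_evenFirstReturnSeries (by positivity) ih

end PlanarConvolution

/-! ### Dimension two: moments -/

section Planar

open PowerSeries

theorem planar_inv_coeff_bound (n : ℕ) :
    |1 / coeff n (evenReturnSeries 2) - Real.pi * n| ≤ 2 := by
  obtain ⟨h1, h2⟩ := planar_coeff_bounds n
  have ha := coeff_evenReturnSeries_pos (d := 2) (by norm_num) n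
  have h3 : Real.pi * n ≤ 1 / coeff n (evenReturnSeries 2) := (le_div_iff₀ ha).2 h1
  have h4 : 1 / coeff n (evenReturnSeries 2) ≤ Real.pi * (n + 1 / 2) := (div_le_iff₀ ha).2 h2
  rw [abs_of_nonneg (by linarith)]
  linarith [Real.pi_le_four]

theorem inv_pow_log_sub_le {n : ℕ} (hn : 8 ≤ n) (m : ℕ) :
    (shiftedLog n)⁻¹ ^ m ≤ (Real.log n)⁻¹ ^ m ∧
      (Real.log n)⁻¹ ^ m - (shiftedLog n)⁻¹ ^ m ≤ m * (Real.log n)⁻¹ ^ (m + 1) := by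
  have hn' : (8 : ℝ) ≤ n := by exact_mod_cast hn
  have hn0 : (0 : ℝ) < n := by linarith
  have hL : 2 ≤ Real.log n := by
    have h := two_le_shiftedLog 0
    unfold shiftedLog at h
    rw [Nat.cast_zero, zero_add] at h
    exact h.trans (Real.log_le_log (by norm_num) hn')
  have hlow : Real.log n ≤ shiftedLog n := Real.log_le_log hn0 (by linarith)
  have hup : shiftedLog n ≤ Real.log n + 1 := by
    have h : shiftedLog n ≤ Real.log (2 * n) := Real.log_le_log (by positivity) (by linarith)
    rw [Real.log_mul two_ne_zero hn0.ne'] at h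
    linarith [Real.log_two_lt_d9]
  have hl := shiftedLog_pos n
  have hL0 : 0 < Real.log n := by linarith
  have hxy : (Real.log n)⁻¹ - (shiftedLog n)⁻¹
      = (shiftedLog n - Real.log n) * ((Real.log n)⁻¹ * (shiftedLog n)⁻¹) := by
    field_simp
  have hyx : (shiftedLog n)⁻¹ ≤ (Real.log n)⁻¹ := inv_anti₀ hL0 hlow
  have hx1 : (Real.log n)⁻¹ ≤ 1 := inv_le_one_of_one_le₀ (by linarith)
  set x := (Real.log n)⁻¹ with hx
  set y := (shiftedLog n)⁻¹ with hy
  have hx0 : 0 < x := inv_pos.2 hL0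
  have hy0 : 0 < y := inv_pos.2 hl
  refine ⟨pow_le_pow_left₀ hy0.le hyx m, ?_⟩
  -- Since `log (n + 8) ≤ log n + 1`, the reciprocals differ by at most `x ^ 2`; Bernoulli's
  -- inequality then handles the power `m`.
  have h1 : x * (1 - x) ≤ y := by
    have h2 : x - y ≤ 1 * (x * x) := by
      rw [hxy]
      exact mul_le_mul (by linarith) (mul_le_mul_of_nonneg_left hyx hx0.le) (by positivity)
        zero_le_one
    linarith
  have h2 := pow_le_pow_left₀ (mul_nonneg hx0.le (by linarith)) h1 m
  have h3 := one_add_mul_le_pow (show -2 ≤ -x by linarith) m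
  have h4 := mul_le_mul_of_nonneg_left h3 (pow_nonneg hx0.le m)
  rw [mul_pow, show 1 - x = 1 + -x by ring] at h2
  have h5 : x ^ m * (1 + m * -x) = x ^ m - m * x ^ (m + 1) := by ring
  linarith

/-- Applied with `m = 1`, `c = 1` to the range and with `m = 2`, `c = π` to the multiplicities. The
condition `m ≤ 2` lets the third-order error of `planar_derivative_mul_bound` be absorbed. -/
theorem planar_isBigO {A : ℝ⟦X⟧} (hA : HasDecay 1 A) {c : ℝ} (hc : 0 < c) {m : ℕ} (hm : m ≤ 2)
    (ht : ∃ C : ℝ, 0 ≤ C ∧ ∀ n : ℕ,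
      |coeff n (PowerSeries.mk 1 * A) - Real.pi * c * (shiftedLog n)⁻¹ ^ m|
        ≤ C * (shiftedLog n)⁻¹ ^ (m + 1)) :
    (fun n : ℕ => 2 * coeff n (X * derivative ℝ (evenReturnSeries 2) * A)
        / coeff n (evenReturnSeries 2) - 2 * (n : ℝ) * (Real.pi * c) / Real.log n ^ m)
      =O[atTop] fun n : ℕ => 2 * (n : ℝ) * (Real.pi * c) / Real.log n ^ m * (1 / Real.log n) := by
  obtain ⟨C, hC0, hC⟩ := ht
  obtain ⟨K, hK0, hK⟩ := planar_derivative_mul_bound hA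
  have hpi0 := Real.pi_pos
  set M := C + K with hM
  have hM0 : 0 ≤ M := by positivity
  refine IsBigO.of_bound ((4 * (c + M) + 2 * Real.pi * M + 2 * Real.pi * c * m)
    / (2 * (Real.pi * c))) ?_
  filter_upwards [eventually_ge_atTop 8] with n hn
  obtain ⟨h1, h2⟩ := inv_pow_log_sub_le hn m
  have h1' := (inv_pow_log_sub_le hn (m + 1)).1
  have hn' : (8 : ℝ) ≤ n := by exact_mod_cast hn
  have hn0 : (0 : ℝ) < n := by linarith
  have hL0 : 0 < Real.log n := Real.log_pos (by linarith)
  -- The error of `1 / u_n` is bounded and comes without a factor `n`; this inequality fits it into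
  -- the common bound.
  have hnL : 1 ≤ n * (Real.log n)⁻¹ := by
    rw [← div_eq_mul_inv, one_le_div hL0]
    exact Real.log_le_self hn0.le
  have hy0 : 0 < (shiftedLog n)⁻¹ := inv_pos.2 (shiftedLog_pos n)
  have hy1 := inv_shiftedLog_le_one n
  have hx0 : 0 < (Real.log n)⁻¹ := inv_pos.2 hL0
  have hdiff : |coeff n (X * derivative ℝ (evenReturnSeries 2) * A) - c * (shiftedLog n)⁻¹ ^ m|
      ≤ M * (shiftedLog n)⁻¹ ^ (m + 1) := by
    have h3 : K * (shiftedLog n)⁻¹ ^ 3 ≤ K * (shiftedLog n)⁻¹ ^ (m + 1) :=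
      mul_le_mul_of_nonneg_left (pow_le_pow_of_le_one hy0.le hy1 (by omega)) hK0
    have h4 : 1 / Real.pi * |coeff n (PowerSeries.mk 1 * A) - Real.pi * c * (shiftedLog n)⁻¹ ^ m|
        ≤ C * (shiftedLog n)⁻¹ ^ (m + 1) := by
      refine le_trans ?_ (hC n)
      refine mul_le_of_le_one_left (abs_nonneg _) ?_
      rw [div_le_one hpi0]
      linarith [Real.two_le_pi]
    rw [← abs_of_pos (one_div_pos.2 hpi0), ← abs_mul, mul_sub,
      show 1 / Real.pi * (Real.pi * c * (shiftedLog n)⁻¹ ^ m) = c * (shiftedLog n)⁻¹ ^ m by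
        field_simp] at h4
    have h5 := abs_le.1 h4
    have h6 := abs_le.1 (hK n)
    rw [abs_le, hM, add_mul]
    constructor <;> linarith [h5.1, h5.2, h6.1, h6.2]
  have hinv := planar_inv_coeff_bound n
  set q := coeff n (X * derivative ℝ (evenReturnSeries 2) * A)
  set a := coeff n (evenReturnSeries 2)
  set x := (Real.log n)⁻¹ with hx
  set y := (shiftedLog n)⁻¹ with hy
  have hq : |q| ≤ (c + M) * (n * x ^ (m + 1)) := by
    have h3 : M * y ^ (m + 1) ≤ M * y ^ m :=
      mul_le_mul_of_nonneg_left (pow_le_pow_of_le_one hy0.le hy1 (Nat.le_succ m)) hM0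
    have h4 : |q| ≤ (c + M) * y ^ m := by
      have h5 := abs_le.1 hdiff
      have h6 : 0 ≤ c * y ^ m := by positivity
      rw [abs_le, add_mul]
      constructor <;> linarith [h5.1, h5.2]
    refine h4.trans (mul_le_mul_of_nonneg_left (h1.trans ?_) (by positivity))
    calc x ^ m ≤ n * x * x ^ m := le_mul_of_one_le_left (by positivity) hnL
      _ = _ := by ring
  -- Three errors: `1 / u_n` against `π * n`, the numerator against its main term, and `log (n + 8)`
  -- against `log n`. The constant chosen above adds their bounds.
  have hsplit : 2 * q / a - 2 * (n : ℝ) * (Real.pi * c) / Real.log n ^ m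
      = 2 * (q * (1 / a - Real.pi * n)) + 2 * Real.pi * n * (q - c * y ^ m)
        - 2 * Real.pi * c * n * (x ^ m - y ^ m) := by
    rw [hx, inv_pow]
    ring
  have hrhs : 2 * (n : ℝ) * (Real.pi * c) / Real.log n ^ m * (1 / Real.log n)
      = 2 * (Real.pi * c) * (n * x ^ (m + 1)) := by
    rw [hx, pow_succ, inv_pow]
    ring
  rw [hsplit, hrhs, Real.norm_eq_abs, Real.norm_of_nonneg (by positivity),
    show ∀ S : ℝ, S / (2 * (Real.pi * c)) * (2 * (Real.pi * c) * (n * x ^ (m + 1)))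
      = S * (n * x ^ (m + 1)) from fun S => by field_simp]
  have b1 : |2 * (q * (1 / a - Real.pi * n))| ≤ 4 * (c + M) * (n * x ^ (m + 1)) := by
    rw [abs_mul, abs_two, abs_mul]
    calc _ ≤ 2 * ((c + M) * (n * x ^ (m + 1)) * 2) :=
          mul_le_mul_of_nonneg_left (mul_le_mul hq hinv (abs_nonneg _) (by positivity)) two_pos.le
      _ = _ := by ring
  have b2 : |2 * Real.pi * n * (q - c * y ^ m)| ≤ 2 * Real.pi * M * (n * x ^ (m + 1)) := by
    rw [abs_mul, abs_of_nonneg (by positivity)]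
    calc _ ≤ 2 * Real.pi * n * (M * x ^ (m + 1)) :=
          mul_le_mul_of_nonneg_left (hdiff.trans (mul_le_mul_of_nonneg_left h1' hM0))
            (by positivity)
      _ = _ := by ring
  have b3 : |2 * Real.pi * c * n * (x ^ m - y ^ m)|
      ≤ 2 * Real.pi * c * m * (n * x ^ (m + 1)) := by
    rw [abs_mul, abs_of_nonneg (by positivity), abs_of_nonneg (sub_nonneg.2 h1)]
    calc _ ≤ 2 * Real.pi * c * n * (m * x ^ (m + 1)) :=
          mul_le_mul_of_nonneg_left h2 (by positivity)
      _ = _ := by ring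
  rw [add_mul, add_mul]
  exact (abs_sub _ _).trans (add_le_add ((abs_add_le _ _).trans (add_le_add b1 b2)) b3)

theorem planar_multRange {k : ℕ} (hk : 1 ≤ k) :
    (fun n : ℕ => closedWalkMean 2 n (LatticeWalk.multRange k)
        - 2 * (n : ℝ) * Real.pi ^ 2 / Real.log n ^ 2)
      =O[atTop] fun n : ℕ => 2 * (n : ℝ) * Real.pi ^ 2 / Real.log n ^ 2 * (1 / Real.log n) := by
  have hV := hasDecay_planar
  have hA := (((HasDecay.one 1).sub hV).pow zero_le_one 2).mul zero_le_one
    (hV.pow zero_le_one (k - 1))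
  have hmul : PowerSeries.mk 1 * ((1 - evenFirstReturnSeries 2) ^ 2
        * evenFirstReturnSeries 2 ^ (k - 1))
      = tailSeries 2 * (1 - evenFirstReturnSeries 2) * evenFirstReturnSeries 2 ^ (k - 1) := by
    unfold tailSeries
    ring
  have h := planar_isBigO hA Real.pi_pos le_rfl (by
    rw [hmul, ← sq]
    exact planar_tail_mul_pow_bound (k - 1))
  rw [← sq] at h
  refine h.congr' ?_ EventuallyEq.rfl
  filter_upwards [eventually_gt_atTop 0] with n hn
  rw [closedWalkMean_multRange (by norm_num) hn hk]

theorem planar_range :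
    (fun n : ℕ => closedWalkMean 2 n LatticeWalk.range - 2 * (n : ℝ) * Real.pi / Real.log n)
      =O[atTop] fun n : ℕ => 2 * (n : ℝ) * Real.pi / Real.log n * (1 / Real.log n) := by
  have h := planar_isBigO ((HasDecay.one 1).sub hasDecay_planar) one_pos one_le_two
    ⟨12 * Real.pi ^ 2, by positivity, fun n => by
      rw [mul_one, pow_one]
      exact abs_coeff_tailSeries_sub_le n⟩
  simp only [mul_one, pow_one] at h
  refine h.congr' ?_ EventuallyEq.rfl
  filter_upwards [eventually_gt_atTop 0] with n hn
  rw [closedWalkMean_range (by norm_num) hn]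

end Planar

/-! ### Assembly of the theorem -/

theorem mainTheorem5 :
    -- the generating functions
    (∀ d : ℕ, 1 ≤ d → ∀ z : ℂ, ‖z‖ < 1 / (2 * (d : ℝ)) →
      IntegrableOn (walkIntegrand (0 : Fin d → ℤ) z) (Set.Ioi 0) ∧
      1 + walkH (0 : Fin d → ℤ) z ∈ Complex.slitPlane ∧
      DifferentiableAt ℂ (fun ζ : ℂ => walkH (0 : Fin d → ℤ) ζ) z ∧
      (∀ k : ℕ, 1 ≤ k →
        HasSum (fun w : closedWalks d => (w.1.multRange k : ℂ) * z ^ w.1.length)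
          (z * deriv (fun ζ : ℂ => (1 / (k : ℂ)) *
            (walkH (0 : Fin d → ℤ) ζ / (1 + walkH (0 : Fin d → ℤ) ζ)) ^ k) z)) ∧
      HasSum (fun w : closedWalks d => (w.1.range : ℂ) * z ^ w.1.length)
        (z * deriv (fun ζ : ℂ => Complex.log (1 + walkH (0 : Fin d → ℤ) ζ)) z)) ∧
    -- the values of `h(0, d, z)`
    (∀ z : ℂ, ‖z‖ < 1 / 2 →
      walkH (0 : Fin 1 → ℤ) z =
        (1 - Complex.sqrt (1 - 4 * z ^ 2)) / Complex.sqrt (1 - 4 * z ^ 2)) ∧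
    (∀ z : ℂ, ‖z‖ < 1 / 4 →
      walkH (0 : Fin 2 → ℤ) z = 2 / (Real.pi : ℂ) * ellipticK (16 * z ^ 2) - 1) ∧
    (∀ d : ℕ, 2 < d →
      IntegrableOn (walkGIntegrand d) (Set.Ioi 0) ∧
      0 < walkG d ∧
      walkH (0 : Fin d → ℤ) (1 / (2 * (d : ℂ))) = (walkG d : ℂ) ∧
      Tendsto (noReturnProb d) atTop (𝓝 (1 / (1 + walkG d)))) ∧
    -- the asymptotic first moment of the number of points of multiplicity `2 k`
    (∀ k : ℕ, 1 ≤ k →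
      ((fun n : ℕ => closedWalkMean 1 n (LatticeWalk.multRange k) - 1)
        =O[atTop] fun n : ℕ => 1 / (n : ℝ)) ∧
      ((fun n : ℕ => closedWalkMean 2 n (LatticeWalk.multRange k)
          - 2 * (n : ℝ) * Real.pi ^ 2 / Real.log n ^ 2)
        =O[atTop] fun n : ℕ =>
          2 * (n : ℝ) * Real.pi ^ 2 / Real.log n ^ 2 * (1 / Real.log n)) ∧
      (∀ d : ℕ, 2 < d →
        (fun n : ℕ => closedWalkMean d n (LatticeWalk.multRange k)
          - 2 * (n : ℝ) * (walkG d ^ (k - 1) / (1 + walkG d) ^ (k + 1)))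
        =O[atTop] transientError d)) ∧
    -- the asymptotic first moment of the range
    ((fun n : ℕ => closedWalkMean 1 n LatticeWalk.range - Real.sqrt (Real.pi * n))
      =O[atTop] fun n : ℕ => Real.sqrt (Real.pi * n) * (1 / (n : ℝ))) ∧
    ((fun n : ℕ => closedWalkMean 2 n LatticeWalk.range
        - 2 * (n : ℝ) * Real.pi / Real.log n)
      =O[atTop] fun n : ℕ =>
        2 * (n : ℝ) * Real.pi / Real.log n * (1 / Real.log n)) ∧
    (∀ d : ℕ, 2 < d →
      (fun n : ℕ => closedWalkMean d n LatticeWalk.range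
        - 2 * (n : ℝ) * (1 / (1 + walkG d)))
      =O[atTop] transientError d) := by
  refine ⟨fun d hd z hz => ⟨(integrableOn_walkIntegrand hd hz).1,
      Complex.mem_slitPlane_iff.2 (Or.inl (re_one_add_walkH_pos hd hz)),
      differentiableAt_walkH hd hz, fun k hk => hasSum_multRange hd hz hk, hasSum_range hd hz⟩,
    fun z hz => walkH_one hz, fun z hz => walkH_two hz,
    fun d hd => ⟨(transient_green hd).1, walkG_pos hd, (transient_green hd).2.1,
      tendsto_noReturnProb hd⟩,
    fun k hk => ⟨multRange_one_isBigO hk, planar_multRange hk, fun d hd => transient_multRange hd hk⟩,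
    range_one_isBigO, planar_range, fun d hd => transient_range hd⟩
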